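/- Let $(\Sigma,\mathtt j)$ be a connected Riemann surface (not necessarily compact) with a smooth Riemannian metric $ds^2_\Sigma$ conformal to $\mathtt j$, let $(M,J,g)$ be a Hermitian surface (a complex manifold of complex dimension $2$ with a smooth Riemannian metric $g$ such that $g(J\cdot,J\cdot)=g$), and let $f:\Sigma\to M$ be a smooth isometric immersion. A point $x\in\Sigma$ is *complex* if $df\circ\mathtt j=J\circ df$ at $x$, and *anticomplex* if $df\circ\mathtt j=-J\circ df$ at $x$. The Chern connection of $M$ is the connection on $TM$ which preserves $g$ and $J$ and whose torsion has vanishing $(1,1)$-part. Let $\nabla$ be the connection on $T^*\Sigma\otimes f^{-1}TM$ induced by the Levi-Civita connection of $\Sigma$ and the Chern connection of $M$. Assume that $f$ is *Chern minimal*, i.e. $\operatorname{tr}\nabla df=0$, and *generic*, i.e. not every point of $\Sigma$ is complex and not every point of $\Sigma$ is anticomplex. An *adapted frame* on an open set $U\subseteq\Sigma$ consists of a smooth $(1,0)$-form $\varphi$ on $U$ with $ds^2_\Sigma=\varphi\bar\varphi$, a smooth unitary frame of $f^{-1}TM$ over $U$ with dual coframe $\omega^1,\omega^2$, and smooth functions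 $s,t:U\to\mathbb C$ such that $f^*\omega^1=s\,\varphi$ and $f^*\omega^2=t\,\bar\varphi$. **Proposition 2.3.** (1) The complex points and the anticomplex points of $f$ are isolated: every complex or anticomplex point $x$ has a neighbourhood in which no point other than $x$ is complex or anticomplex. (2) Every point of $\Sigma$ has an open neighbourhood on which an adapted frame exists. For every $x\in\Sigma$ there are integers $p,q\ge 0$, with $p>0$ if and only if $x$ is anticomplex, and $q>0$ if and only if $x$ is complex, such that for every adapted frame on an open neighbourhood of $x$ and every holomorphic coordinate $z$ of $\Sigma$ centred at $x$, $$s=z^{p}\,h,\qquad t=\bar z^{\,q}\,k$$ near $x$, with smooth functions $h,k$ without zeros; and $p$, $q$ are the only exponents for which $s$, respectively $t$, has such a factorization. So the order of an anticomplex point ($p$) and of a complex point ($q$) is well defined, independently of the adapted frame and of the coordinate. -/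

import Mathlib

open scoped Manifold ContDiff Bundle Topology

noncomputable section

namespace ChernMinimal

/-! ### Complex manifolds as real manifolds -/

section ComplexStructure

variable {E : Type*} [NormedAddCommGroup E] [NormedSpace ℝ E] [NormedSpace ℂ E]
  [IsScalarTower ℝ ℂ E] {M : Type*} [TopologicalSpace M] [ChartedSpace E M]

/-- A complex manifold is a real manifold, with the same charts. -/
instance isManifold_real_of_complex [h : IsManifold 𝓘(ℂ, E) ω M] : IsManifold 𝓘(ℝ, E) ω M := by
  refine isManifold_of_contDiffOn _ _ _ ?_
  intro e e' he he'
  have h1 := (contDiffGroupoid ω 𝓘(ℂ, E)).compatible he he'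
  rw [contDiffGroupoid, mem_groupoid_of_pregroupoid] at h1
  exact h1.1.restrict_scalars ℝ

/-- The almost complex structure `J` of a complex manifold (`j` on a Riemann surface), acting on
the tangent space of the underlying real manifold. Mathlib identifies the tangent space at `x` with
the model space `E` by the preferred chart at `x`, which is holomorphic; in it, `J` is
multiplication by `i`. -/
def tangentJ (x : M) : TangentSpace 𝓘(ℝ, E) x →L[ℝ] TangentSpace 𝓘(ℝ, E) x :=
  show E →L[ℝ] E from Complex.I • ContinuousLinearMap.id ℝ E

/-- The action `c • v = (Re c) v + (Im c) J v` of a complex number on a tangent vector. -/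
def complexSMul {x : M} (c : ℂ) (v : TangentSpace 𝓘(ℝ, E) x) : TangentSpace 𝓘(ℝ, E) x :=
  c.re • v + c.im • tangentJ x v

end ComplexStructure

/-! ### Hermitian metrics and the two connections -/

section Metric

variable (E : Type*) [NormedAddCommGroup E] [NormedSpace ℝ E] [NormedSpace ℂ E]
  [IsScalarTower ℝ ℂ E] (M : Type*) [TopologicalSpace M] [ChartedSpace E M]
  [Bundle.RiemannianBundle (fun x : M ↦ TangentSpace 𝓘(ℝ, E) x)]

/-- The Riemannian metric is Hermitian, `g(Jv, Jw) = g(v, w)`. (In complex dimension one this says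
that the metric is conformal to the complex structure.) -/
def IsHermitianMetric : Prop :=
  ∀ (x : M) (v w : TangentSpace 𝓘(ℝ, E) x),
    inner ℝ (tangentJ x v) (tangentJ x w) = inner ℝ v w

end Metric

section Connections

variable {E : Type*} [NormedAddCommGroup E] [NormedSpace ℝ E] [FiniteDimensional ℝ E]
  {M : Type*} [TopologicalSpace M] [ChartedSpace E M] [IsManifold 𝓘(ℝ, E) ∞ M]
  [Bundle.RiemannianBundle (fun x : M ↦ TangentSpace 𝓘(ℝ, E) x)]

/-- The vector field `Y` is differentiable at `x`. -/
def DifferentiableFieldAt (Y : Π x : M, TangentSpace 𝓘(ℝ, E) x) (x : M) : Prop :=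
  MDifferentiableAt 𝓘(ℝ, E) 𝓘(ℝ, E).tangent (fun y ↦ (⟨y, Y y⟩ : TangentBundle 𝓘(ℝ, E) M)) x

/-- `cov` preserves the metric: `v g(Y, Z) = g(∇_v Y, Z) + g(Y, ∇_v Z)`. -/
def PreservesMetric
    (cov : CovariantDerivative 𝓘(ℝ, E) E (TangentSpace 𝓘(ℝ, E) : M → Type _)) : Prop :=
  ∀ (Y Z : Π x : M, TangentSpace 𝓘(ℝ, E) x) (x : M),
    DifferentiableFieldAt Y x → DifferentiableFieldAt Z x →
    ∀ v : TangentSpace 𝓘(ℝ, E) x,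
      mfderiv 𝓘(ℝ, E) 𝓘(ℝ, ℝ) (fun y ↦ (inner ℝ (Y y) (Z y) : ℝ)) x v =
        (inner ℝ (cov Y x v) (Z x) + inner ℝ (Y x) (cov Z x v) : ℝ)

/-- `cov` is the Levi-Civita connection of the Riemannian manifold `M`. -/
structure IsLeviCivitaConnection
    (cov : CovariantDerivative 𝓘(ℝ, E) E (TangentSpace 𝓘(ℝ, E) : M → Type _)) : Prop where
  metric : PreservesMetric cov
  torsion : cov.torsion = 0

variable [NormedSpace ℂ E] [IsScalarTower ℝ ℂ E]

/-- `cov` is the Chern connection of the Hermitian manifold `M`: it preserves the metric and the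
complex structure, and the `(1,1)`-part of its torsion `T` vanishes. Extending `T` complex
bilinearly, the latter means that `T(Z, W̄) = 0` for `Z`, `W` of type `(1,0)`, that is,
`T(Jv, Jw) = -T(v, w)` for all real `v`, `w`. -/
structure IsChernConnection
    (cov : CovariantDerivative 𝓘(ℝ, E) E (TangentSpace 𝓘(ℝ, E) : M → Type _)) : Prop where
  metric : PreservesMetric cov
  complex : ∀ (Y : Π x : M, TangentSpace 𝓘(ℝ, E) x) (x : M), DifferentiableFieldAt Y x →
    ∀ v : TangentSpace 𝓘(ℝ, E) x,
      cov (fun y ↦ tangentJ y (Y y)) x v = tangentJ x (cov Y x v)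
  torsion : ∀ (x : M) (v w : TangentSpace 𝓘(ℝ, E) x),
    cov.torsion x (tangentJ x v) (tangentJ x w) = -cov.torsion x v w

end Connections

/-! ### Maps from a Riemann surface `S` to a complex surface `M` -/

/-- The model space of complex surfaces. -/
abbrev C2 : Type := EuclideanSpace ℂ (Fin 2)

section Maps

variable {S : Type*} [TopologicalSpace S] [ChartedSpace ℂ S]
  {M : Type*} [TopologicalSpace M] [ChartedSpace C2 M]

/-- `x` is a complex point of `f`: `df ∘ j = J ∘ df` at `x`. -/
def IsComplexPoint (f : S → M) (x : S) : Prop :=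
  ∀ v : TangentSpace 𝓘(ℝ, ℂ) x,
    mfderiv 𝓘(ℝ, ℂ) 𝓘(ℝ, C2) f x (tangentJ x v) = tangentJ (f x) (mfderiv 𝓘(ℝ, ℂ) 𝓘(ℝ, C2) f x v)

/-- `x` is an anticomplex point of `f`: `df ∘ j = -J ∘ df` at `x`. -/
def IsAnticomplexPoint (f : S → M) (x : S) : Prop :=
  ∀ v : TangentSpace 𝓘(ℝ, ℂ) x,
    mfderiv 𝓘(ℝ, ℂ) 𝓘(ℝ, C2) f x (tangentJ x v) = -tangentJ (f x) (mfderiv 𝓘(ℝ, ℂ) 𝓘(ℝ, C2) f x v)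

variable [Bundle.RiemannianBundle (fun x : S ↦ TangentSpace 𝓘(ℝ, ℂ) x)]
  [Bundle.RiemannianBundle (fun x : M ↦ TangentSpace 𝓘(ℝ, C2) x)]

/-- `f` preserves the metrics. In particular every `df` is injective: `f` is an immersion. -/
def IsIsometricMap (f : S → M) : Prop :=
  ∀ (x : S) (v w : TangentSpace 𝓘(ℝ, ℂ) x),
    inner ℝ (mfderiv 𝓘(ℝ, ℂ) 𝓘(ℝ, C2) f x v) (mfderiv 𝓘(ℝ, ℂ) 𝓘(ℝ, C2) f x w) = inner ℝ v w

/-- The second fundamental form `(∇df)(v, w)` at `x`, for the connection on `T*S ⊗ f⁻¹TM` that is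
induced by a connection `covS` on `S` and a connection `covM` on `M`. It is
`∇_v (df W) - df (∇_v W)` for any vector field `W` with value `w` at `x`. Taking `W` with constant
components in the chart at `x`, and writing `F` for `f` in the charts at `x` and `f x`, the first
term is `D²F(v, w) + Γ(df v, df w)`, where `Γ(a, b)` (the Christoffel symbols of `covM`) is the
covariant derivative in the direction `a` of the vector field with constant components `b` in the
chart at `f x`, which is `FiberBundle.extend C2 b`. -/
def secondFundamentalForm [IsManifold 𝓘(ℝ, ℂ) 1 S] [IsManifold 𝓘(ℝ, C2) 1 M]
    (covS : CovariantDerivative 𝓘(ℝ, ℂ) ℂ (TangentSpace 𝓘(ℝ, ℂ) : S → Type _))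
    (covM : CovariantDerivative 𝓘(ℝ, C2) C2 (TangentSpace 𝓘(ℝ, C2) : M → Type _))
    (f : S → M) (x : S) (v w : TangentSpace 𝓘(ℝ, ℂ) x) : TangentSpace 𝓘(ℝ, C2) (f x) :=
  let df := mfderiv 𝓘(ℝ, ℂ) 𝓘(ℝ, C2) f x
  let F : ℂ → C2 := writtenInExtChartAt 𝓘(ℝ, ℂ) 𝓘(ℝ, C2) x f
  let D2F : TangentSpace 𝓘(ℝ, C2) (f x) :=
    show C2 from fderiv ℝ (fderiv ℝ F) (extChartAt 𝓘(ℝ, ℂ) x x) v w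
  D2F + covM (FiberBundle.extend C2 (df w)) (f x) (df v)
    - df (covS (FiberBundle.extend ℂ w) x v)

/-- `f` is Chern minimal: the trace, with respect to the metric of `S`, of its second fundamental
form `∇df` vanishes, where `∇` is induced by the Levi-Civita connection of `S` and the Chern
connection of `M` (each of which is unique). -/
def IsChernMinimal [IsManifold 𝓘(ℝ, ℂ) ∞ S] [IsManifold 𝓘(ℝ, C2) ∞ M] (f : S → M) : Prop :=
  ∃ (covS : CovariantDerivative 𝓘(ℝ, ℂ) ℂ (TangentSpace 𝓘(ℝ, ℂ) : S → Type _))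
    (covM : CovariantDerivative 𝓘(ℝ, C2) C2 (TangentSpace 𝓘(ℝ, C2) : M → Type _)),
    IsLeviCivitaConnection covS ∧ IsChernConnection covM ∧
      ∀ (x : S) (b : OrthonormalBasis (Fin 2) ℝ (TangentSpace 𝓘(ℝ, ℂ) x)),
        ∑ i, secondFundamentalForm covS covM f x (b i) (b i) = 0

/-- The `(1,0)`-form `φ` dual to a unit tangent vector `ε` of `S`: it is complex linear with
`φ(ε) = 1`, so that `φ φ̄` is the metric of `S`. -/
def dualForm {x : S} (ε v : TangentSpace 𝓘(ℝ, ℂ) x) : ℂ :=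
  ⟨inner ℝ v ε, inner ℝ v (tangentJ x ε)⟩

/-- Adapted frames on an open set `U ⊆ S`: a smooth unit vector field `ε` on `U`, with dual
`(1,0)`-form `φ`, a smooth unitary frame `e₁, e₂` of `f⁻¹TM` on `U`, with dual coframe
`ω¹, ω²`, and smooth functions `s, t : U → ℂ`, such that `f*ω¹ = s φ` and `f*ω² = t φ̄`, that is,
`df(v) = s φ(v) e₁ + t φ̄(v) e₂`. Unitarity for the Hermitian inner product is expressed by
`g(eᵢ, eᵢ) = 1` and `g(e₁, e₂) = g(e₁, J e₂) = 0`. -/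
structure IsAdaptedFrame [IsManifold 𝓘(ℝ, ℂ) 1 S] [IsManifold 𝓘(ℝ, C2) 1 M] (f : S → M)
    (U : Set S) (ε : Π x : S, TangentSpace 𝓘(ℝ, ℂ) x)
    (e₁ e₂ : Π x : S, TangentSpace 𝓘(ℝ, C2) (f x)) (s t : S → ℂ) : Prop where
  smooth_ε : ContMDiffOn 𝓘(ℝ, ℂ) 𝓘(ℝ, ℂ).tangent ∞
    (fun x ↦ (⟨x, ε x⟩ : TangentBundle 𝓘(ℝ, ℂ) S)) U
  smooth_e₁ : ContMDiffOn 𝓘(ℝ, ℂ) 𝓘(ℝ, C2).tangent ∞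
    (fun x ↦ (⟨f x, e₁ x⟩ : TangentBundle 𝓘(ℝ, C2) M)) U
  smooth_e₂ : ContMDiffOn 𝓘(ℝ, ℂ) 𝓘(ℝ, C2).tangent ∞
    (fun x ↦ (⟨f x, e₂ x⟩ : TangentBundle 𝓘(ℝ, C2) M)) U
  smooth_s : ContMDiffOn 𝓘(ℝ, ℂ) 𝓘(ℝ, ℂ) ∞ s U
  smooth_t : ContMDiffOn 𝓘(ℝ, ℂ) 𝓘(ℝ, ℂ) ∞ t U
  inner_ε : ∀ x ∈ U, inner ℝ (ε x) (ε x) = 1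
  inner_e₁ : ∀ x ∈ U, inner ℝ (e₁ x) (e₁ x) = 1
  inner_e₂ : ∀ x ∈ U, inner ℝ (e₂ x) (e₂ x) = 1
  inner_e₁_e₂ : ∀ x ∈ U, inner ℝ (e₁ x) (e₂ x) = 0
  inner_e₁_Je₂ : ∀ x ∈ U, inner ℝ (e₁ x) (tangentJ (f x) (e₂ x)) = 0
  df_eq : ∀ x ∈ U, ∀ v : TangentSpace 𝓘(ℝ, ℂ) x,
    mfderiv 𝓘(ℝ, ℂ) 𝓘(ℝ, C2) f x v =
      complexSMul (s x * dualForm (ε x) v) (e₁ x)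
        + complexSMul (t x * starRingEnd ℂ (dualForm (ε x) v)) (e₂ x)

/-- Near `x`, `a = z ^ n * h` with `h` smooth and without zeros. -/
def FactorsAt (a z : S → ℂ) (x : S) (n : ℕ) : Prop :=
  ∃ V : Set S, IsOpen V ∧ x ∈ V ∧ ∃ h : S → ℂ, ContMDiffOn 𝓘(ℝ, ℂ) 𝓘(ℝ, ℂ) ∞ h V ∧
    ∀ y ∈ V, h y ≠ 0 ∧ a y = z y ^ n * h y

/-- `z` is a holomorphic coordinate of the Riemann surface `S` centred at `x`. -/
def IsHolomorphicCoordinateAt (z : OpenPartialHomeomorph S ℂ) (x : S) : Prop :=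
  z ∈ IsManifold.maximalAtlas 𝓘(ℂ) ω S ∧ x ∈ z.source ∧ z x = 0

end Maps

end ChernMinimal

end

/-! In a holomorphic coordinate `z` of the surface and a holomorphic chart of `M`, `f` becomes a map
`F` from an open subset of `ℂ` to `ℂ²`. Its Wirtinger derivatives split `df` by type: in an adapted
frame `F_z` is `s e₁` and `F_z̄` is `t e₂`, each up to a smooth factor without zeros. Anticomplex
points are thus the zeros of `s`, complex points the zeros of `t`.

The properties of the Chern connection enter in one place. Parallelism of `J` and the vanishing of
the `(1,1)`-torsion force its Christoffel symbols `Γ` in holomorphic charts to be complex bilinear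
(`IsChernConnection.christoffel_I_left`), while the Levi-Civita symbols of a conformal metric have
zero trace (`IsLeviCivitaConnection.christoffel_trace`). Hence `tr ∇df = 0` reads `F_{zz̄} =
-(Γ(F_z, F_z̄) + Γ(F_z̄, F_z)) / 2`, whose right side is linear in `F_z` and linear in `F_z̄`.
Writing `F_z = σ e` with a unit vector `e` and pairing with `e` gives `∂σ/∂z̄ = c σ`; the conjugate
of the coefficient of `F_z̄` satisfies an equation of the same kind (`exists_dzbar_coeff_eq`,
`exists_dzbar_conj_coeff_eq`).

The similarity principle `eventually_zero_or_factor_of_dzbar_eq` treats such equations: solve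
`∂u/∂z̄ = c` by convolution with `1/(πz)`; then `σ exp(-u)` is holomorphic, so `σ` vanishes near the
point or is a power of the coordinate times a smooth function without zeros. On a connected surface
the first alternative, if it occurs at one point, spreads everywhere
(`forall_or_forall_not_eventually`), and genericity excludes it. So the zeros of `s` and `t` are
isolated.

Adapted frames exist because conformality of `f` means that `F_z` and `F_z̄` are Hermitian
orthogonal; they have no common zero, so one of them can be normalized and completed to a unitary
frame (`exists_unitary_frame`). The orders are well defined because `‖s‖` and `‖t‖` are determined
by `df` and the metrics (`IsAdaptedFrame.norm_s`, `IsAdaptedFrame.norm_t`), and two coordinates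
centred at the same point have comparable absolute values (`FactorsAt.order_unique`). -/

noncomputable section

namespace ChernMinimal

open MeasureTheory Set Filter

/-! ### Wirtinger derivatives, the Cauchy–Pompeiu formula and the equation `∂u/∂z̄ = c`. -/

section Wirtinger

variable {E : Type*} [NormedAddCommGroup E] [NormedSpace ℝ E] [NormedSpace ℂ E]

/-- The Wirtinger derivative `∂F/∂z`. -/
def dz (F : ℂ → E) (z : ℂ) : E :=
  (1 / 2 : ℂ) • (fderiv ℝ F z 1 - Complex.I • fderiv ℝ F z Complex.I)

/-- The Wirtinger derivative `∂F/∂z̄`. -/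
def dzbar (F : ℂ → E) (z : ℂ) : E :=
  (1 / 2 : ℂ) • (fderiv ℝ F z 1 + Complex.I • fderiv ℝ F z Complex.I)

end Wirtinger

/-- The kernel `1/z` is locally integrable on the plane. -/
lemma locallyIntegrable_inv_complex : LocallyIntegrable (fun z : ℂ ↦ z⁻¹) volume := by
  have key : ∀ r : ℝ, IntegrableOn (fun z : ℂ ↦ z⁻¹) (Metric.ball 0 r) volume := by
    intro r
    have h := (integrableOn_fun_norm_addHaar (E := ℂ) volume (f := fun y : ℝ ↦ y⁻¹) (r := r)).2 (by
      rw [Complex.finrank_real_complex]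
      refine IntegrableOn.congr_fun (f := fun _ ↦ (1 : ℝ)) ?_ ?_ measurableSet_Ioo
      · simp
      · intro y hy
        simp [mul_inv_cancel₀ hy.1.ne'])
    refine Integrable.mono' h (by fun_prop) (Eventually.of_forall fun z ↦ ?_)
    simp
  intro x
  refine ⟨Metric.ball 0 (‖x‖ + 1), Metric.isOpen_ball.mem_nhds (by simp), key _⟩

section CauchyPompeiu

variable {g : ℂ → ℂ}

lemma integrableOn_polar_of_compact_support {F : ℝ × ℝ → ℂ} (hF : Continuous F) {R : ℝ}
    (hR : ∀ p : ℝ × ℝ, R < p.1 → F p = 0) :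
    IntegrableOn F (Ioi (0 : ℝ) ×ˢ Ioo (-Real.pi) Real.pi) volume := by
  have h1 : IntegrableOn F (Icc (0 : ℝ) R ×ˢ Icc (-Real.pi) Real.pi) volume :=
    hF.continuousOn.integrableOn_compact (isCompact_Icc.prod isCompact_Icc)
  refine h1.of_forall_sdiff_eq_zero (measurableSet_Ioi.prod measurableSet_Ioo) ?_
  rintro ⟨r, θ⟩ ⟨⟨h2, h3⟩, h4⟩
  refine hR _ ?_
  by_contra h5
  exact h4 ⟨⟨h2.le, not_lt.1 h5⟩, ⟨h3.1.le, h3.2.le⟩⟩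

lemma hasDerivAt_comp_circle (hg : ContDiff ℝ 1 g) (r θ : ℝ) :
    HasDerivAt (fun θ : ℝ ↦ g (r * Complex.exp (θ * Complex.I)))
      (r * fderiv ℝ g (r * Complex.exp (θ * Complex.I))
        (Complex.I * Complex.exp (θ * Complex.I))) θ := by
  have h1 : HasDerivAt (fun θ : ℝ ↦ (r : ℂ) * Complex.exp (θ * Complex.I))
      (r * (Complex.I * Complex.exp (θ * Complex.I))) θ := by
    have h := (((hasDerivAt_id (θ : ℂ)).mul_const Complex.I).cexp.const_mul (r : ℂ)).comp_ofReal
    refine HasDerivAt.congr_deriv (f' := _) h ?_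
    simp only [id_eq]
    ring
  have h2 := ((hg.differentiable one_ne_zero) (r * Complex.exp (θ * Complex.I))).hasFDerivAt
  have h3 := h2.comp_hasDerivAt θ h1
  rw [← Complex.real_smul (x := r) (z := Complex.I * _), map_smul] at h3
  simpa [Function.comp_def] using h3

lemma hasDerivAt_comp_ray (hg : ContDiff ℝ 1 g) (r θ : ℝ) :
    HasDerivAt (fun r : ℝ ↦ g (r * Complex.exp (θ * Complex.I)))
      (fderiv ℝ g (r * Complex.exp (θ * Complex.I)) (Complex.exp (θ * Complex.I))) r := by
  have h1 : HasDerivAt (fun r : ℝ ↦ (r : ℂ) * Complex.exp (θ * Complex.I))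
      (Complex.exp (θ * Complex.I)) r := by
    have h := ((hasDerivAt_id (r : ℂ)).mul_const (Complex.exp (θ * Complex.I))).comp_ofReal
    simpa using h
  have h2 := ((hg.differentiable one_ne_zero) (r * Complex.exp (θ * Complex.I))).hasFDerivAt
  exact h2.comp_hasDerivAt r h1

/-- The Cauchy–Pompeiu formula for a compactly supported function. -/
lemma integral_inv_mul_dzbar (hg : ContDiff ℝ 1 g) (hc : HasCompactSupport g) :
    ∫ w, w⁻¹ * dzbar g w = -Real.pi * g 0 := by
  obtain ⟨R, hR⟩ : ∃ R : ℝ, ∀ w : ℂ, R < ‖w‖ → w ∉ tsupport g := by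
    obtain ⟨R, hR⟩ := hc.isCompact.isBounded.subset_closedBall 0
    refine ⟨R, fun w hw hw' ↦ ?_⟩
    have := hR hw'
    simp at this
    linarith
  have hR0 : ∀ w : ℂ, R < ‖w‖ → g w = 0 := fun w hw ↦ image_eq_zero_of_notMem_tsupport (hR w hw)
  have hR1 : ∀ w : ℂ, R < ‖w‖ → fderiv ℝ g w = 0 := fun w hw ↦
    fderiv_of_notMem_tsupport ℝ (hR w hw)
  have hcont : Continuous (fderiv ℝ g) := hg.continuous_fderiv one_ne_zero
  set e : ℝ → ℂ := fun θ ↦ Complex.exp (θ * Complex.I) with he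
  have hec : Continuous e := by fun_prop
  have hen : ∀ θ, ‖e θ‖ = 1 := fun θ ↦ Complex.norm_exp_ofReal_mul_I θ
  -- `A` is the radial derivative of `g` in polar coordinates, and `r * B` is the angular one.
  set A : ℝ × ℝ → ℂ := fun p ↦ fderiv ℝ g (p.1 * e p.2) (e p.2) with hA
  set B : ℝ × ℝ → ℂ := fun p ↦ fderiv ℝ g (p.1 * e p.2) (Complex.I * e p.2) with hB
  have hpn : ∀ p : ℝ × ℝ, R < p.1 → R < ‖(p.1 : ℂ) * e p.2‖ := by
    intro p hp
    rw [norm_mul, hen, mul_one, Complex.norm_real]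
    exact hp.trans_le (le_abs_self _)
  have hpe : Continuous fun p : ℝ × ℝ ↦ (p.1 : ℂ) * e p.2 := by fun_prop
  have hAi : IntegrableOn A (Ioi (0 : ℝ) ×ˢ Ioo (-Real.pi) Real.pi) volume := by
    refine integrableOn_polar_of_compact_support (R := R) ((hcont.comp hpe).clm_apply (by fun_prop)) fun p hp ↦ ?_
    simp [hA, hR1 _ (hpn p hp)]
  have hBi : IntegrableOn B (Ioi (0 : ℝ) ×ˢ Ioo (-Real.pi) Real.pi) volume := by
    refine integrableOn_polar_of_compact_support (R := R) ((hcont.comp hpe).clm_apply (by fun_prop)) fun p hp ↦ ?_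
    simp [hB, hR1 _ (hpn p hp)]
  -- The Jacobian `r` cancels the modulus of `w⁻¹`, and `exp(-iθ) ∂g/∂z̄ = (A + i B) / 2`.
  have h1 : ∫ w, w⁻¹ * dzbar g w =
      ∫ p in Ioi (0 : ℝ) ×ˢ Ioo (-Real.pi) Real.pi,
        ((1 / 2 : ℂ) * A p + (Complex.I / 2) * B p) := by
    rw [← Complex.integral_comp_polarCoord_symm]
    refine setIntegral_congr_fun (measurableSet_Ioi.prod measurableSet_Ioo) ?_
    rintro ⟨r, θ⟩ ⟨hr, -⟩
    have hr : (r : ℂ) ≠ 0 := Complex.ofReal_ne_zero.2 (ne_of_gt hr)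
    have hps : Complex.polarCoord.symm (r, θ) = r * e θ := by
      rw [Complex.polarCoord_symm_apply, he]
      simp [Complex.exp_mul_I]
    have hlin : ∀ (L : ℂ →L[ℝ] ℂ) (c : ℂ), L c = c.re * L 1 + c.im * L Complex.I := by
      intro L c
      have : c = c.re • (1 : ℂ) + c.im • Complex.I := by
        simp [Complex.re_add_im]
      conv_lhs => rw [this]
      rw [map_add, map_smul, map_smul]
      simp
    simp only [hps, hA, hB, dzbar, smul_eq_mul, Complex.real_smul]
    rw [hlin _ (e θ), hlin _ (Complex.I * e θ)]
    have he1 : e θ = (Real.cos θ : ℂ) + Real.sin θ * Complex.I := by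
      rw [he]; simp only [Complex.exp_mul_I]; simp
    have he2 : (e θ)⁻¹ = (Real.cos θ : ℂ) - Real.sin θ * Complex.I := by
      rw [he]
      simp only
      rw [← Complex.exp_neg, ← neg_mul, Complex.exp_mul_I]
      simp [sub_eq_add_neg]
    have hre : (e θ).re = Real.cos θ := by rw [he1]; simp only [Complex.add_re, Complex.mul_re,
      Complex.ofReal_re, Complex.ofReal_im, Complex.I_re, Complex.I_im]; ring
    have him : (e θ).im = Real.sin θ := by rw [he1]; simp only [Complex.add_im, Complex.mul_im,
      Complex.ofReal_re, Complex.ofReal_im, Complex.I_re, Complex.I_im]; ring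
    have hre' : (Complex.I * e θ).re = -Real.sin θ := by simp [him]
    have him' : (Complex.I * e θ).im = Real.cos θ := by simp [hre]
    rw [hre, him, hre', him', mul_inv, he2]
    field_simp
    rw [Complex.ofReal_neg]
    linear_combination (-(Real.sin θ : ℂ) * (fderiv ℝ g (r * e θ) Complex.I)) * Complex.I_sq
  rw [h1, integral_add (hAi.const_mul _) (hBi.const_mul _), integral_const_mul,
    integral_const_mul]
  -- Along each ray the integral of `A` is `-g 0`, because `g` vanishes far out; the angles
  -- contribute `2π`.
  have hA' : ∫ p in Ioi (0 : ℝ) ×ˢ Ioo (-Real.pi) Real.pi, A p = -(2 * Real.pi) * g 0 := by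
    have hAi' : Integrable A ((volume.restrict (Ioi (0 : ℝ))).prod
        (volume.restrict (Ioo (-Real.pi) Real.pi))) := by
      rw [Measure.prod_restrict]; exact hAi
    have : ∫ p in Ioi (0 : ℝ) ×ˢ Ioo (-Real.pi) Real.pi, A p =
        ∫ p, A p ∂((volume.restrict (Ioi (0 : ℝ))).prod
          (volume.restrict (Ioo (-Real.pi) Real.pi))) := by
      rw [Measure.prod_restrict]; rfl
    rw [this, integral_prod_symm _ hAi']
    have h2 : ∀ θ : ℝ, ∫ r in Ioi (0 : ℝ), A (r, θ) = -g 0 := by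
      intro θ
      have h3 := integral_Ioi_of_hasDerivAt_of_tendsto' (a := (0 : ℝ)) (m := (0 : ℂ))
        (f := fun r : ℝ ↦ g (r * e θ)) (f' := fun r ↦ A (r, θ))
        (fun r _ ↦ hasDerivAt_comp_ray hg r θ) ?_ ?_
      · simpa using h3
      · have h4 : Continuous fun r : ℝ ↦ A (r, θ) :=
          (hcont.comp (by fun_prop : Continuous fun r : ℝ ↦ (r : ℂ) * e θ)).clm_apply
            (continuous_const : Continuous fun _ : ℝ ↦ e θ)
        have h5 : IntegrableOn (fun r ↦ A (r, θ)) (Icc 0 R) :=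
          h4.continuousOn.integrableOn_compact isCompact_Icc
        refine h5.of_forall_sdiff_eq_zero measurableSet_Ioi ?_
        rintro r ⟨h6, h7⟩
        have h8 : R < r := by
          by_contra h8
          exact h7 ⟨(mem_Ioi.1 h6).le, not_lt.1 h8⟩
        simp [hA, hR1 _ (hpn (r, θ) h8)]
      · refine tendsto_const_nhds.congr' ?_
        filter_upwards [eventually_gt_atTop R] with r hr
        exact (hR0 _ (hpn (r, θ) hr)).symm
    simp_rw [h2]
    rw [integral_const]
    simp [Measure.real, Real.pi_pos.le]
    left
    ring
  -- On each circle `r * B` is the derivative of a periodic function of the angle.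
  have hB' : ∫ p in Ioi (0 : ℝ) ×ˢ Ioo (-Real.pi) Real.pi, B p = 0 := by
    rw [Measure.volume_eq_prod, setIntegral_prod _ hBi]
    refine setIntegral_eq_zero_of_forall_eq_zero fun r hr ↦ ?_
    have hr : (r : ℂ) ≠ 0 := Complex.ofReal_ne_zero.2 (ne_of_gt hr)
    rw [← integral_Ioc_eq_integral_Ioo,
      ← intervalIntegral.integral_of_le (by linarith [Real.pi_pos])]
    have h3 := intervalIntegral.integral_eq_sub_of_hasDerivAt (a := -Real.pi) (b := Real.pi)
      (f := fun θ : ℝ ↦ g (r * e θ)) (f' := fun θ ↦ r * B (r, θ))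
      (fun θ _ ↦ hasDerivAt_comp_circle hg r θ) ?_
    · rw [intervalIntegral.integral_const_mul] at h3
      have h4 : e Real.pi = e (-Real.pi) := by
        simp [he, Complex.exp_neg]
      rw [h4, sub_self] at h3
      exact (mul_eq_zero.1 h3).resolve_left hr
    · refine Continuous.intervalIntegrable ?_ _ _
      exact continuous_const.mul ((hcont.comp
        (by fun_prop : Continuous fun θ : ℝ ↦ (r : ℂ) * e θ)).clm_apply (by fun_prop))
  rw [hA', hB']
  ring

end CauchyPompeiu

/-- The equation `∂u/∂z̄ = c` has a smooth solution for smooth compactly supported `c`. -/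
lemma exists_dzbar_eq {c : ℂ → ℂ} (hc : ContDiff ℝ ∞ c) (hcs : HasCompactSupport c) :
    ∃ u : ℂ → ℂ, ContDiff ℝ ∞ u ∧ ∀ z, dzbar u z = c z := by
  set L : ℂ →L[ℝ] ℂ →L[ℝ] ℂ := ContinuousLinearMap.mul ℝ ℂ with hL
  -- Derivatives of the convolution fall on the smooth factor `c`. Cauchy–Pompeiu for `w ↦ c (z -
  -- w)` then evaluates `∂v/∂z̄` as `π c`, whence the factor `π⁻¹` in the solution.
  set v : ℂ → ℂ := convolution (fun z : ℂ ↦ z⁻¹) c L volume with hv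
  have hvs : ContDiff ℝ ∞ v :=
    hcs.contDiff_convolution_right L locallyIntegrable_inv_complex (n := ⊤) hc
  have hc1 : ContDiff ℝ 1 c := hc.of_le (by simp)
  have hcf : Continuous (fderiv ℝ c) := hc1.continuous_fderiv one_ne_zero
  have hfd : ∀ z d, fderiv ℝ v z d = ∫ w, w⁻¹ * fderiv ℝ c (z - w) d := by
    intro z d
    rw [(hcs.hasFDerivAt_convolution_right L locallyIntegrable_inv_complex hc1 z).fderiv,
      convolution_precompR_apply L locallyIntegrable_inv_complex (hcs.fderiv ℝ) hcf]
    rfl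
  have hint : ∀ z d, Integrable fun w ↦ w⁻¹ * fderiv ℝ c (z - w) d := by
    intro z d
    have h1 : HasCompactSupport fun a ↦ fderiv ℝ c a d := hcs.fderiv_apply ℝ d
    exact h1.convolutionExists_right L locallyIntegrable_inv_complex
      (hcf.clm_apply continuous_const) z
  refine ⟨fun z ↦ (Real.pi : ℂ)⁻¹ * v z, contDiff_const.mul hvs, fun z ↦ ?_⟩
  have h0 : ∀ d, fderiv ℝ (fun z ↦ (Real.pi : ℂ)⁻¹ * v z) z d = (Real.pi : ℂ)⁻¹ * fderiv ℝ v z d := by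
    intro d
    rw [fderiv_const_mul (hvs.differentiable (by simp) z)]
    rfl
  set g : ℂ → ℂ := fun w ↦ c (z - w) with hg
  have hgs : ContDiff ℝ 1 g := hc1.comp (contDiff_const.sub contDiff_id)
  have hgc : HasCompactSupport g := hcs.comp_homeomorph (Homeomorph.subLeft z)
  have hgd : ∀ w d, fderiv ℝ g w d = -fderiv ℝ c (z - w) d := by
    intro w d
    have h := ((hc1.differentiable one_ne_zero) (z - w)).hasFDerivAt.comp w
      ((hasFDerivAt_id w).const_sub z)
    have h' : fderiv ℝ g w = _ := h.fderiv
    rw [h']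
    simp
  have key := integral_inv_mul_dzbar hgs hgc
  have h1 : (fun w ↦ w⁻¹ * dzbar g w) = fun w ↦ (-(1 / 2) : ℂ) * (w⁻¹ * fderiv ℝ c (z - w) 1) +
      (-(Complex.I / 2)) * (w⁻¹ * fderiv ℝ c (z - w) Complex.I) := by
    funext w
    simp only [dzbar, hgd, smul_eq_mul]
    ring
  rw [h1, integral_add ((hint z 1).const_mul _) ((hint z _).const_mul _), integral_const_mul,
    integral_const_mul, ← hfd, ← hfd] at key
  have hpi : (Real.pi : ℂ) ≠ 0 := by simp [Real.pi_ne_zero]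
  simp only [dzbar, h0, smul_eq_mul]
  have hg0 : g 0 = c z := by simp [hg]
  rw [hg0] at key
  field_simp
  linear_combination (-2) * key

/-! ### The similarity principle and the uniqueness of exponents. -/

/-- A smooth function near a point agrees near it with a compactly supported smooth function. -/
lemma exists_contDiff_hasCompactSupport_eventuallyEq {c : ℂ → ℂ} {V : Set ℂ} (hV : IsOpen V)
    {z₀ : ℂ} (hz₀ : z₀ ∈ V) (hc : ContDiffOn ℝ ∞ c V) :
    ∃ c' : ℂ → ℂ, ContDiff ℝ ∞ c' ∧ HasCompactSupport c' ∧ c' =ᶠ[𝓝 z₀] c := by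
  obtain ⟨r, hr, hrV⟩ := Metric.isOpen_iff.1 hV z₀ hz₀
  let χ : ContDiffBump z₀ := ⟨r / 4, r / 2, by positivity, by linarith⟩
  have hts : tsupport χ ⊆ V := by
    rw [χ.tsupport_eq]
    exact (Metric.closedBall_subset_ball (by simp [χ]; linarith)).trans hrV
  refine ⟨fun z ↦ χ z • c z, ?_, χ.hasCompactSupport.smul_right, ?_⟩
  · refine contDiff_iff_contDiffAt.2 fun z ↦ ?_
    by_cases hz : z ∈ tsupport χ
    · exact χ.contDiff.contDiffAt.smul (hc.contDiffAt (hV.mem_nhds (hts hz)))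
    · have h1 : (fun z ↦ χ z • c z) =ᶠ[𝓝 z] fun _ ↦ 0 := by
        filter_upwards [(isClosed_tsupport χ).isOpen_compl.mem_nhds hz] with w hw
        simp [image_eq_zero_of_notMem_tsupport hw]
      exact contDiffAt_const.congr_of_eventuallyEq h1
  · filter_upwards [χ.eventuallyEq_one] with z hz
    simp [hz]

/-- The similarity principle: a solution of `∂σ/∂z̄ = c σ` vanishes near a point, or is a power of
the coordinate times a smooth function without zeros. -/
lemma eventually_zero_or_factor_of_dzbar_eq {σ c : ℂ → ℂ} {V : Set ℂ} (hV : IsOpen V) {z₀ : ℂ}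
    (hz₀ : z₀ ∈ V) (hσ : ContDiffOn ℝ ∞ σ V) (hc : ContDiffOn ℝ ∞ c V)
    (h : ∀ z ∈ V, dzbar σ z = c z * σ z) :
    (∀ᶠ z in 𝓝 z₀, σ z = 0) ∨ ∃ (n : ℕ) (W : Set ℂ) (H : ℂ → ℂ), IsOpen W ∧ z₀ ∈ W ∧ W ⊆ V ∧
      ContDiffOn ℝ ∞ H W ∧ ∀ z ∈ W, H z ≠ 0 ∧ σ z = (z - z₀) ^ n * H z := by
  obtain ⟨c', hc', hcs, hcc⟩ := exists_contDiff_hasCompactSupport_eventuallyEq hV hz₀ hc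
  obtain ⟨u, hu, hud⟩ := exists_dzbar_eq hc' hcs
  -- Near `z₀` the cut-off `c'` equals `c`, so `∂u/∂z̄ = c` there and the product satisfies the
  -- Cauchy–Riemann equation.
  set φ : ℂ → ℂ := fun z ↦ σ z * Complex.exp (-u z) with hφ
  have hdiff : ∀ᶠ z in 𝓝 z₀, DifferentiableAt ℂ φ z := by
    filter_upwards [hcc, hV.mem_nhds hz₀] with z hz hzV
    have hσd : DifferentiableAt ℝ σ z :=
      (hσ.contDiffAt (hV.mem_nhds hzV)).differentiableAt (by simp)
    have hudd : DifferentiableAt ℝ u z := hu.differentiable (by simp) z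
    have hE : HasFDerivAt (fun z ↦ Complex.exp (-u z)) (Complex.exp (-u z) • -fderiv ℝ u z) z :=
      hudd.hasFDerivAt.neg.cexp
    have hφd := hσd.hasFDerivAt.mul hE
    have hfd : ∀ d, fderiv ℝ φ z d =
        Complex.exp (-u z) * (fderiv ℝ σ z d - σ z * fderiv ℝ u z d) := by
      intro d
      have : fderiv ℝ φ z = _ := hφd.fderiv
      rw [this]
      simp
      ring
    rw [differentiableAt_complex_iff_differentiableAt_real]
    refine ⟨hφd.differentiableAt, ?_⟩
    have h1 := h z hzV
    have h2 := hud z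
    rw [hz] at h2
    simp only [dzbar, smul_eq_mul] at h1 h2
    rw [hfd, hfd, smul_eq_mul]
    linear_combination (Complex.exp (-u z)) * (-2 * Complex.I * h1 + 2 * Complex.I * σ z * h2
      + (fderiv ℝ σ z Complex.I - σ z * fderiv ℝ u z Complex.I) * Complex.I_sq)
  have han : AnalyticAt ℂ φ z₀ := by
    obtain ⟨W, hW, hWo, hzW⟩ := eventually_nhds_iff.1 hdiff
    exact (DifferentiableOn.analyticAt (s := W)
      (fun z hz ↦ (hW z hz).differentiableWithinAt) (hWo.mem_nhds hzW))
  have hσφ : ∀ z, σ z = φ z * Complex.exp (u z) := by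
    intro z
    rw [hφ]
    simp only
    rw [mul_assoc, ← Complex.exp_add]
    simp
  by_cases hz : ∀ᶠ z in 𝓝 z₀, φ z = 0
  · left
    filter_upwards [hz] with z hz
    rw [hσφ, hz, zero_mul]
  right
  obtain ⟨n, g, hg, hg0, hgφ⟩ := han.exists_eventuallyEq_pow_smul_nonzero_iff.2 hz
  obtain ⟨W, hW, hWo, hzW⟩ := eventually_nhds_iff.1 (hgφ.and
    (hg.eventually_analyticAt.and (hg.continuousAt.eventually_ne hg0)))
  refine ⟨n, W ∩ V, fun z ↦ g z * Complex.exp (u z), hWo.inter hV, ⟨hzW, hz₀⟩, inter_subset_right,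
    ?_, ?_⟩
  · intro z hz
    refine ContDiffAt.contDiffWithinAt ?_
    exact ((hW z hz.1).2.1.contDiffAt.restrict_scalars ℝ).mul
      (hu.cexp.contDiffAt)
  · rintro z ⟨hz, -⟩
    refine ⟨mul_ne_zero (hW z hz).2.2 (Complex.exp_ne_zero _), ?_⟩
    rw [hσφ, (hW z hz).1, smul_eq_mul, mul_assoc]

/-- The exponent `n` in `‖a‖ ∼ ‖ζ‖ ^ n` is determined by `a`, and does not change if `ζ` is
replaced by a comparable function. -/
lemma exponent_unique {X : Type*} {l : Filter X} [l.NeBot] {ζ ξ h k : X → ℂ} {m n : ℕ}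
    {C₁ C₂ c₁ c₂ K₁ K₂ : ℝ} (hζ0 : Tendsto ζ l (𝓝 0)) (hζ : ∀ᶠ x in l, ζ x ≠ 0)
    (hC₁ : 0 < C₁) (hζξ : ∀ᶠ x in l, ‖ζ x‖ ≤ C₁ * ‖ξ x‖)
    (hC₂ : 0 < C₂) (hξζ : ∀ᶠ x in l, ‖ξ x‖ ≤ C₂ * ‖ζ x‖)
    (hc₁ : 0 < c₁) (hh : ∀ᶠ x in l, c₁ ≤ ‖h x‖) (hh' : ∀ᶠ x in l, ‖h x‖ ≤ K₁)
    (hc₂ : 0 < c₂) (hk : ∀ᶠ x in l, c₂ ≤ ‖k x‖) (hk' : ∀ᶠ x in l, ‖k x‖ ≤ K₂)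
    (heq : ∀ᶠ x in l, ‖ζ x ^ m * h x‖ = ‖ξ x ^ n * k x‖) : m = n := by
  have hn0 : Tendsto (fun x ↦ ‖ζ x‖) l (𝓝 0) := by simpa using hζ0.norm
  rcases lt_trichotomy m n with hmn | hmn | hmn
  · exfalso
    obtain ⟨d, rfl⟩ := Nat.exists_eq_add_of_lt hmn
    -- With `n = m + d + 1`, division by `‖ζ‖ ^ m` leaves a positive power of `‖ζ‖`, which tends to
    -- zero and would squeeze the positive lower bound `c₁`.
    have hb : ∀ᶠ x in l, c₁ ≤ ‖ζ x‖ ^ (d + 1) * (C₂ ^ (m + d + 1) * K₂) := by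
      filter_upwards [hζ, hξζ, hh, hk', heq] with x h1 h2 h3 h4 h5
      have h6 : 0 < ‖ζ x‖ ^ m := pow_pos (norm_pos_iff.2 h1) _
      rw [norm_mul, norm_mul, norm_pow, norm_pow] at h5
      have h7 : ‖ξ x‖ ^ (m + d + 1) ≤ (C₂ * ‖ζ x‖) ^ (m + d + 1) := by gcongr
      have h8 : ‖ζ x‖ ^ m * c₁ ≤ ‖ζ x‖ ^ m * (‖ζ x‖ ^ (d + 1) * (C₂ ^ (m + d + 1) * K₂)) := by
        calc ‖ζ x‖ ^ m * c₁ ≤ ‖ζ x‖ ^ m * ‖h x‖ := by gcongr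
          _ = ‖ξ x‖ ^ (m + d + 1) * ‖k x‖ := h5
          _ ≤ (C₂ * ‖ζ x‖) ^ (m + d + 1) * K₂ := by gcongr
          _ = _ := by ring
      exact le_of_mul_le_mul_left h8 h6
    have ht : Tendsto (fun x ↦ ‖ζ x‖ ^ (d + 1) * (C₂ ^ (m + d + 1) * K₂)) l (𝓝 0) := by
      simpa using (hn0.pow (d + 1)).mul_const (C₂ ^ (m + d + 1) * K₂)
    exact absurd (ge_of_tendsto ht hb) (not_le.2 hc₁)
  · exact hmn
  · exfalso
    obtain ⟨d, rfl⟩ := Nat.exists_eq_add_of_lt hmn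
    have hb : ∀ᶠ x in l, c₂ ≤ ‖ζ x‖ ^ (d + 1) * (C₁ ^ n * K₁) := by
      filter_upwards [hζ, hζξ, hk, hh', heq] with x h1 h2 h3 h4 h5
      have h6 : 0 < ‖ζ x‖ ^ n := pow_pos (norm_pos_iff.2 h1) _
      rw [norm_mul, norm_mul, norm_pow, norm_pow] at h5
      have h7 : ‖ζ x‖ ^ n ≤ (C₁ * ‖ξ x‖) ^ n := by gcongr
      have h8 : ‖ζ x‖ ^ n * c₂ ≤ ‖ζ x‖ ^ n * (‖ζ x‖ ^ (d + 1) * (C₁ ^ n * K₁)) := by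
        calc ‖ζ x‖ ^ n * c₂ ≤ (C₁ * ‖ξ x‖) ^ n * ‖k x‖ := by gcongr
          _ = C₁ ^ n * (‖ξ x‖ ^ n * ‖k x‖) := by ring
          _ = C₁ ^ n * (‖ζ x‖ ^ (n + d + 1) * ‖h x‖) := by rw [h5]
          _ ≤ C₁ ^ n * (‖ζ x‖ ^ (n + d + 1) * K₁) := by gcongr
          _ = _ := by ring
      exact le_of_mul_le_mul_left h8 h6
    have ht : Tendsto (fun x ↦ ‖ζ x‖ ^ (d + 1) * (C₁ ^ n * K₁)) l (𝓝 0) := by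
      simpa using (hn0.pow (d + 1)).mul_const (C₁ ^ n * K₁)
    exact absurd (ge_of_tendsto ht hb) (not_le.2 hc₂)

/-! ### Second derivatives and Wirtinger calculus. -/

section Calculus

variable {E : Type*} [NormedAddCommGroup E] [NormedSpace ℝ E]
  {E' : Type*} [NormedAddCommGroup E'] [NormedSpace ℝ E']
  {E'' : Type*} [NormedAddCommGroup E''] [NormedSpace ℝ E'']

/-- The chain rule for second derivatives. -/
lemma fderiv_fderiv_comp {g : E' → E''} {f : E → E'} {x : E} (hg : ContDiffAt ℝ 2 g (f x))
    (hf : ContDiffAt ℝ 2 f x) (v w : E) :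
    fderiv ℝ (fderiv ℝ (g ∘ f)) x v w =
      fderiv ℝ (fderiv ℝ g) (f x) (fderiv ℝ f x v) (fderiv ℝ f x w) +
        fderiv ℝ g (f x) (fderiv ℝ (fderiv ℝ f) x v w) := by
  have h1 : fderiv ℝ (g ∘ f) =ᶠ[𝓝 x] fun y ↦ (fderiv ℝ g (f y)).comp (fderiv ℝ f y) := by
    have hg' : ∀ᶠ y in 𝓝 x, ContDiffAt ℝ 2 g (f y) :=
      hf.continuousAt.eventually (hg.eventually (by simp))
    filter_upwards [hg', hf.eventually (by simp)] with y hy hy'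
    exact fderiv_comp y (hy.differentiableAt (by simp)) (hy'.differentiableAt (by simp))
  have hg1 : DifferentiableAt ℝ (fderiv ℝ g) (f x) :=
    (hg.fderiv_right (m := 1) (by norm_num)).differentiableAt one_ne_zero
  have hf1 : DifferentiableAt ℝ (fderiv ℝ f) x :=
    (hf.fderiv_right (m := 1) (by norm_num)).differentiableAt one_ne_zero
  have hf0 : DifferentiableAt ℝ f x := hf.differentiableAt (by simp)
  rw [h1.fderiv_eq]
  have h2 := (hg1.hasFDerivAt.comp x hf0.hasFDerivAt).clm_comp hf1.hasFDerivAt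
  have h3 : fderiv ℝ (fun y ↦ (fderiv ℝ g (f y)).comp (fderiv ℝ f y)) x = _ := h2.fderiv
  rw [h3]
  simp [add_comm]

end Calculus

section ComplexCalculus

set_option linter.unusedSectionVars false

variable {E : Type*} [NormedAddCommGroup E] [NormedSpace ℝ E] [NormedSpace ℂ E]
  [IsScalarTower ℝ ℂ E]
  {E' : Type*} [NormedAddCommGroup E'] [NormedSpace ℝ E'] [NormedSpace ℂ E']
  [IsScalarTower ℝ ℂ E']

lemma fderiv_real_apply_of_complex {θ : E → E'} {x : E} (h : DifferentiableAt ℂ θ x) (v : E) :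
    fderiv ℝ θ x v = fderiv ℂ θ x v := by
  rw [h.fderiv_restrictScalars ℝ]
  rfl

lemma fderiv_fderiv_real_of_complex {θ : E → E'} {x : E} (h : ContDiffAt ℂ 2 θ x) (v w : E) :
    fderiv ℝ (fderiv ℝ θ) x v w = fderiv ℂ (fderiv ℂ θ) x v w := by
  have h1 : fderiv ℝ θ =ᶠ[𝓝 x]
      fun y ↦ ContinuousLinearMap.restrictScalarsL ℂ E E' ℝ ℝ (fderiv ℂ θ y) := by
    filter_upwards [h.eventually (by simp)] with y hy
    exact (hy.differentiableAt (by simp)).fderiv_restrictScalars ℝ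
  have h2 : DifferentiableAt ℂ (fderiv ℂ θ) x :=
    (h.fderiv_right (m := 1) (by norm_num)).differentiableAt one_ne_zero
  rw [h1.fderiv_eq]
  have h3 := (ContinuousLinearMap.restrictScalarsL ℂ E E' ℝ ℝ).hasFDerivAt.comp x
    (h2.hasFDerivAt.restrictScalars ℝ)
  have h4 : fderiv ℝ (fun y ↦ ContinuousLinearMap.restrictScalarsL ℂ E E' ℝ ℝ (fderiv ℂ θ y)) x
    = _ := h3.fderiv
  rw [h4]
  rfl

variable {F : ℂ → E} {ζ : ℂ}

lemma fderiv_one_eq (F : ℂ → E) (ζ : ℂ) : fderiv ℝ F ζ 1 = dz F ζ + dzbar F ζ := by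
  simp only [dz, dzbar]
  module

lemma fderiv_I_eq (F : ℂ → E) (ζ : ℂ) :
    fderiv ℝ F ζ Complex.I = Complex.I • (dz F ζ - dzbar F ζ) := by
  have h : Complex.I • Complex.I • fderiv ℝ F ζ Complex.I = -fderiv ℝ F ζ Complex.I := by
    rw [smul_smul, Complex.I_mul_I, neg_one_smul]
  have h' : dz F ζ - dzbar F ζ = -(Complex.I • fderiv ℝ F ζ Complex.I) := by
    simp only [dz, dzbar]
    module
  rw [h', smul_neg, h, neg_neg]

/-- The real differential in terms of the Wirtinger derivatives. -/
lemma fderiv_apply_eq (F : ℂ → E) (ζ v : ℂ) :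
    fderiv ℝ F ζ v = v • dz F ζ + starRingEnd ℂ v • dzbar F ζ := by
  have hv : v = v.re • (1 : ℂ) + v.im • Complex.I := by simp [Complex.re_add_im]
  have hv' : v = v.re + v.im * Complex.I := by simp [Complex.re_add_im]
  have hcv : starRingEnd ℂ v = v.re - v.im * Complex.I := by
    apply Complex.ext <;> simp
  conv_lhs => rw [hv]
  rw [map_add, map_smul, map_smul, fderiv_one_eq, fderiv_I_eq, hcv]
  generalize v.re = s, v.im = t at hv'
  subst hv'
  have hr : ∀ (r : ℝ) (x : E), r • x = (r : ℂ) • x := fun r x ↦ (algebraMap_smul ℂ r x).symm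
  rw [hr, hr]
  module

/-- A real linear map on `ℂ` splits uniquely into a complex linear and an antilinear part. This lets
the expression of `df` in an adapted frame be read as a formula for the Wirtinger derivatives. -/
lemma dz_eq_of_fderiv {a b : E} (h : ∀ v : ℂ, fderiv ℝ F ζ v = v • a + starRingEnd ℂ v • b) :
    dz F ζ = a := by
  have h2 : Complex.I • Complex.I • (a - b) = -(a - b) := by
    rw [smul_smul, Complex.I_mul_I, neg_one_smul]
  have h3 : fderiv ℝ F ζ Complex.I = Complex.I • (a - b) := by
    rw [h, Complex.conj_I]; module
  rw [dz, h3, h2, h 1, map_one]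
  module

lemma dzbar_eq_of_fderiv {a b : E} (h : ∀ v : ℂ, fderiv ℝ F ζ v = v • a + starRingEnd ℂ v • b) :
    dzbar F ζ = b := by
  have h2 : Complex.I • Complex.I • (a - b) = -(a - b) := by
    rw [smul_smul, Complex.I_mul_I, neg_one_smul]
  have h3 : fderiv ℝ F ζ Complex.I = Complex.I • (a - b) := by
    rw [h, Complex.conj_I]; module
  rw [dzbar, h3, h2, h 1, map_one]
  module

lemma contDiffOn_dz {V : Set ℂ} (hV : IsOpen V) (hF : ContDiffOn ℝ ∞ F V) :
    ContDiffOn ℝ ∞ (dz F) V := by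
  have h := hF.fderiv_of_isOpen (m := ∞) hV (by simp)
  have h1 := h.clm_apply (contDiffOn_const (c := (1 : ℂ)))
  have h2 := h.clm_apply (contDiffOn_const (c := Complex.I))
  exact (h1.sub (h2.const_smul Complex.I)).const_smul (1 / 2 : ℂ)

lemma contDiffOn_dzbar {V : Set ℂ} (hV : IsOpen V) (hF : ContDiffOn ℝ ∞ F V) :
    ContDiffOn ℝ ∞ (dzbar F) V := by
  have h := hF.fderiv_of_isOpen (m := ∞) hV (by simp)
  have h1 := h.clm_apply (contDiffOn_const (c := (1 : ℂ)))
  have h2 := h.clm_apply (contDiffOn_const (c := Complex.I))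
  exact (h1.add (h2.const_smul Complex.I)).const_smul (1 / 2 : ℂ)

lemma fderiv_dz_apply (hF : ContDiffAt ℝ 2 F ζ) (v : ℂ) :
    fderiv ℝ (dz F) ζ v = (1 / 2 : ℂ) • (fderiv ℝ (fderiv ℝ F) ζ v 1 -
      Complex.I • fderiv ℝ (fderiv ℝ F) ζ v Complex.I) := by
  have h1 : HasFDerivAt (fderiv ℝ F) _ ζ :=
    ((hF.fderiv_right (m := 1) (by norm_num)).differentiableAt one_ne_zero).hasFDerivAt
  have h2 := ((h1.clm_apply (hasFDerivAt_const (1 : ℂ) ζ)).sub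
    ((h1.clm_apply (hasFDerivAt_const Complex.I ζ)).const_smul Complex.I)).const_smul (1 / 2 : ℂ)
  have h3 : fderiv ℝ (dz F) ζ = _ := h2.fderiv
  rw [h3]
  simp

lemma fderiv_dzbar_apply (hF : ContDiffAt ℝ 2 F ζ) (v : ℂ) :
    fderiv ℝ (dzbar F) ζ v = (1 / 2 : ℂ) • (fderiv ℝ (fderiv ℝ F) ζ v 1 +
      Complex.I • fderiv ℝ (fderiv ℝ F) ζ v Complex.I) := by
  have h1 : HasFDerivAt (fderiv ℝ F) _ ζ :=
    ((hF.fderiv_right (m := 1) (by norm_num)).differentiableAt one_ne_zero).hasFDerivAt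
  have h2 := ((h1.clm_apply (hasFDerivAt_const (1 : ℂ) ζ)).add
    ((h1.clm_apply (hasFDerivAt_const Complex.I ζ)).const_smul Complex.I)).const_smul (1 / 2 : ℂ)
  have h3 : fderiv ℝ (dzbar F) ζ = _ := h2.fderiv
  rw [h3]
  simp

/-- The Laplacian of `F`. -/
def lapl (F : ℂ → E) (ζ : ℂ) : E :=
  fderiv ℝ (fderiv ℝ F) ζ 1 1 + fderiv ℝ (fderiv ℝ F) ζ Complex.I Complex.I

lemma snd_fderiv_symm (hF : ContDiffAt ℝ 2 F ζ) (v w : ℂ) :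
    fderiv ℝ (fderiv ℝ F) ζ v w = fderiv ℝ (fderiv ℝ F) ζ w v :=
  (hF.isSymmSndFDerivAt (by simp)).eq v w

/-- The mixed second derivatives cancel by symmetry, which leaves a quarter of the Laplacian. -/
lemma dzbar_dz (hF : ContDiffAt ℝ 2 F ζ) : dzbar (dz F) ζ = (1 / 4 : ℂ) • lapl F ζ := by
  rw [dzbar, fderiv_dz_apply hF, fderiv_dz_apply hF, snd_fderiv_symm hF Complex.I 1, lapl]
  have h : ∀ x : E, Complex.I • Complex.I • x = -x := fun x ↦ by
    rw [smul_smul, Complex.I_mul_I, neg_one_smul]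
  rw [smul_comm Complex.I (1 / 2 : ℂ), smul_sub Complex.I, h]
  module

lemma dz_dzbar (hF : ContDiffAt ℝ 2 F ζ) : dz (dzbar F) ζ = (1 / 4 : ℂ) • lapl F ζ := by
  rw [dz, fderiv_dzbar_apply hF, fderiv_dzbar_apply hF, snd_fderiv_symm hF Complex.I 1, lapl]
  have h : ∀ x : E, Complex.I • Complex.I • x = -x := fun x ↦ by
    rw [smul_smul, Complex.I_mul_I, neg_one_smul]
  rw [smul_comm Complex.I (1 / 2 : ℂ), smul_add Complex.I, h]
  module

lemma dzbar_smul {σ : ℂ → ℂ} {e : ℂ → E} (hσ : DifferentiableAt ℝ σ ζ)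
    (he : DifferentiableAt ℝ e ζ) :
    dzbar (fun ζ ↦ σ ζ • e ζ) ζ = dzbar σ ζ • e ζ + σ ζ • dzbar e ζ := by
  have h : fderiv ℝ (fun ζ ↦ σ ζ • e ζ) ζ = _ := (hσ.hasFDerivAt.smul he.hasFDerivAt).fderiv
  simp only [dzbar, h, smul_eq_mul]
  simp
  module

lemma dz_smul {σ : ℂ → ℂ} {e : ℂ → E} (hσ : DifferentiableAt ℝ σ ζ)
    (he : DifferentiableAt ℝ e ζ) :
    dz (fun ζ ↦ σ ζ • e ζ) ζ = dz σ ζ • e ζ + σ ζ • dz e ζ := by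
  have h : fderiv ℝ (fun ζ ↦ σ ζ • e ζ) ζ = _ := (hσ.hasFDerivAt.smul he.hasFDerivAt).fderiv
  simp only [dz, h, smul_eq_mul]
  simp
  module

/-- Conjugation exchanges the two Wirtinger derivatives. It turns the `∂/∂z` equation for the
coefficient of `F_z̄` into a `∂/∂z̄` equation, to which the similarity principle applies. -/
lemma dzbar_conj {σ : ℂ → ℂ} (hσ : DifferentiableAt ℝ σ ζ) :
    dzbar (fun ζ ↦ starRingEnd ℂ (σ ζ)) ζ = starRingEnd ℂ (dz σ ζ) := by
  have h : fderiv ℝ (fun ζ ↦ starRingEnd ℂ (σ ζ)) ζ = _ :=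
    (Complex.conjCLE.toContinuousLinearMap.hasFDerivAt.comp ζ hσ.hasFDerivAt).fderiv
  have h2 : starRingEnd ℂ (1 / 2) = 1 / 2 := by
    rw [map_div₀, map_one, Complex.conj_ofNat]
  simp only [dzbar, dz, h, smul_eq_mul, map_mul, map_sub, h2, Complex.conj_I]
  simp

end ComplexCalculus

/-- A shortcut instance: the norm on bilinear forms. -/
instance instNormedAddCommGroupBilin {E : Type*} [NormedAddCommGroup E] [NormedSpace ℝ E] :
    NormedAddCommGroup (E →L[ℝ] E →L[ℝ] ℝ) :=
  ContinuousLinearMap.toNormedAddCommGroup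

/-- A shortcut instance: the normed space of bilinear forms. -/
instance instNormedSpaceBilin {E : Type*} [NormedAddCommGroup E] [NormedSpace ℝ E] :
    NormedSpace ℝ (E →L[ℝ] E →L[ℝ] ℝ) :=
  ContinuousLinearMap.toNormedSpace

/-! ### Hermitian forms described by their real parts. -/

section Hermitian

set_option linter.unusedSectionVars false

variable {E : Type*} [NormedAddCommGroup E] [NormedSpace ℝ E] [NormedSpace ℂ E]
  [IsScalarTower ℝ ℂ E]

/-- A real inner product that is invariant under multiplication by `i`. -/
structure IsHermitianForm (G : E →L[ℝ] E →L[ℝ] ℝ) : Prop where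
  symm : ∀ v w, G v w = G w v
  smul_I : ∀ v w, G (Complex.I • v) (Complex.I • w) = G v w
  pos : ∀ v, v ≠ 0 → 0 < G v v

/-- The Hermitian form whose real part is `G`. -/
def hermForm (G : E →L[ℝ] E →L[ℝ] ℝ) (v w : E) : ℂ :=
  (G v w : ℂ) + Complex.I * (G v (Complex.I • w) : ℂ)

lemma I_smul_I_smul (x : E) : Complex.I • Complex.I • x = -x := by
  rw [smul_smul, Complex.I_mul_I, neg_one_smul]

lemma complex_smul_eq (c : ℂ) (x : E) : c • x = c.re • x + c.im • Complex.I • x := by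
  have hr : ∀ (r : ℝ) (x : E), r • x = (r : ℂ) • x := fun r x ↦ (algebraMap_smul ℂ r x).symm
  conv_lhs => rw [← Complex.re_add_im c]
  rw [hr, hr, add_smul, mul_smul]

variable {G : E →L[ℝ] E →L[ℝ] ℝ}

lemma IsHermitianForm.I_left (hG : IsHermitianForm G) (v w : E) :
    G (Complex.I • v) w = -G v (Complex.I • w) := by
  have h := hG.smul_I v (Complex.I • w)
  rw [I_smul_I_smul, map_neg] at h
  linarith

lemma hermForm_re (v w : E) : (hermForm G v w).re = G v w := by
  simp [hermForm]

lemma hermForm_im (v w : E) : (hermForm G v w).im = G v (Complex.I • w) := by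
  simp [hermForm]

lemma hermForm_add_left (v v' w : E) :
    hermForm G (v + v') w = hermForm G v w + hermForm G v' w := by
  simp [hermForm]; ring

lemma hermForm_sub_left (v v' w : E) :
    hermForm G (v - v') w = hermForm G v w - hermForm G v' w := by
  simp [hermForm]; ring

lemma IsHermitianForm.conj (hG : IsHermitianForm G) (v w : E) :
    starRingEnd ℂ (hermForm G v w) = hermForm G w v := by
  apply Complex.ext
  · simp [hermForm_re, hG.symm v w]
  · rw [Complex.conj_im, hermForm_im, hermForm_im, hG.symm w, hG.I_left]

lemma IsHermitianForm.smul_left (hG : IsHermitianForm G) (c : ℂ) (v w : E) :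
    hermForm G (c • v) w = c * hermForm G v w := by
  apply Complex.ext
  · rw [hermForm_re, Complex.mul_re, hermForm_re, hermForm_im, complex_smul_eq c v]
    simp [hG.I_left]
    ring
  · rw [hermForm_im, Complex.mul_im, hermForm_re, hermForm_im, complex_smul_eq c v]
    simp [hG.I_left, I_smul_I_smul]

lemma IsHermitianForm.smul_right (hG : IsHermitianForm G) (c : ℂ) (v w : E) :
    hermForm G v (c • w) = starRingEnd ℂ c * hermForm G v w := by
  rw [← hG.conj, hG.smul_left, map_mul, hG.conj]

lemma IsHermitianForm.self_eq (hG : IsHermitianForm G) (v : E) :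
    hermForm G v v = (G v v : ℂ) := by
  apply Complex.ext
  · simp [hermForm_re]
  · have h := hG.I_left v v
    rw [hG.symm] at h
    rw [hermForm_im, Complex.ofReal_im]
    linarith

end Hermitian

section BilinearCalculus

variable {E : Type*} [NormedAddCommGroup E] [NormedSpace ℝ E]
  {X : Type*} [NormedAddCommGroup X] [NormedSpace ℝ X]
  {W : Type*} [NormedAddCommGroup W] [NormedSpace ℝ W]

lemma fderiv_bilin_comp_apply {G : E → E →L[ℝ] E →L[ℝ] ℝ} {θ a b : X → E} {x : X}
    {θ' a' b' : X →L[ℝ] E} (hG : DifferentiableAt ℝ G (θ x)) (hθ : HasFDerivAt θ θ' x)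
    (ha : HasFDerivAt a a' x) (hb : HasFDerivAt b b' x) (v : X) :
    fderiv ℝ (fun u ↦ G (θ u) (a u) (b u)) x v =
      fderiv ℝ G (θ x) (θ' v) (a x) (b x) + G (θ x) (a' v) (b x) + G (θ x) (a x) (b' v) := by
  have h1 : HasFDerivAt (fun u ↦ G (θ u)) ((fderiv ℝ G (θ x)).comp θ') x :=
    hG.hasFDerivAt.comp x hθ
  have h2 := h1.clm_apply ha
  have h3 := h2.clm_apply hb
  rw [h3.fderiv]
  simp
  ring

lemma contDiffOn_fderiv_comp_apply {G : E → W} {F v : X → E} {V : Set X} {Ω : Set E}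
    (hΩ : IsOpen Ω) (hFV : MapsTo F V Ω) (hG : ContDiffOn ℝ ∞ G Ω) (hF : ContDiffOn ℝ ∞ F V)
    (hv : ContDiffOn ℝ ∞ v V) : ContDiffOn ℝ ∞ (fun x ↦ fderiv ℝ G (F x) (v x)) V :=
  ((hG.fderiv_of_isOpen (m := ∞) hΩ (by simp)).comp hF hFV).clm_apply hv

lemma contDiffOn_bilin_apply {D : X → E →L[ℝ] E →L[ℝ] ℝ} {v w : X → E} {V : Set X}
    (hD : ContDiffOn ℝ ∞ D V) (hv : ContDiffOn ℝ ∞ v V) (hw : ContDiffOn ℝ ∞ w V) :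
    ContDiffOn ℝ ∞ (fun x ↦ D x (v x) (w x)) V :=
  (hD.clm_apply hv).clm_apply hw

end BilinearCalculus

/-! ### The Chern minimal equation in coordinates, its invariance, and the equations for the
coefficients. -/

section ChernHarmonic

set_option linter.unusedSectionVars false

variable {E : Type*} [NormedAddCommGroup E] [NormedSpace ℝ E] [NormedSpace ℂ E]
  [IsScalarTower ℝ ℂ E]

/-- `Γ` is the Christoffel form at `u` of the Chern connection of the Hermitian metric `G`. -/
def IsChernForm (G : E → E →L[ℝ] E →L[ℝ] ℝ) (u : E) (Γ : E →ₗ[ℂ] E →ₗ[ℂ] E) : Prop :=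
  ∀ v w e, G u (Γ v w) e =
    1 / 2 * (fderiv ℝ G u v w e + fderiv ℝ G u (Complex.I • v) w (Complex.I • e))

/-- The Chern minimal equation `F_{zz̄} = -(Γ(F_z, F_z̄) + Γ(F_z̄, F_z)) / 2` for a map to an open
subset of a complex vector space with Hermitian metric `G`. -/
def IsChernHarmonicAt (G : E → E →L[ℝ] E →L[ℝ] ℝ) (F : ℂ → E) (ζ : ℂ) : Prop :=
  ∃ Γ : E →ₗ[ℂ] E →ₗ[ℂ] E, IsChernForm G (F ζ) Γ ∧
    lapl F ζ = (-2 : ℂ) • (Γ (dz F ζ) (dzbar F ζ) + Γ (dzbar F ζ) (dz F ζ))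

lemma IsChernHarmonicAt.congr {G : E → E →L[ℝ] E →L[ℝ] ℝ} {F F' : ℂ → E} {ζ : ℂ}
    (h : IsChernHarmonicAt G F ζ) (hF : F' =ᶠ[𝓝 ζ] F) : IsChernHarmonicAt G F' ζ := by
  obtain ⟨Γ, h1, h2⟩ := h
  have h3 : fderiv ℝ (fderiv ℝ F') ζ = fderiv ℝ (fderiv ℝ F) ζ := (hF.fderiv (𝕜 := ℝ)).fderiv_eq
  refine ⟨Γ, by rwa [hF.eq_of_nhds], ?_⟩
  simp only [lapl, dz, dzbar, h3, hF.fderiv_eq] at h2 ⊢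
  exact h2

/-- The pair `(c, c i)` is the image of `(1, i)` under a similarity of ratio `|c|`, so the trace is
multiplied by `|c|²`: the cross terms `B 1 i` and `B i 1` cancel in the sum, without any symmetry of
`B`. -/
lemma bilin_trace (B : ℂ → ℂ → E) (hadd : ∀ v v' w, B (v + v') w = B v w + B v' w)
    (hadd' : ∀ v w w', B v (w + w') = B v w + B v w')
    (hsmul : ∀ (r : ℝ) v w, B (r • v) w = r • B v w)
    (hsmul' : ∀ (r : ℝ) v w, B v (r • w) = r • B v w) (c : ℂ) :
    B c c + B (c * Complex.I) (c * Complex.I) =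
      (c * starRingEnd ℂ c) • (B 1 1 + B Complex.I Complex.I) := by
  have hr : ∀ (r : ℝ) (x : E), r • x = (r : ℂ) • x := fun r x ↦ (algebraMap_smul ℂ r x).symm
  have h1 : c = c.re • (1 : ℂ) + c.im • Complex.I := by simp [Complex.re_add_im]
  have h2 : c * Complex.I = (-c.im) • (1 : ℂ) + c.re • Complex.I := by
    apply Complex.ext <;> simp
  have h3 : c * starRingEnd ℂ c = ((c.re * c.re + c.im * c.im : ℝ) : ℂ) := by
    rw [Complex.mul_conj, Complex.normSq_apply]
  rw [h2, h3]
  generalize hs : c.re = s at *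
  generalize ht : c.im = t at *
  clear h3 h2
  subst h1
  simp only [hadd, hadd', hsmul, hsmul']
  rw [← hr]
  module

lemma deriv_eq_fderiv_mul {τ : ℂ → ℂ} {ζ : ℂ} (h : DifferentiableAt ℂ τ ζ) (v : ℂ) :
    fderiv ℝ τ ζ v = deriv τ ζ * v := by
  rw [fderiv_real_apply_of_complex h, fderiv_eq_smul_deriv, smul_eq_mul, mul_comm]

/-- The Chern minimal equation is invariant under holomorphic changes of the coordinate of the
domain. -/
lemma IsChernHarmonicAt.comp_right {G : E → E →L[ℝ] E →L[ℝ] ℝ} {F : ℂ → E} {τ : ℂ → ℂ} {ζ : ℂ}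
    (h : IsChernHarmonicAt G F (τ ζ)) (hτ : ContDiffAt ℂ 2 τ ζ) (hF : ContDiffAt ℝ 2 F (τ ζ)) :
    IsChernHarmonicAt G (F ∘ τ) ζ := by
  obtain ⟨Γ, h1, h2⟩ := h
  refine ⟨Γ, h1, ?_⟩
  have hd : DifferentiableAt ℂ τ ζ := hτ.differentiableAt (by simp)
  have hfd : ∀ v : ℂ, fderiv ℝ (F ∘ τ) ζ v = v • (deriv τ ζ • dz F (τ ζ)) +
      starRingEnd ℂ v • (starRingEnd ℂ (deriv τ ζ) • dzbar F (τ ζ)) := by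
    intro v
    rw [fderiv_comp ζ (hF.differentiableAt (by simp)) (hd.restrictScalars ℝ)]
    rw [ContinuousLinearMap.comp_apply, deriv_eq_fderiv_mul hd, fderiv_apply_eq, map_mul]
    module
  rw [dz_eq_of_fderiv hfd, dzbar_eq_of_fderiv hfd]
  have h3 := bilin_trace (fun v w ↦ fderiv ℝ (fderiv ℝ F) (τ ζ) v w) (by simp) (by simp)
    (fun r v w ↦ by rw [map_smul]; rfl) (fun r v w ↦ by rw [map_smul]) (deriv τ ζ)
  -- Holomorphic functions are harmonic, so the second derivative of `τ` does not contribute to the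
  -- Laplacian of `F ∘ τ`.
  have h4 : fderiv ℂ (fderiv ℂ τ) ζ 1 1 + fderiv ℂ (fderiv ℂ τ) ζ Complex.I Complex.I = 0 := by
    have : Complex.I = Complex.I • (1 : ℂ) := by simp
    rw [this, map_smul, map_smul, smul_apply, I_smul_I_smul]
    simp
  have hτr : ContDiffAt ℝ 2 τ ζ := hτ.restrict_scalars ℝ
  rw [lapl, fderiv_fderiv_comp hF hτr, fderiv_fderiv_comp hF hτr, deriv_eq_fderiv_mul hd,
    deriv_eq_fderiv_mul hd, fderiv_fderiv_real_of_complex hτ, fderiv_fderiv_real_of_complex hτ,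
    add_add_add_comm, ← map_add, h4, map_zero, add_zero, mul_one, h3]
  change _ • lapl F (τ ζ) = _
  rw [h2]
  simp only [map_smul, LinearMap.smul_apply]
  module

/-- The Chern minimal equation is invariant under holomorphic changes of the coordinates of the
target. -/
lemma IsChernHarmonicAt.comp_left {G G' : E → E →L[ℝ] E →L[ℝ] ℝ} {F : ℂ → E} {θ : E → E} {ζ : ℂ}
    (h : IsChernHarmonicAt G F ζ) (hθ : ContDiffAt ℂ 2 θ (F ζ)) (hF : ContDiffAt ℝ 2 F ζ)
    (A : E ≃L[ℂ] E) (hA : fderiv ℂ θ (F ζ) = A) (hG : DifferentiableAt ℝ G (F ζ))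
    (hG' : DifferentiableAt ℝ G' (θ (F ζ))) (hherm : IsHermitianForm (G' (θ (F ζ))))
    (hGG' : ∀ᶠ u in 𝓝 (F ζ), ∀ v w, G u v w = G' (θ u) (fderiv ℂ θ u v) (fderiv ℂ θ u w)) :
    IsChernHarmonicAt G' (θ ∘ F) ζ := by
  obtain ⟨Γ, h1, h2⟩ := h
  set B := fderiv ℂ (fderiv ℂ θ) (F ζ) with hB
  have hθ1 : DifferentiableAt ℂ θ (F ζ) := hθ.differentiableAt (by simp)
  have hθ2 : DifferentiableAt ℂ (fderiv ℂ θ) (F ζ) :=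
    (hθ.fderiv_right (m := 1) (by norm_num)).differentiableAt one_ne_zero
  have hAθ : ∀ x, fderiv ℂ θ (F ζ) x = A x := fun x ↦ by rw [hA]; rfl
  -- The transformation law of the metric, differentiated once; `A` and `B` are the first and second
  -- derivatives of `θ`.
  have hGd : ∀ x v w, fderiv ℝ G (F ζ) x v w =
      fderiv ℝ G' (θ (F ζ)) (A x) (A v) (A w) + G' (θ (F ζ)) (B x v) (A w) +
        G' (θ (F ζ)) (A v) (B x w) := by
    intro x v w
    have hθr : HasFDerivAt θ ((fderiv ℂ θ (F ζ)).restrictScalars ℝ) (F ζ) :=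
      hθ1.hasFDerivAt.restrictScalars ℝ
    have hd : ∀ y, HasFDerivAt (fun u ↦ fderiv ℂ θ u y) ((B.flip y).restrictScalars ℝ) (F ζ) := by
      intro y
      have := (hθ2.hasFDerivAt.clm_apply (hasFDerivAt_const y (F ζ))).restrictScalars ℝ
      refine this.congr_fderiv ?_
      ext z
      simp [hB]
    have e1 := fderiv_bilin_comp_apply (θ := id) (a := fun _ ↦ v) (b := fun _ ↦ w) hG
      (hasFDerivAt_id _) (hasFDerivAt_const _ _) (hasFDerivAt_const _ _) x
    have e2 := fderiv_bilin_comp_apply hG' hθr (hd v) (hd w) x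
    rw [Filter.EventuallyEq.fderiv_eq (hGG'.mono fun u hu ↦ (hu v w).symm)] at e2
    simp [hAθ] at e1 e2
    linarith
  have hGA : ∀ v w, G (F ζ) v w = G' (θ (F ζ)) (A v) (A w) := by
    intro v w
    rw [hGG'.self_of_nhds, hAθ, hAθ]
  set A' : E →ₗ[ℂ] E := A.symm.toLinearEquiv.toLinearMap with hA'
  have hA'1 : ∀ x, A' (A x) = x := fun x ↦ A.symm_apply_apply x
  let B' : E →ₗ[ℂ] E →ₗ[ℂ] E := LinearMap.mk₂ ℂ (fun v w ↦ B v w) (by simp) (by simp) (by simp)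
    (by simp)
  -- The classical transformation law of Christoffel symbols. The Hessian of `θ` enters as a
  -- correction, and the Laplacian of `θ ∘ F` produces the matching term.
  refine ⟨(Γ.compl₁₂ A' A').compr₂ A.toLinearEquiv.toLinearMap - B'.compl₁₂ A' A', ?_, ?_⟩
  · intro v w e
    obtain ⟨v, rfl⟩ := A.surjective v
    obtain ⟨w, rfl⟩ := A.surjective w
    obtain ⟨e, rfl⟩ := A.surjective e
    have e1 : ((Γ.compl₁₂ A' A').compr₂ A.toLinearEquiv.toLinearMap - B'.compl₁₂ A' A') (A v) (A w)
        = A (Γ v w) - B v w := by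
      simp [hA'1, B']
    have e2 := h1 v w e
    rw [hGA, hGd, hGd] at e2
    have e3 : A (Complex.I • v) = Complex.I • A v := map_smul _ _ _
    have e4 : A (Complex.I • e) = Complex.I • A e := map_smul _ _ _
    have e5 : ∀ y, B (Complex.I • v) y = Complex.I • B v y := fun y ↦ by
      rw [map_smul]; rfl
    -- Replacing `(v, e)` by `(i v, i e)` keeps the term with `B v w` and changes the sign of the
    -- one with `B v e`, because `B` is complex bilinear; the latter drops out of the sum.
    rw [e3, e4, e5, e5, map_smul (B v) Complex.I e, I_smul_I_smul, hherm.smul_I, map_neg] at e2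
    rw [Function.comp_apply, e1, map_sub, sub_apply, e2]
    ring
  · have hθr : ContDiffAt ℝ 2 θ (F ζ) := hθ.restrict_scalars ℝ
    have hfd : ∀ v : ℂ, fderiv ℝ (θ ∘ F) ζ v = v • A (dz F ζ) +
        starRingEnd ℂ v • A (dzbar F ζ) := by
      intro v
      rw [fderiv_comp ζ (hθr.differentiableAt (by simp)) (hF.differentiableAt (by simp)),
        ContinuousLinearMap.comp_apply, fderiv_real_apply_of_complex hθ1, hAθ, fderiv_apply_eq]
      simp
    rw [dz_eq_of_fderiv hfd, dzbar_eq_of_fderiv hfd]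
    rw [lapl, fderiv_fderiv_comp hθr hF, fderiv_fderiv_comp hθr hF,
      fderiv_fderiv_real_of_complex hθ, fderiv_fderiv_real_of_complex hθ,
      fderiv_real_apply_of_complex hθ1, fderiv_real_apply_of_complex hθ1, hAθ, hAθ,
      add_add_add_comm, ← map_add, fderiv_one_eq, fderiv_I_eq]
    change _ + A (lapl F ζ) = _
    rw [h2]
    simp only [map_smul, map_add, map_sub, add_apply, sub_apply, smul_apply,
      LinearMap.sub_apply, LinearMap.compr₂_apply, LinearMap.compl₁₂_apply, hA'1, B',
      LinearMap.mk₂_apply, ← hB]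
    rw [← smul_sub, I_smul_I_smul]
    change _ = (-2 : ℂ) • (A _ - _ + (A _ - _))
    module

/-- The sesquilinear expression `h(Γ(v, w), e)` in terms of the derivative of the metric. -/
def chernExpr (D : E → E →L[ℝ] E →L[ℝ] ℝ) (v w e : E) : ℂ :=
  (1 / 2 * (D v w e + D (Complex.I • v) w (Complex.I • e)) : ℝ) +
    Complex.I * (1 / 2 * (D v w (Complex.I • e) - D (Complex.I • v) w e) : ℝ)

/-- `IsChernForm` gives the real part; the imaginary part is the same identity for `i e` in place of
`e`. -/
lemma IsChernForm.hermForm_eq {G : E → E →L[ℝ] E →L[ℝ] ℝ} {u : E} {Γ : E →ₗ[ℂ] E →ₗ[ℂ] E}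
    (h : IsChernForm G u Γ) (v w e : E) :
    hermForm (G u) (Γ v w) e = chernExpr (fderiv ℝ G u) v w e := by
  rw [hermForm, h, h, I_smul_I_smul, map_neg, ← sub_eq_add_neg, chernExpr]

/-- `IsChernHarmonicAt` supplies `Γ` separately at each point, with no smooth dependence. Smoothness
of the coefficient `c` is obtained from this explicit expression in the derivative of the metric. -/
lemma contDiffOn_chernExpr {G : E → E →L[ℝ] E →L[ℝ] ℝ} {F v w e : ℂ → E} {V : Set ℂ} {Ω : Set E}
    (hΩ : IsOpen Ω) (hFV : MapsTo F V Ω) (hG : ContDiffOn ℝ ∞ G Ω) (hF : ContDiffOn ℝ ∞ F V)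
    (hv : ContDiffOn ℝ ∞ v V) (hw : ContDiffOn ℝ ∞ w V) (he : ContDiffOn ℝ ∞ e V) :
    ContDiffOn ℝ ∞ (fun ζ ↦ chernExpr (fderiv ℝ G (F ζ)) (v ζ) (w ζ) (e ζ)) V := by
  have hv' := hv.const_smul Complex.I
  have he' := he.const_smul Complex.I
  have hD := contDiffOn_fderiv_comp_apply hΩ hFV hG hF hv
  have hD' := contDiffOn_fderiv_comp_apply hΩ hFV hG hF hv'
  have h1 := (contDiffOn_bilin_apply hD hw he).add (contDiffOn_bilin_apply hD' hw he')
  have h2 := (contDiffOn_bilin_apply hD hw he').sub (contDiffOn_bilin_apply hD' hw he)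
  have h3 := Complex.ofRealCLM.contDiff.comp_contDiffOn
    ((contDiffOn_const (c := (1 / 2 : ℝ))).mul h1)
  have h4 := Complex.ofRealCLM.contDiff.comp_contDiffOn
    ((contDiffOn_const (c := (1 / 2 : ℝ))).mul h2)
  exact h3.add (contDiffOn_const.mul h4)

lemma contDiffOn_hermForm {D : ℂ → E →L[ℝ] E →L[ℝ] ℝ} {v w : ℂ → E} {V : Set ℂ}
    (hD : ContDiffOn ℝ ∞ D V) (hv : ContDiffOn ℝ ∞ v V) (hw : ContDiffOn ℝ ∞ w V) :
    ContDiffOn ℝ ∞ (fun ζ ↦ hermForm (D ζ) (v ζ) (w ζ)) V := by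
  have h1 := contDiffOn_bilin_apply hD hv hw
  have h2 := contDiffOn_bilin_apply hD hv (hw.const_smul Complex.I)
  exact (Complex.ofRealCLM.contDiff.comp_contDiffOn h1).add
    (contDiffOn_const.mul (Complex.ofRealCLM.contDiff.comp_contDiffOn h2))

/-- Let `F` solve the Chern minimal equation on `V`. If `F_z = σ e` with `h(e, e) = 1`, then
`σ` satisfies an equation `∂σ/∂z̄ = c σ`. -/
lemma exists_dzbar_coeff_eq {G : E → E →L[ℝ] E →L[ℝ] ℝ} {F e : ℂ → E} {σ : ℂ → ℂ} {V : Set ℂ}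
    {Ω : Set E} (hV : IsOpen V) (hΩ : IsOpen Ω) (hFV : MapsTo F V Ω)
    (hG : ContDiffOn ℝ ∞ G Ω) (hherm : ∀ u ∈ Ω, IsHermitianForm (G u)) (hF : ContDiffOn ℝ ∞ F V)
    (hch : ∀ ζ ∈ V, IsChernHarmonicAt G F ζ) (he : ContDiffOn ℝ ∞ e V)
    (hσ : ContDiffOn ℝ ∞ σ V) (hee : ∀ ζ ∈ V, hermForm (G (F ζ)) (e ζ) (e ζ) = 1)
    (ha : ∀ ζ ∈ V, dz F ζ = σ ζ • e ζ) :
    ∃ c : ℂ → ℂ, ContDiffOn ℝ ∞ c V ∧ ∀ ζ ∈ V, dzbar σ ζ = c ζ * σ ζ := by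
  have hb := contDiffOn_dzbar hV hF
  -- The Hermitian product with `e` of `σ_z̄ e + σ e_z̄ = F_{zz̄}` determines `c`. The factor `-1/2`
  -- is the `-2` of the equation times the `1/4` that relates `F_{zz̄}` to the Laplacian.
  refine ⟨fun ζ ↦ -(1 / 2) * (chernExpr (fderiv ℝ G (F ζ)) (e ζ) (dzbar F ζ) (e ζ) +
    chernExpr (fderiv ℝ G (F ζ)) (dzbar F ζ) (e ζ) (e ζ)) -
      hermForm (G (F ζ)) (dzbar e ζ) (e ζ), ?_, ?_⟩
  · exact (contDiffOn_const.mul ((contDiffOn_chernExpr hΩ hFV hG hF he hb he).add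
      (contDiffOn_chernExpr hΩ hFV hG hF hb he he))).sub
        (contDiffOn_hermForm (hG.comp hF hFV) (contDiffOn_dzbar hV he) he)
  · intro ζ hζ
    have hn := hV.mem_nhds hζ
    have hF2 : ContDiffAt ℝ 2 F ζ := (hF.contDiffAt hn).of_le (by norm_cast)
    obtain ⟨Γ, h1, h2⟩ := hch ζ hζ
    have h3 := dzbar_smul ((hσ.contDiffAt hn).differentiableAt (by simp))
      ((he.contDiffAt hn).differentiableAt (by simp))
    have h4 : dzbar (fun ζ ↦ σ ζ • e ζ) ζ = dzbar (dz F) ζ := by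
      have : (fun ζ ↦ σ ζ • e ζ) =ᶠ[𝓝 ζ] dz F := by
        filter_upwards [hn] with ξ hξ using (ha ξ hξ).symm
      simp only [dzbar, this.fderiv_eq]
    rw [h4, dzbar_dz hF2, h2, ha ζ hζ] at h3
    have h5 := congrArg (fun x ↦ hermForm (G (F ζ)) x (e ζ)) h3
    have hH := hherm _ (hFV hζ)
    simp only [map_smul, LinearMap.smul_apply, hermForm_add_left, hH.smul_left, h1.hermForm_eq,
      hee ζ hζ] at h5
    linear_combination -h5

/-- Let `F` solve the Chern minimal equation on `V`. If `F_z̄ = τ e` with `h(e, e) = 1`, then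
the conjugate of `τ` satisfies an equation `∂τ̄/∂z̄ = c τ̄`. -/
lemma exists_dzbar_conj_coeff_eq {G : E → E →L[ℝ] E →L[ℝ] ℝ} {F e : ℂ → E} {τ : ℂ → ℂ} {V : Set ℂ}
    {Ω : Set E} (hV : IsOpen V) (hΩ : IsOpen Ω) (hFV : MapsTo F V Ω)
    (hG : ContDiffOn ℝ ∞ G Ω) (hherm : ∀ u ∈ Ω, IsHermitianForm (G u)) (hF : ContDiffOn ℝ ∞ F V)
    (hch : ∀ ζ ∈ V, IsChernHarmonicAt G F ζ) (he : ContDiffOn ℝ ∞ e V)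
    (hτ : ContDiffOn ℝ ∞ τ V) (hee : ∀ ζ ∈ V, hermForm (G (F ζ)) (e ζ) (e ζ) = 1)
    (hb : ∀ ζ ∈ V, dzbar F ζ = τ ζ • e ζ) :
    ∃ c : ℂ → ℂ, ContDiffOn ℝ ∞ c V ∧ ∀ ζ ∈ V,
      dzbar (fun ζ ↦ starRingEnd ℂ (τ ζ)) ζ = c ζ * starRingEnd ℂ (τ ζ) := by
  have ha := contDiffOn_dz hV hF
  refine ⟨fun ζ ↦ starRingEnd ℂ
    (-(1 / 2) * (chernExpr (fderiv ℝ G (F ζ)) (e ζ) (dz F ζ) (e ζ) +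
      chernExpr (fderiv ℝ G (F ζ)) (dz F ζ) (e ζ) (e ζ)) -
        hermForm (G (F ζ)) (dz e ζ) (e ζ)), ?_, ?_⟩
  · exact Complex.conjCLE.contDiff.comp_contDiffOn
      ((contDiffOn_const.mul ((contDiffOn_chernExpr hΩ hFV hG hF he ha he).add
      (contDiffOn_chernExpr hΩ hFV hG hF ha he he))).sub
        (contDiffOn_hermForm (hG.comp hF hFV) (contDiffOn_dz hV he) he))
  · intro ζ hζ
    have hn := hV.mem_nhds hζ
    have hF2 : ContDiffAt ℝ 2 F ζ := (hF.contDiffAt hn).of_le (by norm_cast)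
    obtain ⟨Γ, h1, h2⟩ := hch ζ hζ
    have hτd := (hτ.contDiffAt hn).differentiableAt (by simp)
    have h3 := dz_smul hτd ((he.contDiffAt hn).differentiableAt (by simp))
    have h4 : dz (fun ζ ↦ τ ζ • e ζ) ζ = dz (dzbar F) ζ := by
      have : (fun ζ ↦ τ ζ • e ζ) =ᶠ[𝓝 ζ] dzbar F := by
        filter_upwards [hn] with ξ hξ using (hb ξ hξ).symm
      simp only [dz, this.fderiv_eq]
    rw [h4, dz_dzbar hF2, h2, hb ζ hζ] at h3
    have h5 := congrArg (fun x ↦ hermForm (G (F ζ)) x (e ζ)) h3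
    have hH := hherm _ (hFV hζ)
    simp only [map_smul, LinearMap.smul_apply, hermForm_add_left, hH.smul_left, h1.hermForm_eq,
      hee ζ hζ] at h5
    rw [dzbar_conj hτd, ← map_mul]
    congr 1
    linear_combination -h5

end ChernHarmonic

/-! ### Smooth unitary frames adapted to two orthogonal vector functions. -/

section LocalFrame

set_option linter.unusedSectionVars false

variable {E : Type*} [NormedAddCommGroup E] [NormedSpace ℝ E] [NormedSpace ℂ E]
  [IsScalarTower ℝ ℂ E]

/-- In dimension two, a vector orthogonal to `e₁` is a multiple of `e₂`. -/
lemma IsHermitianForm.eq_smul_of_orthogonal {G : E →L[ℝ] E →L[ℝ] ℝ} (hG : IsHermitianForm G)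
    (hE : Module.finrank ℂ E = 2) {e₁ e₂ v : E} (h₁ : hermForm G e₁ e₁ = 1)
    (h₂ : hermForm G e₂ e₂ = 1) (h₁₂ : hermForm G e₁ e₂ = 0) (hv : hermForm G v e₁ = 0) :
    v = hermForm G v e₂ • e₂ := by
  have h₂₁ : hermForm G e₂ e₁ = 0 := by rw [← hG.conj, h₁₂, map_zero]
  have hli : LinearIndependent ℂ ![e₁, e₂] := by
    rw [LinearIndependent.pair_iff]
    intro s t hst
    have e1 : hermForm G (s • e₁ + t • e₂) e₁ = 0 := by rw [hst]; simp [hermForm]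
    have e2 : hermForm G (s • e₁ + t • e₂) e₂ = 0 := by rw [hst]; simp [hermForm]
    rw [hermForm_add_left, hG.smul_left, hG.smul_left] at e1 e2
    rw [h₁, h₂₁] at e1
    rw [h₂, h₁₂] at e2
    constructor <;> [simpa using e1; simpa using e2]
  have hspan := hli.span_eq_top_of_card_eq_finrank (by simp [hE])
  have hmem : v ∈ Submodule.span ℂ {e₁, e₂} := by
    have : v ∈ Submodule.span ℂ (Set.range ![e₁, e₂]) := by rw [hspan]; trivial
    simpa [Set.pair_comm] using this
  obtain ⟨s, t, rfl⟩ := Submodule.mem_span_pair.1 hmem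
  rw [hermForm_add_left, hG.smul_left, hG.smul_left, h₁, h₂₁] at hv
  have hs : s = 0 := by simpa using hv
  subst hs
  rw [zero_smul, zero_add, hG.smul_left, h₂, mul_one]

variable {D : ℂ → E →L[ℝ] E →L[ℝ] ℝ} {V : Set ℂ} {ζ₀ : ℂ}

/-- Normalization of a smooth vector function. -/
lemma exists_smooth_normalization (hD : ContDiffOn ℝ ∞ D V)
    (hherm : ∀ ζ ∈ V, IsHermitianForm (D ζ)) {v : ℂ → E} (hv : ContDiffOn ℝ ∞ v V)
    (hv0 : ∀ ζ ∈ V, v ζ ≠ 0) :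
    ∃ r : ℂ → ℂ, ContDiffOn ℝ ∞ r V ∧ (∀ ζ ∈ V, r ζ ≠ 0) ∧
      ∀ ζ ∈ V, hermForm (D ζ) (r ζ • v ζ) (r ζ • v ζ) = 1 := by
  have hs := contDiffOn_bilin_apply hD hv hv
  have hp : ∀ ζ ∈ V, 0 < D ζ (v ζ) (v ζ) := fun ζ hζ ↦ (hherm ζ hζ).pos _ (hv0 ζ hζ)
  have hq := (hs.sqrt fun ζ hζ ↦ (hp ζ hζ).ne').inv fun ζ hζ ↦ (Real.sqrt_pos.2 (hp ζ hζ)).ne'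
  refine ⟨fun ζ ↦ (((√(D ζ (v ζ) (v ζ)))⁻¹ : ℝ) : ℂ),
    Complex.ofRealCLM.contDiff.comp_contDiffOn hq, fun ζ hζ ↦ ?_, fun ζ hζ ↦ ?_⟩
  · exact Complex.ofReal_ne_zero.2 (inv_ne_zero (Real.sqrt_pos.2 (hp ζ hζ)).ne')
  · rw [(hherm ζ hζ).smul_left, (hherm ζ hζ).smul_right, (hherm ζ hζ).self_eq, Complex.conj_ofReal]
    have h := Real.mul_self_sqrt (hp ζ hζ).le
    have h' := (Real.sqrt_pos.2 (hp ζ hζ)).ne'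
    rw [← Complex.ofReal_mul, ← Complex.ofReal_mul, ← Complex.ofReal_one]
    congr 1
    field_simp
    linarith

/-- A smooth unit vector function is part of a smooth unitary frame. -/
lemma exists_smooth_unit_orthogonal (hE : Module.finrank ℂ E = 2) (hV : IsOpen V) (hζ₀ : ζ₀ ∈ V)
    (hD : ContDiffOn ℝ ∞ D V) (hherm : ∀ ζ ∈ V, IsHermitianForm (D ζ)) {e : ℂ → E}
    (he : ContDiffOn ℝ ∞ e V) (he1 : ∀ ζ ∈ V, hermForm (D ζ) (e ζ) (e ζ) = 1) :
    ∃ (W : Set ℂ) (e' : ℂ → E), IsOpen W ∧ ζ₀ ∈ W ∧ W ⊆ V ∧ ContDiffOn ℝ ∞ e' W ∧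
      (∀ ζ ∈ W, hermForm (D ζ) (e' ζ) (e' ζ) = 1) ∧ ∀ ζ ∈ W, hermForm (D ζ) (e' ζ) (e ζ) = 0 := by
  -- Gram–Schmidt applied to a constant vector independent of `e ζ₀`; the result stays nonzero near
  -- `ζ₀`.
  obtain ⟨c, hc⟩ : ∃ c, c ∉ Submodule.span ℂ {e ζ₀} := by
    by_contra! h
    have h1 : Submodule.span ℂ {e ζ₀} = ⊤ := eq_top_iff.2 fun x _ ↦ h x
    have h2 := finrank_span_le_card (R := ℂ) ({e ζ₀} : Set E)
    rw [h1, finrank_top, hE] at h2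
    simp at h2
  set w : ℂ → E := fun ζ ↦ c - hermForm (D ζ) c (e ζ) • e ζ with hw
  have hws : ContDiffOn ℝ ∞ w V :=
    contDiffOn_const.sub ((contDiffOn_hermForm hD contDiffOn_const he).smul he)
  have hw0 : w ζ₀ ≠ 0 := by
    intro h
    apply hc
    rw [sub_eq_zero.1 h]
    exact Submodule.smul_mem _ _ (Submodule.mem_span_singleton_self _)
  have hwe : ∀ ζ ∈ V, hermForm (D ζ) (w ζ) (e ζ) = 0 := by
    intro ζ hζ
    rw [hw]
    simp only
    rw [hermForm_sub_left, (hherm ζ hζ).smul_left, he1 ζ hζ, mul_one, sub_self]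
  have hWo : IsOpen (V ∩ w ⁻¹' {0}ᶜ) := hws.continuousOn.isOpen_inter_preimage hV isOpen_compl_singleton
  obtain ⟨r, hr, hr0, hr1⟩ := exists_smooth_normalization (V := V ∩ w ⁻¹' {0}ᶜ)
    (hD.mono inter_subset_left) (fun ζ hζ ↦ hherm ζ hζ.1) (hws.mono inter_subset_left)
    (fun ζ hζ ↦ hζ.2)
  refine ⟨_, fun ζ ↦ r ζ • w ζ, hWo, ⟨hζ₀, hw0⟩, inter_subset_left,
    hr.smul (hws.mono inter_subset_left), hr1, fun ζ hζ ↦ ?_⟩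
  rw [(hherm ζ hζ.1).smul_left, hwe ζ hζ.1, mul_zero]

/-- Two orthogonal smooth vector functions, the first of which does not vanish, are multiples of
the vectors of a smooth unitary frame. -/
lemma exists_unitary_frame_of_ne_zero (hE : Module.finrank ℂ E = 2) (hV : IsOpen V) (hζ₀ : ζ₀ ∈ V)
    (hD : ContDiffOn ℝ ∞ D V) (hherm : ∀ ζ ∈ V, IsHermitianForm (D ζ)) {a b : ℂ → E}
    (ha : ContDiffOn ℝ ∞ a V) (hb : ContDiffOn ℝ ∞ b V)
    (hab : ∀ ζ ∈ V, hermForm (D ζ) (b ζ) (a ζ) = 0) (h0 : a ζ₀ ≠ 0) :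
    ∃ (W : Set ℂ) (e₁ e₂ : ℂ → E) (σ τ : ℂ → ℂ), IsOpen W ∧ ζ₀ ∈ W ∧ W ⊆ V ∧
      ContDiffOn ℝ ∞ e₁ W ∧ ContDiffOn ℝ ∞ e₂ W ∧ ContDiffOn ℝ ∞ σ W ∧ ContDiffOn ℝ ∞ τ W ∧
      (∀ ζ ∈ W, hermForm (D ζ) (e₁ ζ) (e₁ ζ) = 1) ∧ (∀ ζ ∈ W, hermForm (D ζ) (e₂ ζ) (e₂ ζ) = 1) ∧
      (∀ ζ ∈ W, hermForm (D ζ) (e₁ ζ) (e₂ ζ) = 0) ∧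
      (∀ ζ ∈ W, a ζ = σ ζ • e₁ ζ) ∧ ∀ ζ ∈ W, b ζ = τ ζ • e₂ ζ := by
  have hWo : IsOpen (V ∩ a ⁻¹' {0}ᶜ) := ha.continuousOn.isOpen_inter_preimage hV isOpen_compl_singleton
  obtain ⟨r, hr, hr0, hr1⟩ := exists_smooth_normalization (V := V ∩ a ⁻¹' {0}ᶜ)
    (hD.mono inter_subset_left) (fun ζ hζ ↦ hherm ζ hζ.1) (ha.mono inter_subset_left)
    (fun ζ hζ ↦ hζ.2)
  have he : ContDiffOn ℝ ∞ (fun ζ ↦ r ζ • a ζ) (V ∩ a ⁻¹' {0}ᶜ) := hr.smul (ha.mono inter_subset_left)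
  obtain ⟨W, e', hW, hζW, hWV, he', he'1, he'0⟩ := exists_smooth_unit_orthogonal hE hWo
    ⟨hζ₀, h0⟩ (hD.mono inter_subset_left) (fun ζ hζ ↦ hherm ζ hζ.1) he hr1
  have hWV' : W ⊆ V := hWV.trans inter_subset_left
  have hor : ∀ ζ ∈ W, hermForm (D ζ) (r ζ • a ζ) (e' ζ) = 0 := by
    intro ζ hζ
    rw [← (hherm ζ (hWV' hζ)).conj, he'0 ζ hζ, map_zero]
  -- In dimension two `b`, being orthogonal to `a`, is a multiple of `e'`. Its coefficient is a
  -- Hermitian product, hence smooth even at zeros of `b`.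
  refine ⟨W, fun ζ ↦ r ζ • a ζ, e', fun ζ ↦ (r ζ)⁻¹, fun ζ ↦ hermForm (D ζ) (b ζ) (e' ζ), hW, hζW,
    hWV', he.mono hWV, he', (hr.mono hWV).inv fun ζ hζ ↦ hr0 ζ (hWV hζ),
    contDiffOn_hermForm (hD.mono hWV') (hb.mono hWV') he', fun ζ hζ ↦ hr1 ζ (hWV hζ), he'1, hor,
    fun ζ hζ ↦ ?_, fun ζ hζ ↦ ?_⟩
  · rw [smul_smul, inv_mul_cancel₀ (hr0 ζ (hWV hζ)), one_smul]
  · refine (hherm ζ (hWV' hζ)).eq_smul_of_orthogonal hE (hr1 ζ (hWV hζ)) (he'1 ζ hζ) (hor ζ hζ) ?_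
    rw [(hherm ζ (hWV' hζ)).smul_right, hab ζ (hWV' hζ), mul_zero]

/-- Two orthogonal smooth vector functions without common zeros are multiples of the vectors of a
smooth unitary frame. -/
lemma exists_unitary_frame (hE : Module.finrank ℂ E = 2) (hV : IsOpen V) (hζ₀ : ζ₀ ∈ V)
    (hD : ContDiffOn ℝ ∞ D V) (hherm : ∀ ζ ∈ V, IsHermitianForm (D ζ)) {a b : ℂ → E}
    (ha : ContDiffOn ℝ ∞ a V) (hb : ContDiffOn ℝ ∞ b V)
    (hab : ∀ ζ ∈ V, hermForm (D ζ) (a ζ) (b ζ) = 0) (h0 : a ζ₀ ≠ 0 ∨ b ζ₀ ≠ 0) :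
    ∃ (W : Set ℂ) (e₁ e₂ : ℂ → E) (σ τ : ℂ → ℂ), IsOpen W ∧ ζ₀ ∈ W ∧ W ⊆ V ∧
      ContDiffOn ℝ ∞ e₁ W ∧ ContDiffOn ℝ ∞ e₂ W ∧ ContDiffOn ℝ ∞ σ W ∧ ContDiffOn ℝ ∞ τ W ∧
      (∀ ζ ∈ W, hermForm (D ζ) (e₁ ζ) (e₁ ζ) = 1) ∧ (∀ ζ ∈ W, hermForm (D ζ) (e₂ ζ) (e₂ ζ) = 1) ∧
      (∀ ζ ∈ W, hermForm (D ζ) (e₁ ζ) (e₂ ζ) = 0) ∧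
      (∀ ζ ∈ W, a ζ = σ ζ • e₁ ζ) ∧ ∀ ζ ∈ W, b ζ = τ ζ • e₂ ζ := by
  rcases h0 with h0 | h0
  · refine exists_unitary_frame_of_ne_zero hE hV hζ₀ hD hherm ha hb (fun ζ hζ ↦ ?_) h0
    rw [← (hherm ζ hζ).conj, hab ζ hζ, map_zero]
  · obtain ⟨W, e₁, e₂, σ, τ, hW, hζW, hWV, h1, h2, h3, h4, h5, h6, h7, h8, h9⟩ :=
      exists_unitary_frame_of_ne_zero hE hV hζ₀ hD hherm hb ha hab h0
    refine ⟨W, e₂, e₁, τ, σ, hW, hζW, hWV, h2, h1, h4, h3, h6, h5, fun ζ hζ ↦ ?_, h9, h8⟩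
    rw [← (hherm ζ (hWV hζ)).conj, h7 ζ hζ, map_zero]

end LocalFrame

/-! ### Holomorphic transition maps, coordinate vector fields and the metric in charts. -/

section ChartCalculus

set_option linter.unusedSectionVars false

variable {E : Type*} [NormedAddCommGroup E] [NormedSpace ℝ E] [NormedSpace ℂ E]
  [IsScalarTower ℝ ℂ E] {M : Type*} [TopologicalSpace M] [ChartedSpace E M]
  [IsManifold 𝓘(ℂ, E) ω M]

/-- The transition map between two charts of a complex manifold is holomorphic. -/
lemma contDiffAt_transition {e e' : OpenPartialHomeomorph M E}
    (he : e ∈ IsManifold.maximalAtlas 𝓘(ℂ, E) ω M) (he' : e' ∈ IsManifold.maximalAtlas 𝓘(ℂ, E) ω M)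
    {x : M} (hx : x ∈ e.source) (hx' : x ∈ e'.source) :
    ContDiffAt ℂ ω (e' ∘ e.symm) (e x) := by
  have h := StructureGroupoid.compatible_of_mem_maximalAtlas he he'
  rw [contDiffGroupoid, mem_groupoid_of_pregroupoid] at h
  have h1 : ContDiffOn ℂ ω (e.symm ≫ₕ e') (e.symm ≫ₕ e').source := by
    simpa [contDiffPregroupoid] using h.1
  exact h1.contDiffAt ((e.symm ≫ₕ e').open_source.mem_nhds (by simp [hx, hx']))

lemma chartAt_mem_maximalAtlas' (m : M) :
    chartAt E m ∈ IsManifold.maximalAtlas 𝓘(ℂ, E) ω M :=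
  IsManifold.chart_mem_maximalAtlas m

/-- The derivative of a transition map is invertible. -/
lemma exists_transition_equiv {e e' : OpenPartialHomeomorph M E}
    (he : e ∈ IsManifold.maximalAtlas 𝓘(ℂ, E) ω M) (he' : e' ∈ IsManifold.maximalAtlas 𝓘(ℂ, E) ω M)
    {x : M} (hx : x ∈ e.source) (hx' : x ∈ e'.source) :
    ∃ A : E ≃L[ℂ] E, fderiv ℂ (e' ∘ e.symm) (e x) = A := by
  have h1 := (contDiffAt_transition he he' hx hx').differentiableAt (by simp)
  have h2 := (contDiffAt_transition he' he hx' hx).differentiableAt (by simp)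
  have key : ∀ {e e' : OpenPartialHomeomorph M E}, x ∈ e.source → x ∈ e'.source →
      DifferentiableAt ℂ (e' ∘ e.symm) (e x) → DifferentiableAt ℂ (e ∘ e'.symm) (e' x) →
      (fderiv ℂ (e ∘ e'.symm) (e' x)).comp (fderiv ℂ (e' ∘ e.symm) (e x)) =
        ContinuousLinearMap.id ℂ E := by
    intro e e' hx hx' h1 h2
    have h3 : (e' ∘ e.symm) (e x) = e' x := by simp [hx]
    rw [← h3] at h2 ⊢
    rw [← fderiv_comp _ h2 h1]
    have h4 : (e ∘ e'.symm) ∘ (e' ∘ e.symm) =ᶠ[𝓝 (e x)] id := by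
      have h5 : ∀ᶠ u in 𝓝 (e x), u ∈ e.target ∧ e.symm u ∈ e'.source := by
        have h5a : ∀ᶠ u in 𝓝 (e x), u ∈ e.target := e.open_target.mem_nhds (e.map_source hx)
        have h5b : ∀ᶠ u in 𝓝 (e x), e.symm u ∈ e'.source :=
          (e.continuousAt_symm (e.map_source hx)).eventually
            (e'.open_source.mem_nhds (by simpa [hx] using hx'))
        exact h5a.and h5b
      filter_upwards [h5] with u hu
      simp [hu.1, hu.2]
    rw [h4.fderiv_eq, fderiv_id]
  have k1 := key hx hx' h1 h2
  have k2 := key hx' hx h2 h1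
  exact ⟨ContinuousLinearEquiv.equivOfInverse' _ _ k2 k1, rfl⟩

/-- The real coordinate change of tangent vectors is the complex derivative of the transition
map. -/
lemma tangentCoordChange_eq {x y z : M} (hx : z ∈ (chartAt E x).source)
    (hy : z ∈ (chartAt E y).source) (v : E) :
    tangentCoordChange 𝓘(ℝ, E) x y z v =
      fderiv ℂ (chartAt E y ∘ (chartAt E x).symm) (chartAt E x z) v := by
  rw [tangentCoordChange_def, ← fderiv_real_apply_of_complex
    ((contDiffAt_transition (chartAt_mem_maximalAtlas' x) (chartAt_mem_maximalAtlas' y)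
      hx hy).differentiableAt (by simp))]
  simp

/-- The section of the tangent bundle with constant coordinates in the chart at `m`. -/
def constField (m : M) (v : E) (p : M) : TangentSpace 𝓘(ℝ, E) p :=
  tangentCoordChange 𝓘(ℝ, E) m p p v

lemma contMDiffOn_constField (m : M) (v : E) :
    ContMDiffOn 𝓘(ℝ, E) 𝓘(ℝ, E).tangent ∞
      (fun p ↦ (⟨p, constField m v p⟩ : TangentBundle 𝓘(ℝ, E) M)) (chartAt E m).source := by
  have h := (trivializationAt E (TangentSpace 𝓘(ℝ, E)) m).contMDiffOn_section_baseSet_iff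
    (IB := 𝓘(ℝ, E)) (n := ∞) (s := fun p ↦ constField m v p)
  rw [TangentBundle.trivializationAt_baseSet] at h
  refine h.2 ?_
  refine contMDiffOn_const (c := v) |>.congr fun p hp ↦ ?_
  rw [TangentBundle.trivializationAt_apply]
  change tangentCoordChange 𝓘(ℝ, E) p m p (tangentCoordChange 𝓘(ℝ, E) m p p v) = v
  rw [tangentCoordChange_comp (by simp [hp]), tangentCoordChange_self (by simpa using hp)]

end ChartCalculus

section MetricCoord

set_option linter.unusedSectionVars false

variable {E : Type*} [NormedAddCommGroup E] [NormedSpace ℝ E] [NormedSpace ℂ E]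
  [IsScalarTower ℝ ℂ E] {M : Type*} [TopologicalSpace M] [ChartedSpace E M]
  [IsManifold 𝓘(ℂ, E) ω M]
  [Bundle.RiemannianBundle (fun x : M ↦ TangentSpace 𝓘(ℝ, E) x)]

/-- The Riemannian metric at a point, in the preferred chart at that point. -/
def metricAt (p : M) : E →L[ℝ] E →L[ℝ] ℝ :=
  (innerSL ℝ : TangentSpace 𝓘(ℝ, E) p →L[ℝ] TangentSpace 𝓘(ℝ, E) p →L[ℝ] ℝ)

/-- The Riemannian metric in the chart at `m`. -/
def metricCoord (m : M) (u : E) : E →L[ℝ] E →L[ℝ] ℝ :=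
  (metricAt ((chartAt E m).symm u)).bilinearComp
    (tangentCoordChange 𝓘(ℝ, E) m ((chartAt E m).symm u) ((chartAt E m).symm u))
    (tangentCoordChange 𝓘(ℝ, E) m ((chartAt E m).symm u) ((chartAt E m).symm u))

lemma metricCoord_apply (m : M) (u v w : E) :
    metricCoord m u v w = metricAt ((chartAt E m).symm u)
      (tangentCoordChange 𝓘(ℝ, E) m ((chartAt E m).symm u) ((chartAt E m).symm u) v)
      (tangentCoordChange 𝓘(ℝ, E) m ((chartAt E m).symm u) ((chartAt E m).symm u) w) := rfl

lemma isHermitianForm_metricAt (hM : IsHermitianMetric E M) (p : M) :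
    IsHermitianForm (metricAt (E := E) p) where
  symm v w := real_inner_comm (F := TangentSpace 𝓘(ℝ, E) p) w v
  smul_I v w := hM p v w
  pos _ hv := real_inner_self_pos (F := TangentSpace 𝓘(ℝ, E) p).2 hv

/-- Coordinate changes of tangent vectors are complex linear and injective, so invariance under `i`
and positivity carry over from the preferred chart at each point. -/
lemma isHermitianForm_metricCoord (hM : IsHermitianMetric E M) {m : M} {u : E}
    (hu : u ∈ (chartAt E m).target) : IsHermitianForm (metricCoord m u) := by
  have hp := isHermitianForm_metricAt hM ((chartAt E m).symm u)
  have hs : (chartAt E m).symm u ∈ (chartAt E m).source := (chartAt E m).map_target hu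
  have hs' := mem_chart_source E ((chartAt E m).symm u)
  have hT : ∀ v, tangentCoordChange 𝓘(ℝ, E) m ((chartAt E m).symm u) ((chartAt E m).symm u)
      (Complex.I • v) = Complex.I •
      tangentCoordChange 𝓘(ℝ, E) m ((chartAt E m).symm u) ((chartAt E m).symm u) v := by
    intro v
    rw [tangentCoordChange_eq hs hs', tangentCoordChange_eq hs hs', map_smul]
  refine ⟨fun _ _ ↦ ?_, fun _ _ ↦ ?_, fun _ hv ↦ ?_⟩
  · rw [metricCoord_apply, metricCoord_apply, hp.symm]
  · rw [metricCoord_apply, metricCoord_apply, hT, hT, hp.smul_I]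
  · rw [metricCoord_apply]
    refine hp.pos _ fun h ↦ hv ?_
    obtain ⟨A, hA⟩ := exists_transition_equiv (chartAt_mem_maximalAtlas' m)
      (chartAt_mem_maximalAtlas' ((chartAt E m).symm u)) hs hs'
    rw [tangentCoordChange_eq hs hs', hA] at h
    exact (map_eq_zero_iff _ A.injective).1 h

/-- The change of the metric under a change of charts. -/
lemma metricCoord_transition {m m' : M} {u : E} (hu : u ∈ (chartAt E m).target)
    (hu' : (chartAt E m).symm u ∈ (chartAt E m').source) (v w : E) :
    metricCoord m u v w = metricCoord m' ((chartAt E m' ∘ (chartAt E m).symm) u)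
      (fderiv ℂ (chartAt E m' ∘ (chartAt E m).symm) u v)
      (fderiv ℂ (chartAt E m' ∘ (chartAt E m).symm) u w) := by
  set p := (chartAt E m).symm u with hp
  have hs : p ∈ (chartAt E m).source := (chartAt E m).map_target hu
  have hup : chartAt E m p = u := (chartAt E m).right_inv hu
  have h1 : (chartAt E m').symm ((chartAt E m' ∘ (chartAt E m).symm) u) = p := by
    simp [← hp, hu']
  have h2 : ∀ v, tangentCoordChange 𝓘(ℝ, E) m' p p
      (fderiv ℂ (chartAt E m' ∘ (chartAt E m).symm) u v) = tangentCoordChange 𝓘(ℝ, E) m p p v := by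
    intro v
    conv_lhs => rw [← hup]
    rw [← tangentCoordChange_eq hs hu']
    apply tangentCoordChange_comp
    simp [hs, hu']
  rw [metricCoord_apply, metricCoord_apply, h1, h2, h2]

variable [FiniteDimensional ℝ E]
  [IsContMDiffRiemannianBundle 𝓘(ℝ, E) ∞ E (fun x : M ↦ TangentSpace 𝓘(ℝ, E) x)]

/-- The entries are inner products of smooth coordinate fields. -/
lemma contDiffOn_metricCoord (m : M) : ContDiffOn ℝ ∞ (metricCoord m) (chartAt E m).target := by
  refine contDiffOn_clm_apply.2 fun v ↦ contDiffOn_clm_apply.2 fun w ↦ ?_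
  have h := ContMDiffOn.inner_bundle (E := fun p : M ↦ TangentSpace 𝓘(ℝ, E) p)
    (contMDiffOn_constField m v) (contMDiffOn_constField m w)
  have h1 : ContMDiffOn 𝓘(ℝ, E) 𝓘(ℝ, E) ∞ (chartAt E m).symm (chartAt E m).target :=
    contMDiffOn_chart_symm
  exact contMDiffOn_iff_contDiffOn.1 (h.comp h1 fun u hu ↦ (chartAt E m).map_target hu)

end MetricCoord

/-! ### Christoffel symbols of the two connections. -/

section Christoffel

set_option linter.unusedSectionVars false

variable {E : Type*} [NormedAddCommGroup E] [NormedSpace ℝ E] [NormedSpace ℂ E]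
  [IsScalarTower ℝ ℂ E] [FiniteDimensional ℝ E] {M : Type*} [TopologicalSpace M]
  [ChartedSpace E M] [IsManifold 𝓘(ℂ, E) ω M]

lemma constField_self (p : M) (v : E) : constField p v p = v :=
  tangentCoordChange_self (I := 𝓘(ℝ, E)) (by simp)

lemma constField_add (p : M) (v w : E) :
    constField p (v + w) = constField p v + constField p w := by
  funext q
  exact map_add (tangentCoordChange 𝓘(ℝ, E) p q q) v w

lemma constField_smul (p : M) (r : ℝ) (v : E) :
    constField p (r • v) = r • constField p v := by
  funext q
  exact map_smul (tangentCoordChange 𝓘(ℝ, E) p q q) r v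

lemma tangentJ_constField {p q : M} (hq : q ∈ (chartAt E p).source) (v : E) :
    tangentJ q (constField p v q) = constField p (Complex.I • v) q := by
  change Complex.I • (tangentCoordChange 𝓘(ℝ, E) p q q v) =
    tangentCoordChange 𝓘(ℝ, E) p q q (Complex.I • v)
  rw [tangentCoordChange_eq hq (mem_chart_source E q),
    tangentCoordChange_eq hq (mem_chart_source E q), map_smul]

lemma mdifferentiableAt_constField (p : M) (v : E) :
    MDifferentiableAt 𝓘(ℝ, E) 𝓘(ℝ, E).tangent
      (fun q ↦ (⟨q, constField p v q⟩ : TangentBundle 𝓘(ℝ, E) M)) p :=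
  ((contMDiffOn_constField p v).contMDiffAt
    ((chartAt E p).open_source.mem_nhds (mem_chart_source E p))).mdifferentiableAt (by simp)

/-- `FiberBundle.extend` keeps the components in the trivialization at `p` constant, so it is a
coordinate field near `p`. This identifies the covariant derivatives in `secondFundamentalForm` with
Christoffel symbols. -/
lemma extend_eq_constField {p q : M} (hq : q ∈ (chartAt E p).source)
    (v : TangentSpace 𝓘(ℝ, E) p) : FiberBundle.extend E v q = constField (E := E) p v q := by
  have h1 : (trivializationAt E (TangentSpace 𝓘(ℝ, E)) p ⟨p, v⟩).2 = v := by
    rw [TangentBundle.trivializationAt_apply]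
    exact tangentCoordChange_self (I := 𝓘(ℝ, E)) (x := p) (z := p) (v := v) (by simp)
  change (trivializationAt E (TangentSpace 𝓘(ℝ, E)) p).symm q
    (trivializationAt E (TangentSpace 𝓘(ℝ, E)) p ⟨p, v⟩).2 = _
  rw [h1]
  exact (Bundle.Trivialization.symmL_apply (R := ℝ) (hb := hq) _ _).symm.trans
    (DFunLike.congr_fun (TangentBundle.symmL_trivializationAt_eq_core (I := 𝓘(ℝ, E)) hq) v)

lemma eventually_extend_eq_constField (p : M) (v : TangentSpace 𝓘(ℝ, E) p) :
    ∀ᶠ q in 𝓝 p, FiberBundle.extend E v q = constField (E := E) p v q := by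
  filter_upwards [(chartAt E p).open_source.mem_nhds (mem_chart_source E p)] with q hq
  exact extend_eq_constField hq v

/-- Pulled back to the chart, coordinate fields are constant, so they commute. Torsion then becomes
the antisymmetric part of the Christoffel symbols. -/
lemma mlieBracket_constField (p : M) (v w : E) :
    VectorField.mlieBracket 𝓘(ℝ, E) (constField p v) (constField p w) p = 0 := by
  have key : ∀ v : E, ∀ᶠ u in 𝓝 (extChartAt 𝓘(ℝ, E) p p),
      VectorField.mpullbackWithin 𝓘(ℝ, E) 𝓘(ℝ, E) (extChartAt 𝓘(ℝ, E) p).symm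
        (constField p v) (range 𝓘(ℝ, E)) u = v := by
    intro v
    filter_upwards [extChartAt_target_mem_nhds (I := 𝓘(ℝ, E)) p] with u hu
    rw [VectorField.mpullbackWithin_apply]
    have h1 := isInvertible_mfderivWithin_extChartAt_symm (I := 𝓘(ℝ, E)) hu
    have h2 : (extChartAt 𝓘(ℝ, E) p).symm u ∈ (chartAt E p).source := by
      rw [← extChartAt_source 𝓘(ℝ, E)]
      exact (extChartAt 𝓘(ℝ, E) p).map_target hu
    have h3 : constField p v ((extChartAt 𝓘(ℝ, E) p).symm u) =
        mfderivWithin 𝓘(ℝ, E) 𝓘(ℝ, E) (extChartAt 𝓘(ℝ, E) p).symm (range 𝓘(ℝ, E)) u v := by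
      have h4 := TangentBundle.symmL_trivializationAt (I := 𝓘(ℝ, E)) h2
      rw [TangentBundle.symmL_trivializationAt_eq_core h2,
        (extChartAt 𝓘(ℝ, E) p).right_inv hu] at h4
      exact DFunLike.congr_fun h4 v
    rw [h3]
    exact DFunLike.congr_fun h1.inverse_comp_self v
  rw [VectorField.mlieBracket, VectorField.mlieBracketWithin_apply,
    Filter.EventuallyEq.lieBracketWithin_vectorField_eq_nhds (key v) (key w)]
  have h0 : VectorField.lieBracketWithin ℝ (fun _ : E ↦ v) (fun _ ↦ w) = 0 := by
    ext s u
    simp [VectorField.lieBracketWithin]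
  rw [h0]
  exact map_zero (ContinuousLinearMap.inverse _)

variable (cov : CovariantDerivative 𝓘(ℝ, E) E (TangentSpace 𝓘(ℝ, E) : M → Type _))

/-- The Christoffel symbols at `p` of a connection, in the preferred chart at `p`. -/
def christoffel (p : M) (v w : E) : E :=
  cov (constField p w) p v

lemma cov_extend_eq (p : M) (v w : TangentSpace 𝓘(ℝ, E) p) :
    cov (FiberBundle.extend E w) p v = christoffel (E := E) cov p v w := by
  rw [cov.isCovariantDerivativeOn.congr_of_eventuallyEq (s := univ)
    (FiberBundle.mdifferentiableAt_extend 𝓘(ℝ, E) E w) (mdifferentiableAt_constField (E := E) p w)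
    univ_mem (eventually_extend_eq_constField (E := E) p w)]
  rfl

lemma christoffel_add_left (p : M) (v v' w : E) :
    christoffel cov p (v + v') w = christoffel cov p v w + christoffel cov p v' w :=
  map_add (cov (constField p w) p) v v'

lemma christoffel_smul_left (p : M) (r : ℝ) (v w : E) :
    christoffel cov p (r • v) w = r • christoffel cov p v w :=
  map_smul (cov (constField p w) p) r v

lemma christoffel_add_right (p : M) (v w w' : E) :
    christoffel cov p v (w + w') = christoffel cov p v w + christoffel cov p v w' := by
  rw [christoffel, constField_add, cov.isCovariantDerivativeOn.add (s := univ)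
    (mdifferentiableAt_constField p w) (mdifferentiableAt_constField p w')]
  rfl

lemma christoffel_smul_right (p : M) (r : ℝ) (v w : E) :
    christoffel cov p v (r • w) = r • christoffel cov p v w := by
  rw [christoffel, constField_smul, cov.isCovariantDerivativeOn.smul_const (s := univ) r
    (mdifferentiableAt_constField p w)]
  rfl

lemma torsion_eq_christoffel (p : M) (v w : E) :
    cov.torsion p v w = christoffel cov p v w - christoffel cov p w v := by
  have h := cov.torsion_apply (mdifferentiableAt_constField p v)
    (mdifferentiableAt_constField p w)
  rw [mlieBracket_constField, constField_self, constField_self, sub_zero] at h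
  exact h

variable [Bundle.RiemannianBundle (fun x : M ↦ TangentSpace 𝓘(ℝ, E) x)]
  [IsContMDiffRiemannianBundle 𝓘(ℝ, E) ∞ E (fun x : M ↦ TangentSpace 𝓘(ℝ, E) x)]

lemma metricCoord_self (p : M) (v w : E) :
    metricCoord p (chartAt E p p) v w = metricAt p v w := by
  rw [metricCoord_apply, (chartAt E p).left_inv (mem_chart_source E p),
    tangentCoordChange_self (by simp), tangentCoordChange_self (by simp)]

lemma differentiableAt_metricCoord (m : M) {u : E} (hu : u ∈ (chartAt E m).target) :
    DifferentiableAt ℝ (metricCoord (E := E) m) u :=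
  ((contDiffOn_metricCoord m).contDiffAt ((chartAt E m).open_target.mem_nhds hu)).differentiableAt
    (by simp)

variable {cov}

/-- Metric compatibility tested on coordinate fields, whose inner products are the entries of
`metricCoord`. It is evaluated at the centre of the chart, where `christoffel` lives. -/
lemma PreservesMetric.fderiv_metricCoord (h : PreservesMetric cov) (p : M) (d v w : E) :
    fderiv ℝ (metricCoord p) (chartAt E p p) d v w =
      metricAt p (christoffel cov p d v) w + metricAt p v (christoffel cov p d w) := by
  have h1 := h (constField p v) (constField p w) p (mdifferentiableAt_constField p v)
    (mdifferentiableAt_constField p w) d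
  rw [constField_self, constField_self] at h1
  refine Eq.trans ?_ h1
  have h0 := ContMDiffOn.inner_bundle (E := fun p : M ↦ TangentSpace 𝓘(ℝ, E) p)
    (contMDiffOn_constField p v) (contMDiffOn_constField p w)
  have h2 : MDifferentiableAt 𝓘(ℝ, E) 𝓘(ℝ, ℝ)
      (fun q ↦ (inner ℝ (constField p v q) (constField p w q) : ℝ)) p :=
    (h0.contMDiffAt
      ((chartAt E p).open_source.mem_nhds (mem_chart_source E p))).mdifferentiableAt (by simp)
  rw [h2.mfderiv]
  have h3 := differentiableAt_metricCoord p (mem_chart_target E p)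
  have h4 := (h3.hasFDerivAt.clm_apply (hasFDerivAt_const v _)).clm_apply (hasFDerivAt_const w _)
  have h5 : writtenInExtChartAt 𝓘(ℝ, E) 𝓘(ℝ, ℝ) p
      (fun q ↦ (inner ℝ (constField p v q) (constField p w q) : ℝ)) =
      fun u ↦ metricCoord p u v w := rfl
  have h6 : extChartAt 𝓘(ℝ, E) p p = chartAt E p p := by simp
  rw [h5, h6]
  simp only [modelWithCornersSelf_coe, range_id, fderivWithin_univ]
  rw [h4.fderiv]
  simp only [ContinuousLinearMap.comp_zero, zero_add]
  rfl

end Christoffel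

section Chern

set_option linter.unusedSectionVars false

variable {E : Type*} [NormedAddCommGroup E] [NormedSpace ℝ E] [NormedSpace ℂ E]
  [IsScalarTower ℝ ℂ E] [FiniteDimensional ℝ E] {M : Type*} [TopologicalSpace M]
  [ChartedSpace E M] [IsManifold 𝓘(ℂ, E) ω M]
  [Bundle.RiemannianBundle (fun x : M ↦ TangentSpace 𝓘(ℝ, E) x)]
  [IsContMDiffRiemannianBundle 𝓘(ℝ, E) ∞ E (fun x : M ↦ TangentSpace 𝓘(ℝ, E) x)]
  {cov : CovariantDerivative 𝓘(ℝ, E) E (TangentSpace 𝓘(ℝ, E) : M → Type _)}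

/-- In a holomorphic chart `J` maps coordinate fields to coordinate fields, so parallelism of `J`
becomes complex linearity in the differentiated field. -/
lemma IsChernConnection.christoffel_I_right (h : IsChernConnection cov) (p : M) (v w : E) :
    christoffel cov p v (Complex.I • w) = Complex.I • christoffel cov p v w := by
  have h1 := h.complex (constField p w) p (mdifferentiableAt_constField p w) v
  have h2 : ∀ᶠ q in 𝓝 p, constField p (Complex.I • w) q = tangentJ q (constField p w q) := by
    filter_upwards [(chartAt E p).open_source.mem_nhds (mem_chart_source E p)] with q hq
    exact (tangentJ_constField hq w).symm
  have h3 : DifferentiableFieldAt (fun q ↦ tangentJ q (constField p w q)) p := by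
    refine (mdifferentiableAt_constField p (Complex.I • w)).congr_of_eventuallyEq ?_
    filter_upwards [h2] with q hq
    rw [hq]
  rw [← cov.isCovariantDerivativeOn.congr_of_eventuallyEq (s := univ)
    (mdifferentiableAt_constField p (Complex.I • w)) h3 univ_mem h2] at h1
  exact h1

/-- The defect `N(v, w) = Γ(i v, w) - i Γ(v, w)` is symmetric, by the torsion condition. It commutes
with `i` in `w` and anticommutes with it in `v`, and symmetry makes these incompatible unless `N =
0`. -/
lemma IsChernConnection.christoffel_I_left (h : IsChernConnection cov) (p : M) (v w : E) :
    christoffel cov p (Complex.I • v) w = Complex.I • christoffel cov p v w := by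
  set N : E → E → E := fun v w ↦
    christoffel cov p (Complex.I • v) w - Complex.I • christoffel cov p v w with hN
  have hsymm : ∀ v w, N v w = N w v := by
    intro v w
    have h1 := h.torsion p v w
    have h2 : cov.torsion p (tangentJ p v) (tangentJ p w) =
        christoffel cov p (Complex.I • v) (Complex.I • w) -
          christoffel cov p (Complex.I • w) (Complex.I • v) :=
      torsion_eq_christoffel cov p (Complex.I • v) (Complex.I • w)
    have h3 : (cov.torsion p v w : E) = christoffel cov p v w - christoffel cov p w v :=
      torsion_eq_christoffel cov p v w
    rw [h2] at h1
    replace h1 : christoffel cov p (Complex.I • v) (Complex.I • w) -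
        christoffel cov p (Complex.I • w) (Complex.I • v) =
          -(christoffel cov p v w - christoffel cov p w v) := h1.trans (congrArg Neg.neg h3)
    rw [h.christoffel_I_right, h.christoffel_I_right] at h1
    have h4 : christoffel cov p (Complex.I • v) w - christoffel cov p (Complex.I • w) v =
        Complex.I • (christoffel cov p v w - christoffel cov p w v) := by
      have h5 := congrArg (fun x : E ↦ -(Complex.I • x)) h1
      simp only [smul_sub, neg_sub, I_smul_I_smul] at h5 ⊢
      rw [← sub_eq_zero] at h5 ⊢
      rw [← h5]; abel
    simp only [hN]
    rw [smul_sub, sub_eq_iff_eq_add] at h4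
    rw [h4]; abel
  have hr : ∀ v w, N v (Complex.I • w) = Complex.I • N v w := by
    intro v w
    simp only [hN, h.christoffel_I_right, smul_sub]
  have hneg : ∀ v w : E, christoffel cov p (-v) w = -christoffel cov p v w := fun v w ↦
    map_neg (cov (constField p w) p) v
  have hl : ∀ v w, N (Complex.I • v) w = -(Complex.I • N v w) := by
    intro v w
    simp only [hN, I_smul_I_smul, hneg, smul_sub]
    abel
  have h6 : N v w = 0 := by
    have h7 := hl v w
    rw [hsymm, hr, hsymm, eq_neg_iff_add_eq_zero, ← two_smul ℂ, smul_smul] at h7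
    exact (smul_eq_zero.1 h7).resolve_left (by simp)
  exact sub_eq_zero.1 h6

/-- In the sum of the metric derivatives along `v` and `i v`, the terms `g(w, Γ(v, e))` and `g(w,
Γ(i v, i e))` cancel by bilinearity, leaving twice `g(Γ(v, w), e)`. -/
lemma IsChernConnection.exists_isChernForm (hM : IsHermitianMetric E M) (h : IsChernConnection cov)
    (p : M) : ∃ Γ : E →ₗ[ℂ] E →ₗ[ℂ] E, IsChernForm (metricCoord p) (chartAt E p p) Γ ∧
      ∀ v w, Γ v w = christoffel cov p v w := by
  refine ⟨LinearMap.mk₂ ℂ (christoffel cov p) (christoffel_add_left cov p) ?_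
    (christoffel_add_right cov p) ?_, ?_, fun v w ↦ rfl⟩
  · intro c v w
    rw [complex_smul_eq c v, christoffel_add_left, christoffel_smul_left, christoffel_smul_left,
      h.christoffel_I_left, ← complex_smul_eq]
  · intro c v w
    rw [complex_smul_eq c w, christoffel_add_right, christoffel_smul_right,
      christoffel_smul_right, h.christoffel_I_right, ← complex_smul_eq]
  · intro v w e
    have hg := isHermitianForm_metricAt hM p
    rw [metricCoord_self, h.metric.fderiv_metricCoord, h.metric.fderiv_metricCoord,
      LinearMap.mk₂_apply, h.christoffel_I_left, h.christoffel_I_left, h.christoffel_I_right,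
      I_smul_I_smul, hg.smul_I, map_neg]
    ring

end Chern

/-! ### From Chern minimality to the local equation at chart centres. -/

section Differential

set_option linter.unusedSectionVars false

variable {S : Type*} [TopologicalSpace S] [ChartedSpace ℂ S] [IsManifold 𝓘(ℂ) ω S]
  {M : Type*} [TopologicalSpace M] [ChartedSpace C2 M] [IsManifold 𝓘(ℂ, C2) ω M]

/-- The differential of `f` in the charts at `x` and `f x`. -/
lemma mfderiv_apply_eq {f : S → M} (hf : ContMDiff 𝓘(ℝ, ℂ) 𝓘(ℝ, C2) ∞ f) (x : S) :
    mfderiv 𝓘(ℝ, ℂ) 𝓘(ℝ, C2) f x =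
      fderiv ℝ (chartAt C2 (f x) ∘ f ∘ (chartAt ℂ x).symm) (chartAt ℂ x x) := by
  rw [(hf.mdifferentiableAt (by simp)).mfderiv]
  simp only [modelWithCornersSelf_coe, range_id, fderivWithin_univ]
  rfl

end Differential

section Pointwise

set_option linter.unusedSectionVars false

variable {S : Type*} [TopologicalSpace S] [ChartedSpace ℂ S] [IsManifold 𝓘(ℂ) ω S]
  [Bundle.RiemannianBundle (fun x : S ↦ TangentSpace 𝓘(ℝ, ℂ) x)]
  [IsContMDiffRiemannianBundle 𝓘(ℝ, ℂ) ∞ ℂ (fun x : S ↦ TangentSpace 𝓘(ℝ, ℂ) x)]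

/-- In a holomorphic chart of a Riemann surface, the trace of the Christoffel symbols of the
Levi-Civita connection of a conformal metric vanishes. -/
lemma IsLeviCivitaConnection.christoffel_trace (hS : IsHermitianMetric ℂ S)
    {cov : CovariantDerivative 𝓘(ℝ, ℂ) ℂ (TangentSpace 𝓘(ℝ, ℂ) : S → Type _)}
    (h : IsLeviCivitaConnection cov) (x : S) :
    christoffel cov x 1 1 + christoffel cov x Complex.I Complex.I = 0 := by
  have hg := isHermitianForm_metricAt hS x
  have hsymm : christoffel cov x 1 Complex.I = christoffel cov x Complex.I 1 := by
    have h1 := torsion_eq_christoffel cov x 1 Complex.I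
    rw [h.torsion] at h1
    exact (sub_eq_zero.1 h1.symm)
  have hD := h.metric.fderiv_metricCoord x
  -- Invariance of the metric under `i` holds throughout the chart, so it may be differentiated.
  have hherm : ∀ d v w : ℂ, fderiv ℝ (metricCoord x) (chartAt ℂ x x) d (Complex.I * v)
      (Complex.I * w) = fderiv ℝ (metricCoord x) (chartAt ℂ x x) d v w := by
    intro d v w
    have h3 := differentiableAt_metricCoord x (mem_chart_target ℂ x)
    have h4 : ∀ v w : ℂ, fderiv ℝ (fun u ↦ metricCoord x u v w) (chartAt ℂ x x) d =
        fderiv ℝ (metricCoord x) (chartAt ℂ x x) d v w := by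
      intro v w
      rw [((h3.hasFDerivAt.clm_apply (hasFDerivAt_const v _)).clm_apply
        (hasFDerivAt_const w _)).fderiv]
      simp only [ContinuousLinearMap.comp_zero, zero_add]
      rfl
    rw [← h4, ← h4]
    refine DFunLike.congr_fun (Filter.EventuallyEq.fderiv_eq ?_) d
    filter_upwards [(chartAt ℂ x).open_target.mem_nhds (mem_chart_target ℂ x)] with u hu
    exact (isHermitianForm_metricCoord hS hu).smul_I v w
  have hII : ∀ d, fderiv ℝ (metricCoord x) (chartAt ℂ x x) d Complex.I Complex.I =
      fderiv ℝ (metricCoord x) (chartAt ℂ x x) d 1 1 := fun d ↦ by simpa using hherm d 1 1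
  have h1I : ∀ d, fderiv ℝ (metricCoord x) (chartAt ℂ x x) d 1 Complex.I =
      -fderiv ℝ (metricCoord x) (chartAt ℂ x x) d Complex.I 1 := fun d ↦ by
    simpa using (hherm d 1 Complex.I).symm
  simp only [hD] at hII h1I
  set X := christoffel cov x 1 1 + christoffel cov x Complex.I Complex.I with hX
  have e1 := hII 1
  have e2 := hII Complex.I
  have e3 := h1I 1
  have e4 := h1I Complex.I
  rw [hsymm] at e1
  rw [hsymm] at e3
  have s := hg.symm
  -- Invariance moves `i` between the slots and the vanishing of torsion exchanges `Γ(1, i)` with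
  -- `Γ(i, 1)`; together they show that `X` is orthogonal to `1` and to `i`.
  have hX1 : metricAt x X 1 = 0 := by
    rw [hX, map_add, add_apply]
    linarith [s 1 (christoffel cov x 1 1), s Complex.I (christoffel cov x 1 1),
      s 1 (christoffel cov x Complex.I 1), s Complex.I (christoffel cov x Complex.I 1),
      s 1 (christoffel cov x Complex.I Complex.I),
      s Complex.I (christoffel cov x Complex.I Complex.I)]
  have hX2 : metricAt x X Complex.I = 0 := by
    rw [hX, map_add, add_apply]
    linarith [s 1 (christoffel cov x 1 1), s Complex.I (christoffel cov x 1 1),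
      s 1 (christoffel cov x Complex.I 1), s Complex.I (christoffel cov x Complex.I 1),
      s 1 (christoffel cov x Complex.I Complex.I),
      s Complex.I (christoffel cov x Complex.I Complex.I)]
  by_contra hne
  refine (hg.pos X hne).ne' ?_
  have h5 : X = X.re • (1 : ℂ) + X.im • Complex.I := by simp [Complex.re_add_im]
  calc metricAt x X X = metricAt x X (X.re • (1 : ℂ) + X.im • Complex.I) := by rw [← h5]
    _ = 0 := by rw [map_add, map_smul, map_smul, hX1, hX2]; simp

variable {M : Type*} [TopologicalSpace M] [ChartedSpace C2 M] [IsManifold 𝓘(ℂ, C2) ω M]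
  [Bundle.RiemannianBundle (fun x : M ↦ TangentSpace 𝓘(ℝ, C2) x)]
  [IsContMDiffRiemannianBundle 𝓘(ℝ, C2) ∞ C2 (fun x : M ↦ TangentSpace 𝓘(ℝ, C2) x)]

/-- A conformal metric on a Riemann surface has an orthonormal basis proportional to `1, i` at each
point. -/
lemma exists_orthonormalBasis_smul (hS : IsHermitianMetric ℂ S) (x : S) :
    ∃ (c : ℝ) (b : OrthonormalBasis (Fin 2) ℝ (TangentSpace 𝓘(ℝ, ℂ) x)), 0 < c ∧
      b 0 = (c • (1 : ℂ) : ℂ) ∧ b 1 = (c • Complex.I : ℂ) := by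
  have hg := isHermitianForm_metricAt hS x
  have hpos := hg.pos 1 one_ne_zero
  set r := Real.sqrt (metricAt x (1 : ℂ) 1) with hr
  have hr0 : 0 < r := Real.sqrt_pos.2 hpos
  have hrr : r * r = metricAt x (1 : ℂ) 1 := Real.mul_self_sqrt hpos.le
  have hII : metricAt x Complex.I Complex.I = metricAt x (1 : ℂ) 1 := by
    simpa using hg.smul_I 1 1
  have h1I : metricAt x (1 : ℂ) Complex.I = 0 := by
    have h1 := hg.smul_I 1 Complex.I
    have h2 := hg.symm Complex.I 1
    simp at h1
    linarith
  have hI1 : metricAt x Complex.I 1 = 0 := by rw [hg.symm, h1I]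
  let v : Fin 2 → TangentSpace 𝓘(ℝ, ℂ) x := ![(r⁻¹ • (1 : ℂ) : ℂ), (r⁻¹ • Complex.I : ℂ)]
  have key : ∀ (a b : ℝ) (y z : ℂ), metricAt x (a • y) (b • z) = a * b * metricAt x y z := by
    intro a b y z
    rw [map_smul, map_smul, smul_apply, smul_eq_mul, smul_eq_mul]; ring
  have hon : Orthonormal ℝ v := by
    rw [orthonormal_iff_ite]
    have h0 : ∀ i j, inner ℝ (v i) (v j) = metricAt (E := ℂ) x (v i) (v j) := fun i j ↦ rfl
    intro i j
    rw [h0]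
    have e0 : v 0 = (r⁻¹ • (1 : ℂ) : ℂ) := rfl
    have e1 : v 1 = (r⁻¹ • Complex.I : ℂ) := rfl
    fin_cases i <;> fin_cases j
    · change metricAt x (r⁻¹ • (1 : ℂ)) (r⁻¹ • (1 : ℂ)) = 1
      rw [key, ← hrr]; field_simp
    · change metricAt x (r⁻¹ • (1 : ℂ)) (r⁻¹ • Complex.I) = 0
      rw [key, h1I, mul_zero]
    · change metricAt x (r⁻¹ • Complex.I) (r⁻¹ • (1 : ℂ)) = 0
      rw [key, hI1, mul_zero]
    · change metricAt x (r⁻¹ • Complex.I) (r⁻¹ • Complex.I) = 1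
      rw [key, hII, ← hrr]; field_simp
  have hsp : ⊤ ≤ Submodule.span ℝ (range v) := by
    intro w _
    have hgen : ∀ w : ℂ, w = (r * w.re) • (r⁻¹ • (1 : ℂ)) + (r * w.im) • (r⁻¹ • Complex.I) := by
      intro w
      have e : ∀ t, r * t * r⁻¹ = t := fun t ↦ by field_simp
      rw [smul_smul, smul_smul, e, e]
      simp [Complex.re_add_im]
    have hw : w = (r * Complex.re w) • v 0 + (r * Complex.im w) • v 1 := hgen w
    rw [hw]
    exact Submodule.add_mem _ (Submodule.smul_mem _ _ (Submodule.subset_span ⟨0, rfl⟩))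
      (Submodule.smul_mem _ _ (Submodule.subset_span ⟨1, rfl⟩))
  refine ⟨r⁻¹, OrthonormalBasis.mk hon hsp, inv_pos.2 hr0, ?_, ?_⟩ <;> rw [OrthonormalBasis.coe_mk] <;> rfl

/-- On an orthonormal basis `c, c i` the trace of `∇df` is `c²` times the trace over `1, i`, and the
Levi-Civita term drops out by `IsLeviCivitaConnection.christoffel_trace`. -/
lemma IsChernMinimal.isChernHarmonicAt (hS : IsHermitianMetric ℂ S) (hM : IsHermitianMetric C2 M)
    {f : S → M} (hf : ContMDiff 𝓘(ℝ, ℂ) 𝓘(ℝ, C2) ∞ f) (h : IsChernMinimal f) (x : S) :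
    IsChernHarmonicAt (metricCoord (E := C2) (f x)) (chartAt C2 (f x) ∘ f ∘ (chartAt ℂ x).symm)
      (chartAt ℂ x x) := by
  obtain ⟨covS, covM, hLC, hCh, hmin⟩ := h
  obtain ⟨c, b, hc, hb0, hb1⟩ := exists_orthonormalBasis_smul hS x
  obtain ⟨Γ, hΓ, hΓc⟩ := hCh.exists_isChernForm hM (f x)
  set F : ℂ → C2 := chartAt C2 (f x) ∘ f ∘ (chartAt ℂ x).symm with hF
  have hFx : F (chartAt ℂ x x) = chartAt C2 (f x) (f x) := by simp [hF]
  refine ⟨Γ, by rwa [hFx], ?_⟩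
  let T : ℂ → ℂ → C2 := fun v w ↦ fderiv ℝ (fderiv ℝ F) (chartAt ℂ x x) v w +
    christoffel covM (f x) (fderiv ℝ F (chartAt ℂ x x) v) (fderiv ℝ F (chartAt ℂ x x) w) -
    fderiv ℝ F (chartAt ℂ x x) (christoffel covS x v w)
  have hsff : ∀ v w : ℂ, secondFundamentalForm covS covM f x v w = T v w := by
    intro v w
    have h2 : extChartAt 𝓘(ℝ, ℂ) x x = chartAt ℂ x x := by simp
    have h3 := mfderiv_apply_eq hf x
    unfold secondFundamentalForm
    dsimp only
    rw [h2, cov_extend_eq, h3]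
    exact congrArg (fun y : ℂ ↦ fderiv ℝ (fderiv ℝ F) (chartAt ℂ x x) v w +
      christoffel covM (f x) (fderiv ℝ F (chartAt ℂ x x) v) (fderiv ℝ F (chartAt ℂ x x) w) -
      fderiv ℝ F (chartAt ℂ x x) y) (cov_extend_eq covS x v w)
  have h1 := hmin x b
  rw [Fin.sum_univ_two, hb0, hb1] at h1
  replace h1 : T (c • 1) (c • 1) + T (c • Complex.I) (c • Complex.I) = 0 :=
    (congrArg₂ (· + ·) (hsff (c • 1) (c • 1))
      (hsff (c • Complex.I) (c • Complex.I))).symm.trans h1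
  have h2 := hLC.christoffel_trace hS x
  simp only [T, map_smul, smul_apply, christoffel_smul_left, christoffel_smul_right] at h1
  set L := fderiv ℝ F (chartAt ℂ x x) with hL
  have h3 : (c * c) • (lapl F (chartAt ℂ x x) + (christoffel covM (f x) (L 1) (L 1) +
      christoffel covM (f x) (L Complex.I) (L Complex.I)) -
      L (christoffel covS x 1 1 + christoffel covS x Complex.I Complex.I)) = 0 := by
    refine Eq.trans ?_ h1
    rw [map_add, lapl]
    module
  rw [h2, map_zero, sub_zero] at h3
  have h4 := (smul_eq_zero.1 h3).resolve_left (mul_pos hc hc).ne'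
  -- With `F_x = F_z + F_z̄` and `F_y = i (F_z - F_z̄)`, complex bilinearity cancels `Γ(F_z, F_z)`
  -- and `Γ(F_z̄, F_z̄)`; only the mixed terms remain, twice.
  rw [← hΓc, ← hΓc, hL, fderiv_one_eq, fderiv_I_eq] at h4
  rw [eq_neg_of_add_eq_zero_left h4]
  simp only [map_add, map_sub, map_smul, LinearMap.add_apply, LinearMap.sub_apply,
    LinearMap.smul_apply, smul_sub, I_smul_I_smul]
  module

end Pointwise

/-! ### Passage to arbitrary holomorphic coordinates. -/

section RealAtlas

set_option linter.unusedSectionVars false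

variable {E : Type*} [NormedAddCommGroup E] [NormedSpace ℝ E] [NormedSpace ℂ E]
  [IsScalarTower ℝ ℂ E] {M : Type*} [TopologicalSpace M] [ChartedSpace E M]
  [IsManifold 𝓘(ℂ, E) ω M]

/-- A holomorphic chart is a chart of the underlying real manifold. -/
lemma mem_maximalAtlas_real {e : OpenPartialHomeomorph M E}
    (he : e ∈ IsManifold.maximalAtlas 𝓘(ℂ, E) ω M) :
    e ∈ IsManifold.maximalAtlas 𝓘(ℝ, E) ω M := by
  intro e' he'
  have key : ∀ g : OpenPartialHomeomorph E E, g ∈ contDiffGroupoid ω 𝓘(ℂ, E) →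
      g ∈ contDiffGroupoid ω 𝓘(ℝ, E) := by
    intro g hg
    rw [contDiffGroupoid, mem_groupoid_of_pregroupoid] at hg ⊢
    exact ⟨hg.1.restrict_scalars ℝ, hg.2.restrict_scalars ℝ⟩
  exact ⟨key _ (he e' he').1, key _ (he e' he').2⟩

lemma contMDiffOn_holomorphicChart {e : OpenPartialHomeomorph M E}
    (he : e ∈ IsManifold.maximalAtlas 𝓘(ℂ, E) ω M) :
    ContMDiffOn 𝓘(ℝ, E) 𝓘(ℝ, E) ∞ e e.source :=
  (contMDiffOn_of_mem_maximalAtlas (mem_maximalAtlas_real he)).of_le (by simp)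

lemma contMDiffOn_holomorphicChart_symm {e : OpenPartialHomeomorph M E}
    (he : e ∈ IsManifold.maximalAtlas 𝓘(ℂ, E) ω M) :
    ContMDiffOn 𝓘(ℝ, E) 𝓘(ℝ, E) ∞ e.symm e.target :=
  (contMDiffOn_symm_of_mem_maximalAtlas (mem_maximalAtlas_real he)).of_le (by simp)

lemma tangentCoordChange_smul {x y z : M} (hx : z ∈ (chartAt E x).source)
    (hy : z ∈ (chartAt E y).source) (c : ℂ) (v : E) :
    tangentCoordChange 𝓘(ℝ, E) x y z (c • v) = c • tangentCoordChange 𝓘(ℝ, E) x y z v := by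
  rw [tangentCoordChange_eq hx hy, tangentCoordChange_eq hx hy, map_smul]

variable {N : Type*} [TopologicalSpace N] {E' : Type*} [NormedAddCommGroup E'] [NormedSpace ℝ E']
  [ChartedSpace E' N]

/-- A section of a pulled back tangent bundle is smooth if and only if its coordinates in a chart
are. -/
lemma contMDiffOn_section_iff {g : N → M} {e : Π x, TangentSpace 𝓘(ℝ, E) (g x)} {U : Set N} {m : M}
    (hg : ContMDiffOn 𝓘(ℝ, E') 𝓘(ℝ, E) ∞ g U) (hU : MapsTo g U (chartAt E m).source) :
    ContMDiffOn 𝓘(ℝ, E') 𝓘(ℝ, E).tangent ∞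
      (fun x ↦ (⟨g x, e x⟩ : TangentBundle 𝓘(ℝ, E) M)) U ↔
    ContMDiffOn 𝓘(ℝ, E') 𝓘(ℝ, E) ∞ (fun x ↦ tangentCoordChange 𝓘(ℝ, E) (g x) m (g x) (e x)) U := by
  have h := (trivializationAt E (TangentSpace 𝓘(ℝ, E)) m).contMDiffOn_iff (IM := 𝓘(ℝ, E'))
    (IB := 𝓘(ℝ, E)) (n := ∞) (f := fun x ↦ (⟨g x, e x⟩ : TangentBundle 𝓘(ℝ, E) M)) (s := U)
    (fun x hx ↦ by simpa using hU hx)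
  exact h.trans ⟨fun h ↦ h.2, fun h ↦ ⟨hg, h⟩⟩

variable [Bundle.RiemannianBundle (fun x : M ↦ TangentSpace 𝓘(ℝ, E) x)]

lemma metricCoord_tangentCoordChange {m p : M} (hp : p ∈ (chartAt E m).source) (v w : E) :
    metricCoord m (chartAt E m p) (tangentCoordChange 𝓘(ℝ, E) p m p v)
      (tangentCoordChange 𝓘(ℝ, E) p m p w) = metricAt p v w := by
  have h1 : ∀ v : E, tangentCoordChange 𝓘(ℝ, E) m p p (tangentCoordChange 𝓘(ℝ, E) p m p v) = v := by
    intro v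
    rw [tangentCoordChange_comp (by simp [hp]), tangentCoordChange_self (by simp)]
  rw [metricCoord_apply, (chartAt E m).left_inv hp, h1, h1]

end RealAtlas

section Coordinates

set_option linter.unusedSectionVars false

variable {S : Type*} [TopologicalSpace S] [ChartedSpace ℂ S] [IsManifold 𝓘(ℂ) ω S]
  {M : Type*} [TopologicalSpace M] [ChartedSpace C2 M] [IsManifold 𝓘(ℂ, C2) ω M]

/-- The map `f` in the coordinate `z` of `S` and the chart at `m` of `M`. -/
def coordMap (f : S → M) (z : OpenPartialHomeomorph S ℂ) (m : M) : ℂ → C2 :=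
  chartAt C2 m ∘ f ∘ z.symm

/-- The domain of `coordMap f z m`. -/
def coordDomain (f : S → M) (z : OpenPartialHomeomorph S ℂ) (m : M) : Set ℂ :=
  z.target ∩ z.symm ⁻¹' (f ⁻¹' (chartAt C2 m).source)

lemma isOpen_coordDomain {f : S → M} (hf : Continuous f) (z : OpenPartialHomeomorph S ℂ) (m : M) :
    IsOpen (coordDomain f z m) :=
  z.isOpen_inter_preimage_symm ((chartAt C2 m).open_source.preimage hf)

lemma mem_coordDomain {f : S → M} {z : OpenPartialHomeomorph S ℂ} {m : M} {y : S}
    (hy : y ∈ z.source) (hfy : f y ∈ (chartAt C2 m).source) : z y ∈ coordDomain f z m :=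
  ⟨z.map_source hy, by simpa [hy] using hfy⟩

lemma mapsTo_coordMap (f : S → M) (z : OpenPartialHomeomorph S ℂ) (m : M) :
    MapsTo (coordMap f z m) (coordDomain f z m) (chartAt C2 m).target :=
  fun _ hζ ↦ (chartAt C2 m).map_source hζ.2

lemma contDiffOn_coordMap {f : S → M} (hf : ContMDiff 𝓘(ℝ, ℂ) 𝓘(ℝ, C2) ∞ f)
    {z : OpenPartialHomeomorph S ℂ} (hz : z ∈ IsManifold.maximalAtlas 𝓘(ℂ) ω S) (m : M) :
    ContDiffOn ℝ ∞ (coordMap f z m) (coordDomain f z m) := by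
  have h1 := (contMDiffOn_holomorphicChart_symm hz).mono
    (inter_subset_left : coordDomain f z m ⊆ z.target)
  have h2 := hf.comp_contMDiffOn h1
  have h3 := contMDiffOn_holomorphicChart (chartAt_mem_maximalAtlas' (E := C2) m)
  exact contMDiffOn_iff_contDiffOn.1 (h3.comp h2 fun ζ hζ ↦ hζ.2)

/-- The derivative of a holomorphic coordinate, as a complex number: a tangent vector `v` at `y`
has the coordinate `coordDeriv z y * v`. -/
def coordDeriv (z : OpenPartialHomeomorph S ℂ) (y : S) : ℂ :=
  fderiv ℂ (z ∘ (chartAt ℂ y).symm) (chartAt ℂ y y) 1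

lemma fderiv_coord_eq (z : OpenPartialHomeomorph S ℂ) (y : S) (v : ℂ) :
    fderiv ℂ (z ∘ (chartAt ℂ y).symm) (chartAt ℂ y y) v = coordDeriv z y * v := by
  rw [coordDeriv, mul_comm, ← smul_eq_mul, ← map_smul, smul_eq_mul, mul_one]

lemma coordDeriv_ne_zero {z : OpenPartialHomeomorph S ℂ}
    (hz : z ∈ IsManifold.maximalAtlas 𝓘(ℂ) ω S) {y : S} (hy : y ∈ z.source) :
    coordDeriv z y ≠ 0 := by
  obtain ⟨A, hA⟩ := exists_transition_equiv (chartAt_mem_maximalAtlas' (E := ℂ) y) hz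
    (mem_chart_source ℂ y) hy
  rw [coordDeriv, hA]
  exact fun h ↦ one_ne_zero ((map_eq_zero_iff _ A.injective).1 h)

lemma coordDeriv_chartAt {x y : S} (hy : y ∈ (chartAt ℂ x).source) (v : ℂ) :
    coordDeriv (chartAt ℂ x) y * v = tangentCoordChange 𝓘(ℝ, ℂ) y x y v := by
  rw [← fderiv_coord_eq, tangentCoordChange_eq (mem_chart_source ℂ y) hy]

/-- The local expressions of `f` in different charts. -/
lemma coordMap_eventuallyEq {f : S → M} (hf : Continuous f) {z : OpenPartialHomeomorph S ℂ} {m : M}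
    {y : S} (hy : y ∈ z.source) :
    coordMap f z m =ᶠ[𝓝 (z y)] (chartAt C2 m ∘ (chartAt C2 (f y)).symm) ∘
      (coordMap f (chartAt ℂ y) (f y)) ∘ (chartAt ℂ y ∘ z.symm) := by
  have h1 : ∀ᶠ ζ in 𝓝 (z y), z.symm ζ ∈ (chartAt ℂ y).source ∩ f ⁻¹' (chartAt C2 (f y)).source := by
    refine (z.continuousAt_symm (z.map_source hy)).eventually (IsOpen.mem_nhds
      ((chartAt ℂ y).open_source.inter ((chartAt C2 (f y)).open_source.preimage hf)) ?_)
    rw [z.left_inv hy]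
    exact ⟨mem_chart_source ℂ y, mem_chart_source C2 (f y)⟩
  filter_upwards [h1] with ζ hζ
  simp only [coordMap, Function.comp_apply]
  rw [(chartAt ℂ y).left_inv hζ.1, (chartAt C2 (f y)).left_inv hζ.2]

/-- The derivative of `f` in coordinates. -/
lemma fderiv_coordMap {f : S → M} (hf : ContMDiff 𝓘(ℝ, ℂ) 𝓘(ℝ, C2) ∞ f)
    {z : OpenPartialHomeomorph S ℂ} (hz : z ∈ IsManifold.maximalAtlas 𝓘(ℂ) ω S) {m : M} {y : S}
    (hy : y ∈ z.source) (hfy : f y ∈ (chartAt C2 m).source) (v : ℂ) :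
    fderiv ℝ (coordMap f z m) (z y) (coordDeriv z y * v) =
      tangentCoordChange 𝓘(ℝ, C2) (f y) m (f y) (mfderiv 𝓘(ℝ, ℂ) 𝓘(ℝ, C2) f y v) := by
  have hζ := mem_coordDomain hy hfy
  have hF := ((contDiffOn_coordMap hf hz m).contDiffAt
    ((isOpen_coordDomain hf.continuous z m).mem_nhds hζ)).differentiableAt (by simp)
  have hFy := ((contDiffOn_coordMap hf (chartAt_mem_maximalAtlas' (E := ℂ) y) (f y)).contDiffAt
    ((isOpen_coordDomain hf.continuous _ _).mem_nhds
      (mem_coordDomain (mem_chart_source ℂ y) (mem_chart_source C2 (f y))))).differentiableAt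
    (by simp)
  have hθ := (contDiffAt_transition (chartAt_mem_maximalAtlas' (E := C2) (f y))
    (chartAt_mem_maximalAtlas' m) (mem_chart_source C2 (f y)) hfy).differentiableAt (by simp)
  have hτ := (contDiffAt_transition (chartAt_mem_maximalAtlas' (E := ℂ) y) hz
    (mem_chart_source ℂ y) hy).differentiableAt (by simp)
  have h1 : (z ∘ (chartAt ℂ y).symm) (chartAt ℂ y y) = z y := by simp
  have h2 : coordMap f (chartAt ℂ y) (f y) (chartAt ℂ y y) = chartAt C2 (f y) (f y) := by
    simp [coordMap]
  have h3 : coordMap f z m ∘ (z ∘ (chartAt ℂ y).symm) =ᶠ[𝓝 (chartAt ℂ y y)]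
      (chartAt C2 m ∘ (chartAt C2 (f y)).symm) ∘ coordMap f (chartAt ℂ y) (f y) := by
    have h4 : ∀ᶠ ζ in 𝓝 (chartAt ℂ y y), (chartAt ℂ y).symm ζ ∈ z.source ∩
        f ⁻¹' (chartAt C2 (f y)).source := by
      refine ((chartAt ℂ y).continuousAt_symm (mem_chart_target ℂ y)).eventually (IsOpen.mem_nhds
        (z.open_source.inter ((chartAt C2 (f y)).open_source.preimage hf.continuous)) ?_)
      rw [(chartAt ℂ y).left_inv (mem_chart_source ℂ y)]
      exact ⟨hy, mem_chart_source C2 (f y)⟩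
    filter_upwards [h4] with ζ hζ
    simp only [coordMap, Function.comp_apply]
    rw [z.left_inv hζ.1, (chartAt C2 (f y)).left_inv hζ.2]
  have h5 := h3.fderiv_eq (𝕜 := ℝ)
  rw [← h1] at hF
  rw [← h2] at hθ
  rw [fderiv_comp _ hF (hτ.restrictScalars ℝ), fderiv_comp _ (hθ.restrictScalars ℝ) hFy, h1, h2]
    at h5
  have h6 := DFunLike.congr_fun h5 v
  rw [ContinuousLinearMap.comp_apply, ContinuousLinearMap.comp_apply,
    fderiv_real_apply_of_complex hτ, fderiv_coord_eq] at h6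
  rw [h2] at hθ
  rw [h6, fderiv_real_apply_of_complex hθ, mfderiv_apply_eq hf]
  exact (tangentCoordChange_eq (mem_chart_source C2 (f y)) hfy _).symm

variable [Bundle.RiemannianBundle (fun x : S ↦ TangentSpace 𝓘(ℝ, ℂ) x)]
  [IsContMDiffRiemannianBundle 𝓘(ℝ, ℂ) ∞ ℂ (fun x : S ↦ TangentSpace 𝓘(ℝ, ℂ) x)]
  [Bundle.RiemannianBundle (fun x : M ↦ TangentSpace 𝓘(ℝ, C2) x)]
  [IsContMDiffRiemannianBundle 𝓘(ℝ, C2) ∞ C2 (fun x : M ↦ TangentSpace 𝓘(ℝ, C2) x)]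

/-- A Chern minimal map solves the Chern minimal equation in all holomorphic coordinates. -/
lemma IsChernMinimal.isChernHarmonicAt_coordMap (hS : IsHermitianMetric ℂ S)
    (hM : IsHermitianMetric C2 M) {f : S → M} (hf : ContMDiff 𝓘(ℝ, ℂ) 𝓘(ℝ, C2) ∞ f)
    (h : IsChernMinimal f) {z : OpenPartialHomeomorph S ℂ}
    (hz : z ∈ IsManifold.maximalAtlas 𝓘(ℂ) ω S) {m : M} {ζ : ℂ} (hζ : ζ ∈ coordDomain f z m) :
    IsChernHarmonicAt (metricCoord (E := C2) m) (coordMap f z m) ζ := by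
  obtain ⟨y, hy, rfl⟩ : ∃ y ∈ z.source, z y = ζ :=
    ⟨z.symm ζ, z.map_target hζ.1, z.right_inv hζ.1⟩
  have hfy : f y ∈ (chartAt C2 m).source := by simpa [hy] using hζ.2
  have hFy : ContDiffAt ℝ 2 (coordMap f (chartAt ℂ y) (f y)) (chartAt ℂ y y) :=
    ((contDiffOn_coordMap hf (chartAt_mem_maximalAtlas' (E := ℂ) y) (f y)).contDiffAt
      ((isOpen_coordDomain hf.continuous _ _).mem_nhds
        (mem_coordDomain (mem_chart_source ℂ y) (mem_chart_source C2 (f y))))).of_le (by norm_cast)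
  have hτ : ContDiffAt ℂ 2 (chartAt ℂ y ∘ z.symm) (z y) :=
    (contDiffAt_transition hz (chartAt_mem_maximalAtlas' (E := ℂ) y) hy
      (mem_chart_source ℂ y)).of_le (by simp)
  have hτy : (chartAt ℂ y ∘ z.symm) (z y) = chartAt ℂ y y := by simp [hy]
  have hFyy : coordMap f (chartAt ℂ y) (f y) (chartAt ℂ y y) = chartAt C2 (f y) (f y) := by
    simp [coordMap]
  have hG : (coordMap f (chartAt ℂ y) (f y) ∘ (chartAt ℂ y ∘ z.symm)) (z y) =
      chartAt C2 (f y) (f y) := by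
    rw [Function.comp_apply, hτy, hFyy]
  have hθ : ContDiffAt ℂ 2 (chartAt C2 m ∘ (chartAt C2 (f y)).symm) (chartAt C2 (f y) (f y)) :=
    (contDiffAt_transition (chartAt_mem_maximalAtlas' (E := C2) (f y))
      (chartAt_mem_maximalAtlas' m) (mem_chart_source C2 (f y)) hfy).of_le (by simp)
  obtain ⟨A, hA⟩ := exists_transition_equiv (chartAt_mem_maximalAtlas' (E := C2) (f y))
    (chartAt_mem_maximalAtlas' m) (mem_chart_source C2 (f y)) hfy
  have hθy : (chartAt C2 m ∘ (chartAt C2 (f y)).symm) (chartAt C2 (f y) (f y)) =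
      chartAt C2 m (f y) := by simp
  -- The equation is known at the centres of the preferred charts at `y` and `f y`; the two
  -- transition maps carry it to `z` and to the chart at `m`.
  have h1 := h.isChernHarmonicAt hS hM hf y
  have h2 := IsChernHarmonicAt.comp_right (τ := chartAt ℂ y ∘ z.symm) (ζ := z y) (by rwa [hτy]) hτ
    (by rwa [hτy] : ContDiffAt ℝ 2 (coordMap f (chartAt ℂ y) (f y)) _)
  have h3 := IsChernHarmonicAt.comp_left (θ := chartAt C2 m ∘ (chartAt C2 (f y)).symm)
    (G' := metricCoord m) h2 (by rwa [hG])
    (ContDiffAt.comp (z y) (by rwa [hτy]) (hτ.restrict_scalars ℝ)) A (by rwa [hG])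
    (by rw [hG]; exact differentiableAt_metricCoord _ (mem_chart_target C2 (f y)))
    (by rw [hG, hθy]; exact differentiableAt_metricCoord _ ((chartAt C2 m).map_source hfy))
    (by rw [hG, hθy]; exact isHermitianForm_metricCoord hM ((chartAt C2 m).map_source hfy))
    (by
      rw [hG]
      have e1 : ∀ᶠ u in 𝓝 (chartAt C2 (f y) (f y)), u ∈ (chartAt C2 (f y)).target :=
        (chartAt C2 (f y)).open_target.mem_nhds (mem_chart_target C2 (f y))
      have e2 : ∀ᶠ u in 𝓝 (chartAt C2 (f y) (f y)),
          (chartAt C2 (f y)).symm u ∈ (chartAt C2 m).source :=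
        ((chartAt C2 (f y)).continuousAt_symm (mem_chart_target C2 (f y))).eventually
          ((chartAt C2 m).open_source.mem_nhds (by simpa using hfy))
      filter_upwards [e1, e2] with u hu hu' v w
      exact metricCoord_transition hu hu' v w)
  exact h3.congr (coordMap_eventuallyEq hf.continuous hy)

end Coordinates

/-! ### Adapted frames at a point. -/

section FramePointwise

set_option linter.unusedSectionVars false

lemma complexSMul_eq {E : Type*} [NormedAddCommGroup E] [NormedSpace ℝ E] [NormedSpace ℂ E]
    [IsScalarTower ℝ ℂ E] {M : Type*} [TopologicalSpace M] [ChartedSpace E M] {x : M} (c : ℂ)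
    (v : E) : complexSMul (E := E) (x := x) c v = c • v :=
  (complex_smul_eq c v).symm

lemma IsHermitianForm.smul_smul_self {E : Type*} [NormedAddCommGroup E] [NormedSpace ℝ E]
    [NormedSpace ℂ E] [IsScalarTower ℝ ℂ E] {G : E →L[ℝ] E →L[ℝ] ℝ} (hG : IsHermitianForm G)
    (c : ℂ) (v : E) : G (c • v) (c • v) = ‖c‖ ^ 2 * G v v := by
  have h := hG.self_eq (c • v)
  rw [hG.smul_left, hG.smul_right, ← mul_assoc, Complex.mul_conj, hG.self_eq,
    Complex.normSq_eq_norm_sq] at h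
  exact_mod_cast h.symm

variable {S : Type*} [TopologicalSpace S] [ChartedSpace ℂ S] [IsManifold 𝓘(ℂ) ω S]
  [Bundle.RiemannianBundle (fun x : S ↦ TangentSpace 𝓘(ℝ, ℂ) x)]

lemma ne_zero_of_inner_self {x : S} {ε : TangentSpace 𝓘(ℝ, ℂ) x} (hε : inner ℝ ε ε = (1 : ℝ)) :
    (ε : ℂ) ≠ 0 := by
  intro h
  have h1 : ε = 0 := h
  rw [h1, inner_zero_left] at hε
  exact zero_ne_one hε

/-- The vectors `ε` and `i ε` are orthonormal, so the components of `v` along them are the real and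
imaginary parts of `v / ε`. -/
lemma dualForm_eq (hS : IsHermitianMetric ℂ S) {x : S} {ε : TangentSpace 𝓘(ℝ, ℂ) x}
    (hε : inner ℝ ε ε = (1 : ℝ)) (v : ℂ) :
    dualForm (x := x) ε v = v / (show ℂ from ε) := by
  have hg := isHermitianForm_metricAt hS x
  set e : ℂ := ε with he
  have he0 : e ≠ 0 := ne_zero_of_inner_self hε
  have h1 : metricAt x e e = 1 := hε
  have h2 : v = (v / e).re • e + (v / e).im • Complex.I • e := by
    rw [← complex_smul_eq, smul_eq_mul, div_mul_cancel₀ _ he0]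
  have h3 : metricAt x (Complex.I • e) e = 0 := by
    have := hg.I_left e e
    rw [hg.symm e] at this
    linarith
  have h4 : metricAt x e (Complex.I • e) = 0 := by rw [hg.symm, h3]
  have h5 : metricAt x (Complex.I • e) (Complex.I • e) = 1 := by rw [hg.smul_I, h1]
  have h6 : ∀ w : ℂ, metricAt x v w =
      (v / e).re * metricAt x e w + (v / e).im * metricAt x (Complex.I • e) w := by
    intro w
    conv_lhs => rw [h2]
    simp only [map_add, map_smul _ (_ : ℝ), add_apply, smul_apply, smul_eq_mul]
  have h7 : metricAt x v e = (v / e).re := by rw [h6, h1, h3]; ring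
  have h8 : metricAt x v (Complex.I • e) = (v / e).im := by rw [h6, h4, h5]; ring
  exact Complex.ext h7 h8

variable {M : Type*} [TopologicalSpace M] [ChartedSpace C2 M] [IsManifold 𝓘(ℂ, C2) ω M]
  [Bundle.RiemannianBundle (fun x : M ↦ TangentSpace 𝓘(ℝ, C2) x)]
  {f : S → M} {U : Set S} {ε : Π x : S, TangentSpace 𝓘(ℝ, ℂ) x}
  {e₁ e₂ : Π x : S, TangentSpace 𝓘(ℝ, C2) (f x)} {s t : S → ℂ}

/-- The differential of `f` at `y`, as a linear map between the model spaces. -/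
def diffAt (f : S → M) (y : S) : ℂ →L[ℝ] C2 :=
  mfderiv 𝓘(ℝ, ℂ) 𝓘(ℝ, C2) f y

lemma IsAdaptedFrame.diffAt_eq (hS : IsHermitianMetric ℂ S)
    (h : IsAdaptedFrame f U ε e₁ e₂ s t) {y : S} (hy : y ∈ U) (v : ℂ) :
    diffAt f y v = (s y * (v / (show ℂ from ε y))) • (show C2 from e₁ y) +
      (t y * starRingEnd ℂ (v / (show ℂ from ε y))) • (show C2 from e₂ y) := by
  have h1 := h.df_eq y hy v
  rw [dualForm_eq hS (h.inner_ε y hy)] at h1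
  exact h1.trans (congrArg₂ (· + ·) (complexSMul_eq _ _) (complexSMul_eq _ _))

/-- The antilinear part of `df` cancels in `df ∘ j + J ∘ df`, which isolates `s`. Likewise `df ∘ j -
J ∘ df` isolates `t`. Both the zeros and the absolute values of `s` and `t` are read off from these
combinations. -/
lemma IsAdaptedFrame.diffAt_add (hS : IsHermitianMetric ℂ S)
    (h : IsAdaptedFrame f U ε e₁ e₂ s t) {y : S} (hy : y ∈ U) (v : ℂ) :
    diffAt f y (Complex.I * v) + Complex.I • diffAt f y v =
      (2 * Complex.I * (s y * (v / (show ℂ from ε y)))) • (show C2 from e₁ y) := by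
  rw [h.diffAt_eq hS hy, h.diffAt_eq hS hy, mul_div_assoc, map_mul, Complex.conj_I]
  module

lemma IsAdaptedFrame.diffAt_sub (hS : IsHermitianMetric ℂ S)
    (h : IsAdaptedFrame f U ε e₁ e₂ s t) {y : S} (hy : y ∈ U) (v : ℂ) :
    diffAt f y (Complex.I * v) - Complex.I • diffAt f y v =
      (-2 * Complex.I * (t y * starRingEnd ℂ (v / (show ℂ from ε y)))) •
        (show C2 from e₂ y) := by
  rw [h.diffAt_eq hS hy, h.diffAt_eq hS hy, mul_div_assoc, map_mul, Complex.conj_I]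
  module

lemma isAnticomplexPoint_iff_diffAt (y : S) : IsAnticomplexPoint f y ↔
    ∀ v : ℂ, diffAt f y (Complex.I * v) + Complex.I • diffAt f y v = 0 :=
  forall_congr' fun _ ↦ eq_neg_iff_add_eq_zero (G := C2)

lemma isComplexPoint_iff_diffAt (y : S) : IsComplexPoint f y ↔
    ∀ v : ℂ, diffAt f y (Complex.I * v) - Complex.I • diffAt f y v = 0 :=
  forall_congr' fun _ ↦ (sub_eq_zero (G := C2)).symm

lemma IsAdaptedFrame.e₁_ne_zero (h : IsAdaptedFrame f U ε e₁ e₂ s t) {y : S} (hy : y ∈ U) :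
    (show C2 from e₁ y) ≠ 0 := by
  intro h0
  have h1 : e₁ y = 0 := h0
  have h2 := h.inner_e₁ y hy
  rw [h1, inner_zero_left] at h2
  exact zero_ne_one h2

lemma IsAdaptedFrame.e₂_ne_zero (h : IsAdaptedFrame f U ε e₁ e₂ s t) {y : S} (hy : y ∈ U) :
    (show C2 from e₂ y) ≠ 0 := by
  intro h0
  have h1 : e₂ y = 0 := h0
  have h2 := h.inner_e₂ y hy
  rw [h1, inner_zero_left] at h2
  exact zero_ne_one h2

lemma IsAdaptedFrame.isAnticomplexPoint_iff (hS : IsHermitianMetric ℂ S)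
    (h : IsAdaptedFrame f U ε e₁ e₂ s t) {y : S} (hy : y ∈ U) :
    IsAnticomplexPoint f y ↔ s y = 0 := by
  rw [isAnticomplexPoint_iff_diffAt]
  simp only [h.diffAt_add hS hy]
  constructor
  · intro h1
    have h2 := (smul_eq_zero.1 (h1 (show ℂ from ε y))).resolve_right (h.e₁_ne_zero hy)
    rw [div_self (ne_zero_of_inner_self (h.inner_ε y hy))] at h2
    simpa using h2
  · intro h1 v
    rw [h1]
    simp only [zero_mul, mul_zero]
    exact zero_smul ℂ (_ : C2)

lemma IsAdaptedFrame.isComplexPoint_iff (hS : IsHermitianMetric ℂ S)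
    (h : IsAdaptedFrame f U ε e₁ e₂ s t) {y : S} (hy : y ∈ U) :
    IsComplexPoint f y ↔ t y = 0 := by
  rw [isComplexPoint_iff_diffAt]
  simp only [h.diffAt_sub hS hy]
  constructor
  · intro h1
    have h2 := (smul_eq_zero.1 (h1 (show ℂ from ε y))).resolve_right (h.e₂_ne_zero hy)
    rw [div_self (ne_zero_of_inner_self (h.inner_ε y hy))] at h2
    simpa using h2
  · intro h1 v
    rw [h1]
    simp only [zero_mul, mul_zero]
    exact zero_smul ℂ (_ : C2)

lemma metricAt_one_mul (hS : IsHermitianMetric ℂ S) {x : S} {ε : TangentSpace 𝓘(ℝ, ℂ) x}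
    (hε : inner ℝ ε ε = (1 : ℝ)) : ‖1 / (show ℂ from ε)‖ ^ 2 = metricAt x (1 : ℂ) 1 := by
  have he0 := ne_zero_of_inner_self hε
  have h := (isHermitianForm_metricAt hS x).smul_smul_self (show ℂ from ε) 1
  rw [smul_eq_mul, mul_one] at h
  replace h : (1 : ℝ) = _ := hε.symm.trans h
  have h1 : ‖(show ℂ from ε)‖ ≠ 0 := norm_ne_zero_iff.2 he0
  rw [norm_div, norm_one, div_pow, one_pow]
  field_simp
  rw [h]

/-- The absolute value of `s` does not depend on the adapted frame. -/
lemma IsAdaptedFrame.norm_s (hS : IsHermitianMetric ℂ S) (hM : IsHermitianMetric C2 M)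
    (h : IsAdaptedFrame f U ε e₁ e₂ s t) {y : S} (hy : y ∈ U) :
    metricAt (f y) (diffAt f y (Complex.I * 1) + Complex.I • diffAt f y 1)
      (diffAt f y (Complex.I * 1) + Complex.I • diffAt f y 1) =
        4 * metricAt y (1 : ℂ) 1 * ‖s y‖ ^ 2 := by
  have h1 : metricAt (f y) (show C2 from e₁ y) (show C2 from e₁ y) = 1 := h.inner_e₁ y hy
  rw [h.diffAt_add hS hy, (isHermitianForm_metricAt hM (f y)).smul_smul_self, h1,
    ← metricAt_one_mul hS (h.inner_ε y hy)]
  simp only [norm_mul, Complex.norm_I, Complex.norm_ofNat]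
  ring

/-- The absolute value of `t` does not depend on the adapted frame. -/
lemma IsAdaptedFrame.norm_t (hS : IsHermitianMetric ℂ S) (hM : IsHermitianMetric C2 M)
    (h : IsAdaptedFrame f U ε e₁ e₂ s t) {y : S} (hy : y ∈ U) :
    metricAt (f y) (diffAt f y (Complex.I * 1) - Complex.I • diffAt f y 1)
      (diffAt f y (Complex.I * 1) - Complex.I • diffAt f y 1) =
        4 * metricAt y (1 : ℂ) 1 * ‖t y‖ ^ 2 := by
  have h1 : metricAt (f y) (show C2 from e₂ y) (show C2 from e₂ y) = 1 := h.inner_e₂ y hy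
  rw [h.diffAt_sub hS hy, (isHermitianForm_metricAt hM (f y)).smul_smul_self, h1,
    ← metricAt_one_mul hS (h.inner_ε y hy)]
  simp only [norm_mul, norm_neg, RCLike.norm_conj, Complex.norm_I, Complex.norm_ofNat]
  ring

variable {ε' : Π x : S, TangentSpace 𝓘(ℝ, ℂ) x} {e₁' e₂' : Π x : S, TangentSpace 𝓘(ℝ, C2) (f x)}
  {s' t' : S → ℂ} {U' : Set S}

lemma IsAdaptedFrame.norm_s_eq (hS : IsHermitianMetric ℂ S) (hM : IsHermitianMetric C2 M)
    (h : IsAdaptedFrame f U ε e₁ e₂ s t) (h' : IsAdaptedFrame f U' ε' e₁' e₂' s' t') {y : S}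
    (hy : y ∈ U) (hy' : y ∈ U') : ‖s y‖ = ‖s' y‖ := by
  have h1 := (h.norm_s hS hM hy).symm.trans (h'.norm_s hS hM hy')
  have hp := (isHermitianForm_metricAt hS y).pos 1 one_ne_zero
  have h2 := mul_left_cancel₀ (mul_pos four_pos hp).ne' h1
  exact (pow_left_inj₀ (norm_nonneg _) (norm_nonneg _) two_ne_zero).1 h2

lemma IsAdaptedFrame.norm_t_eq (hS : IsHermitianMetric ℂ S) (hM : IsHermitianMetric C2 M)
    (h : IsAdaptedFrame f U ε e₁ e₂ s t) (h' : IsAdaptedFrame f U' ε' e₁' e₂' s' t') {y : S}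
    (hy : y ∈ U) (hy' : y ∈ U') : ‖t y‖ = ‖t' y‖ := by
  have h1 := (h.norm_t hS hM hy).symm.trans (h'.norm_t hS hM hy')
  have hp := (isHermitianForm_metricAt hS y).pos 1 one_ne_zero
  have h2 := mul_left_cancel₀ (mul_pos four_pos hp).ne' h1
  exact (pow_left_inj₀ (norm_nonneg _) (norm_nonneg _) two_ne_zero).1 h2

end FramePointwise

lemma contMDiffOn_complex_mul {E : Type*} [NormedAddCommGroup E] [NormedSpace ℝ E] {N : Type*}
    [TopologicalSpace N] [ChartedSpace E N] {a b : N → ℂ} {U : Set N}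
    (ha : ContMDiffOn 𝓘(ℝ, E) 𝓘(ℝ, ℂ) ∞ a U) (hb : ContMDiffOn 𝓘(ℝ, E) 𝓘(ℝ, ℂ) ∞ b U) :
    ContMDiffOn 𝓘(ℝ, E) 𝓘(ℝ, ℂ) ∞ (fun y ↦ a y * b y) U :=
  ((contDiff_mul (𝕜 := ℝ) (𝔸 := ℂ) (n := ∞)).contMDiff).comp_contMDiffOn (ha.prodMk_space hb)

lemma contDiffOn_complex_div {E : Type*} [NormedAddCommGroup E] [NormedSpace ℝ E] {a b : E → ℂ}
    {U : Set E} (ha : ContDiffOn ℝ ∞ a U) (hb : ContDiffOn ℝ ∞ b U) (hb0 : ∀ y ∈ U, b y ≠ 0) :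
    ContDiffOn ℝ ∞ (fun y ↦ a y / b y) U := by
  simp only [div_eq_mul_inv]
  exact ha.mul (hb.inv hb0)

/-! ### Adapted frames in coordinates and the local factorization of their coefficients. -/

section FrameCoordinates

set_option linter.unusedSectionVars false

variable {S : Type*} [TopologicalSpace S] [ChartedSpace ℂ S] [IsManifold 𝓘(ℂ) ω S]

/-- Both `coordDeriv z y` and the representation of `v` refer to the preferred chart at `y`, which
may jump with `y`. Rewriting their product through the fixed chart at `x` makes smooth dependence on
`y` visible. -/
lemma coordDeriv_mul_eq {z : OpenPartialHomeomorph S ℂ}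
    (hz : z ∈ IsManifold.maximalAtlas 𝓘(ℂ) ω S) {x y : S} (hy : y ∈ z.source)
    (hyx : y ∈ (chartAt ℂ x).source) (v : ℂ) :
    coordDeriv z y * v = fderiv ℂ (z ∘ (chartAt ℂ x).symm) (chartAt ℂ x y)
      (tangentCoordChange 𝓘(ℝ, ℂ) y x y v) := by
  have h1 := (contDiffAt_transition (chartAt_mem_maximalAtlas' (E := ℂ) x) hz hyx
    hy).differentiableAt (by simp)
  have h2 := (contDiffAt_transition (chartAt_mem_maximalAtlas' (E := ℂ) y)
    (chartAt_mem_maximalAtlas' x) (mem_chart_source ℂ y) hyx).differentiableAt (by simp)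
  have h3 : (chartAt ℂ x ∘ (chartAt ℂ y).symm) (chartAt ℂ y y) = chartAt ℂ x y := by simp
  rw [← h3] at h1
  have h4 : (z ∘ (chartAt ℂ x).symm) ∘ (chartAt ℂ x ∘ (chartAt ℂ y).symm) =ᶠ[𝓝 (chartAt ℂ y y)]
      z ∘ (chartAt ℂ y).symm := by
    have h5 : ∀ᶠ u in 𝓝 (chartAt ℂ y y), (chartAt ℂ y).symm u ∈ (chartAt ℂ x).source :=
      ((chartAt ℂ y).continuousAt_symm (mem_chart_target ℂ y)).eventually
        ((chartAt ℂ x).open_source.mem_nhds (by simpa using hyx))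
    filter_upwards [h5] with u hu
    simp [hu]
  have h5 := h4.fderiv_eq (𝕜 := ℂ)
  rw [fderiv_comp _ h1 h2, h3] at h5
  rw [← fderiv_coord_eq, ← h5, tangentCoordChange_eq (mem_chart_source ℂ y) hyx]
  rfl

/-- The coordinate of a smooth vector field is smooth. -/
lemma contMDiffOn_coordDeriv_mul {z : OpenPartialHomeomorph S ℂ}
    (hz : z ∈ IsManifold.maximalAtlas 𝓘(ℂ) ω S) {U : Set S} {ε : Π x : S, TangentSpace 𝓘(ℝ, ℂ) x}
    (hε : ContMDiffOn 𝓘(ℝ, ℂ) 𝓘(ℝ, ℂ).tangent ∞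
      (fun x ↦ (⟨x, ε x⟩ : TangentBundle 𝓘(ℝ, ℂ) S)) U) (x : S) :
    ContMDiffOn 𝓘(ℝ, ℂ) 𝓘(ℝ, ℂ) ∞ (fun y ↦ coordDeriv z y * (show ℂ from ε y))
      (U ∩ (z.source ∩ (chartAt ℂ x).source)) := by
  have h1 : ContMDiffOn 𝓘(ℝ, ℂ) 𝓘(ℝ, ℂ) ∞
      (fun y ↦ tangentCoordChange 𝓘(ℝ, ℂ) y x y (ε y)) (U ∩ (z.source ∩ (chartAt ℂ x).source)) :=
    (contMDiffOn_section_iff (g := fun y : S ↦ y) (m := x) contMDiffOn_id fun y hy ↦ hy.2.2).1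
      (hε.mono inter_subset_left)
  have h2 : ContDiffOn ℝ ∞ (fderiv ℂ (z ∘ (chartAt ℂ x).symm))
      ((chartAt ℂ x).symm ≫ₕ z).source := by
    have h3 : ContDiffOn ℂ ω (z ∘ (chartAt ℂ x).symm) ((chartAt ℂ x).symm ≫ₕ z).source := by
      intro u hu
      have hu1 : u ∈ (chartAt ℂ x).target := by simpa using hu.1
      have hu2 : (chartAt ℂ x).symm u ∈ z.source := by simpa using hu.2
      have := contDiffAt_transition (chartAt_mem_maximalAtlas' (E := ℂ) x) hz
        ((chartAt ℂ x).map_target hu1) hu2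
      rw [(chartAt ℂ x).right_inv hu1] at this
      exact this.contDiffWithinAt
    exact ((h3.fderiv_of_isOpen (m := ω) ((chartAt ℂ x).symm ≫ₕ z).open_source
      (by simp)).restrict_scalars ℝ).of_le (by simp)
  have h3 : ContMDiffOn 𝓘(ℝ, ℂ) 𝓘(ℝ, ℂ) ∞
      (fun y ↦ fderiv ℂ (z ∘ (chartAt ℂ x).symm) (chartAt ℂ x y) 1)
      (U ∩ (z.source ∩ (chartAt ℂ x).source)) := by
    have h4 : ContDiffOn ℝ ∞ (fun u ↦ fderiv ℂ (z ∘ (chartAt ℂ x).symm) u 1)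
        ((chartAt ℂ x).symm ≫ₕ z).source :=
      (((ContinuousLinearMap.apply ℂ ℂ (1 : ℂ)).restrictScalars ℝ).contDiff).comp_contDiffOn h2
    refine (contMDiffOn_iff_contDiffOn.2 h4).comp
      ((contMDiffOn_holomorphicChart (chartAt_mem_maximalAtlas' (E := ℂ) x)).mono
        fun y hy ↦ hy.2.2) fun y hy ↦ ?_
    simp [hy.2.1, hy.2.2]
  refine (contMDiffOn_complex_mul h3 h1).congr fun y hy ↦ ?_
  rw [coordDeriv_mul_eq hz hy.2.1 hy.2.2]
  conv_lhs => rw [← mul_one (tangentCoordChange 𝓘(ℝ, ℂ) y x y _), ← smul_eq_mul, map_smul,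
    smul_eq_mul, mul_comm]

variable {M : Type*} [TopologicalSpace M] [ChartedSpace C2 M] [IsManifold 𝓘(ℂ, C2) ω M]
  [Bundle.RiemannianBundle (fun x : S ↦ TangentSpace 𝓘(ℝ, ℂ) x)]
  [Bundle.RiemannianBundle (fun x : M ↦ TangentSpace 𝓘(ℝ, C2) x)]
  {f : S → M} {U : Set S} {ε : Π x : S, TangentSpace 𝓘(ℝ, ℂ) x}
  {e₁ e₂ : Π x : S, TangentSpace 𝓘(ℝ, C2) (f x)} {s t : S → ℂ}

/-- The differential of `f` in coordinates, in terms of an adapted frame. -/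
lemma IsAdaptedFrame.fderiv_coordMap (hS : IsHermitianMetric ℂ S)
    (h : IsAdaptedFrame f U ε e₁ e₂ s t) (hf : ContMDiff 𝓘(ℝ, ℂ) 𝓘(ℝ, C2) ∞ f)
    {z : OpenPartialHomeomorph S ℂ} (hz : z ∈ IsManifold.maximalAtlas 𝓘(ℂ) ω S) {m : M} {y : S}
    (hyU : y ∈ U) (hy : y ∈ z.source) (hfy : f y ∈ (chartAt C2 m).source) (w : ℂ) :
    fderiv ℝ (coordMap f z m) (z y) w =
      w • ((s y / (coordDeriv z y * (show ℂ from ε y))) •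
        tangentCoordChange 𝓘(ℝ, C2) (f y) m (f y) (e₁ y)) +
      starRingEnd ℂ w • ((t y / starRingEnd ℂ (coordDeriv z y * (show ℂ from ε y))) •
        tangentCoordChange 𝓘(ℝ, C2) (f y) m (f y) (e₂ y)) := by
  have hβ := coordDeriv_ne_zero hz hy
  have hε := ne_zero_of_inner_self (h.inner_ε y hyU)
  obtain ⟨v, rfl⟩ : ∃ v, w = coordDeriv z y * v := ⟨w / coordDeriv z y, by field_simp⟩
  rw [ChernMinimal.fderiv_coordMap hf hz hy hfy]
  have h1 := h.diffAt_eq hS hyU v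
  have hT := tangentCoordChange_smul (mem_chart_source C2 (f y)) hfy
  refine (congrArg (tangentCoordChange 𝓘(ℝ, C2) (f y) m (f y)) h1).trans ?_
  rw [map_add, hT, hT, smul_smul, smul_smul]
  congr 2
  · field_simp
  · have hβ' : starRingEnd ℂ (coordDeriv z y) ≠ 0 := (map_ne_zero _).2 hβ
    have hε' : starRingEnd ℂ (show ℂ from ε y) ≠ 0 := (map_ne_zero _).2 hε
    rw [map_mul, map_mul, map_div₀]
    field_simp

end FrameCoordinates

section Factorization

set_option linter.unusedSectionVars false

variable {S : Type*} [TopologicalSpace S] [ChartedSpace ℂ S] [IsManifold 𝓘(ℂ) ω S]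

/-- A smooth function that satisfies `∂σ/∂z̄ = c σ` in a coordinate, after division by a smooth
function without zeros, vanishes near a point or has a well-defined order there. -/
lemma eventually_zero_or_factorsAt {z : OpenPartialHomeomorph S ℂ} {x : S}
    (hz : IsHolomorphicCoordinateAt z x) {O : Set S} (hO : IsOpen O) (hxO : x ∈ O)
    (hOz : O ⊆ z.source) {a u : S → ℂ} (ha : ContMDiffOn 𝓘(ℝ, ℂ) 𝓘(ℝ, ℂ) ∞ a O)
    (hu : ContMDiffOn 𝓘(ℝ, ℂ) 𝓘(ℝ, ℂ) ∞ u O) (hu0 : ∀ y ∈ O, u y ≠ 0)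
    (hc : ∃ c : ℂ → ℂ, ContDiffOn ℝ ∞ c (z.target ∩ z.symm ⁻¹' O) ∧
      ∀ ζ ∈ z.target ∩ z.symm ⁻¹' O, dzbar (fun ζ ↦ a (z.symm ζ) / u (z.symm ζ)) ζ =
        c ζ * (a (z.symm ζ) / u (z.symm ζ))) :
    (∀ᶠ y in 𝓝 x, a y = 0) ∨ ∃ n, FactorsAt a z x n := by
  obtain ⟨hzm, hxz, hzx⟩ := hz
  obtain ⟨c, hcs, hc⟩ := hc
  have hVo := z.isOpen_inter_preimage_symm hO
  have h0 : (0 : ℂ) ∈ z.target ∩ z.symm ⁻¹' O := by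
    rw [← hzx]
    exact ⟨z.map_source hxz, by simpa [hxz] using hxO⟩
  have hsymm := (contMDiffOn_holomorphicChart_symm hzm).mono
    (inter_subset_left : z.target ∩ z.symm ⁻¹' O ⊆ z.target)
  have hσ : ContDiffOn ℝ ∞ (fun ζ ↦ a (z.symm ζ) / u (z.symm ζ)) (z.target ∩ z.symm ⁻¹' O) :=
    contDiffOn_complex_div (contMDiffOn_iff_contDiffOn.1 (ha.comp hsymm fun ζ hζ ↦ hζ.2))
      (contMDiffOn_iff_contDiffOn.1 (hu.comp hsymm fun ζ hζ ↦ hζ.2)) fun ζ hζ ↦ hu0 _ hζ.2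
  have hzc := z.continuousAt hxz
  rcases eventually_zero_or_factor_of_dzbar_eq hVo h0 hσ hcs hc with h |
    ⟨n, W, H, hW, h0W, hWV, hH, hfac⟩
  · left
    have h' : ∀ᶠ ζ in 𝓝 (z x), a (z.symm ζ) / u (z.symm ζ) = 0 := by rwa [hzx]
    filter_upwards [hzc.eventually h', hO.mem_nhds hxO] with y hy hyO
    rw [z.left_inv (hOz hyO)] at hy
    exact (div_eq_zero_iff.1 hy).resolve_right (hu0 y hyO)
  · right
    refine ⟨n, O ∩ z ⁻¹' W, ?_, ⟨hxO, by simpa [hzx] using h0W⟩, fun y ↦ H (z y) * u y, ?_, ?_⟩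
    · exact (z.continuousOn.mono hOz).isOpen_inter_preimage hO hW
    · exact contMDiffOn_complex_mul ((contMDiffOn_iff_contDiffOn.2 hH).comp
        ((contMDiffOn_holomorphicChart hzm).mono fun y hy ↦ hOz hy.1) fun y hy ↦ hy.2)
        (hu.mono inter_subset_left)
    · intro y hy
      obtain ⟨h1, h2⟩ := hfac (z y) hy.2
      refine ⟨mul_ne_zero h1 (hu0 y hy.1), ?_⟩
      rw [z.left_inv (hOz hy.1), sub_zero, div_eq_iff (hu0 y hy.1)] at h2
      rw [h2]; ring

lemma FactorsAt.conj {a ζ : S → ℂ} {x : S} {n : ℕ} (h : FactorsAt a ζ x n) :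
    FactorsAt (fun y ↦ starRingEnd ℂ (a y)) (fun y ↦ starRingEnd ℂ (ζ y)) x n := by
  obtain ⟨V, hV, hx, k, hk, hfac⟩ := h
  refine ⟨V, hV, hx, fun y ↦ starRingEnd ℂ (k y), ?_, fun y hy ↦ ⟨?_, ?_⟩⟩
  · exact (Complex.conjCLE.contDiff.contMDiff (n := ∞)).comp_contMDiffOn hk
  · exact (map_ne_zero _).2 (hfac y hy).1
  · simp only [(hfac y hy).2, map_mul, map_pow]

end Factorization

section Order

set_option linter.unusedSectionVars false

variable {S : Type*} [TopologicalSpace S] [ChartedSpace ℂ S] [IsManifold 𝓘(ℂ) ω S]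
  [Bundle.RiemannianBundle (fun x : S ↦ TangentSpace 𝓘(ℝ, ℂ) x)]
  [IsContMDiffRiemannianBundle 𝓘(ℝ, ℂ) ∞ ℂ (fun x : S ↦ TangentSpace 𝓘(ℝ, ℂ) x)]
  {M : Type*} [TopologicalSpace M] [ChartedSpace C2 M] [IsManifold 𝓘(ℂ, C2) ω M]
  [Bundle.RiemannianBundle (fun x : M ↦ TangentSpace 𝓘(ℝ, C2) x)]
  [IsContMDiffRiemannianBundle 𝓘(ℝ, C2) ∞ C2 (fun x : M ↦ TangentSpace 𝓘(ℝ, C2) x)]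
  {f : S → M}

section

variable {U : Set S} {ε : Π x : S, TangentSpace 𝓘(ℝ, ℂ) x}
  {e₁ e₂ : Π x : S, TangentSpace 𝓘(ℝ, C2) (f x)} {s t : S → ℂ}

/-- Each of the two coefficients of a Chern minimal map in an adapted frame vanishes near a point or
has a finite order there. -/
lemma IsAdaptedFrame.eventually_zero_or_factorsAt (hS : IsHermitianMetric ℂ S)
    (hM : IsHermitianMetric C2 M) (hf : ContMDiff 𝓘(ℝ, ℂ) 𝓘(ℝ, C2) ∞ f) (hmin : IsChernMinimal f)
    (hU : IsOpen U) (h : IsAdaptedFrame f U ε e₁ e₂ s t) {x : S} (hx : x ∈ U)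
    {z : OpenPartialHomeomorph S ℂ} (hz : IsHolomorphicCoordinateAt z x) :
    ((∀ᶠ y in 𝓝 x, s y = 0) ∨ ∃ n, FactorsAt s z x n) ∧
      ((∀ᶠ y in 𝓝 x, t y = 0) ∨ ∃ n, FactorsAt t (fun y ↦ starRingEnd ℂ (z y)) x n) := by
  set m := f x with hm
  set O : Set S := U ∩ (z.source ∩ (chartAt ℂ x).source) ∩ f ⁻¹' (chartAt C2 m).source with hOdef
  have hO : IsOpen O := (hU.inter (z.open_source.inter (chartAt ℂ x).open_source)).inter
    ((chartAt C2 m).open_source.preimage hf.continuous)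
  have hxO : x ∈ O := ⟨⟨hx, hz.2.1, mem_chart_source ℂ x⟩, mem_chart_source C2 (f x)⟩
  have hOz : O ⊆ z.source := fun y hy ↦ hy.1.2.1
  have hOU : O ⊆ U := fun y hy ↦ hy.1.1
  set u : S → ℂ := fun y ↦ coordDeriv z y * (show ℂ from ε y) with hudef
  have hu : ContMDiffOn 𝓘(ℝ, ℂ) 𝓘(ℝ, ℂ) ∞ u O :=
    (contMDiffOn_coordDeriv_mul hz.1 h.smooth_ε x).mono inter_subset_left
  have hu0 : ∀ y ∈ O, u y ≠ 0 := fun y hy ↦ mul_ne_zero (coordDeriv_ne_zero hz.1 (hOz hy))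
    (ne_zero_of_inner_self (h.inner_ε y (hOU hy)))
  set V : Set ℂ := z.target ∩ z.symm ⁻¹' O with hVdef
  have hV : IsOpen V := z.isOpen_inter_preimage_symm hO
  have hVc : V ⊆ coordDomain f z m := fun ζ hζ ↦ ⟨hζ.1, hζ.2.2⟩
  have hsymm : ContMDiffOn 𝓘(ℝ, ℂ) 𝓘(ℝ, ℂ) ∞ z.symm V :=
    (contMDiffOn_holomorphicChart_symm hz.1).mono inter_subset_left
  have hF := (contDiffOn_coordMap hf hz.1 m).mono hVc
  have hFV : MapsTo (coordMap f z m) V (chartAt C2 m).target := (mapsTo_coordMap f z m).mono_left hVc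
  have hG := contDiffOn_metricCoord (E := C2) m
  have hherm : ∀ w ∈ (chartAt C2 m).target, IsHermitianForm (metricCoord (E := C2) m w) :=
    fun w hw ↦ isHermitianForm_metricCoord hM hw
  have hch : ∀ ζ ∈ V, IsChernHarmonicAt (metricCoord (E := C2) m) (coordMap f z m) ζ :=
    fun ζ hζ ↦ hmin.isChernHarmonicAt_coordMap hS hM hf hz.1 (hVc hζ)
  have hframe : ∀ e : Π x : S, TangentSpace 𝓘(ℝ, C2) (f x),
      ContMDiffOn 𝓘(ℝ, ℂ) 𝓘(ℝ, C2).tangent ∞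
        (fun x ↦ (⟨f x, e x⟩ : TangentBundle 𝓘(ℝ, C2) M)) U →
      (∀ y ∈ U, inner ℝ (e y) (e y) = (1 : ℝ)) →
      ContDiffOn ℝ ∞ (fun ζ ↦ tangentCoordChange 𝓘(ℝ, C2) (f (z.symm ζ)) m (f (z.symm ζ))
        (e (z.symm ζ))) V ∧
      ∀ ζ ∈ V, hermForm (metricCoord (E := C2) m (coordMap f z m ζ))
        (tangentCoordChange 𝓘(ℝ, C2) (f (z.symm ζ)) m (f (z.symm ζ)) (e (z.symm ζ)))
        (tangentCoordChange 𝓘(ℝ, C2) (f (z.symm ζ)) m (f (z.symm ζ)) (e (z.symm ζ))) = 1 := by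
    intro e he he1
    have h1 := (contMDiffOn_section_iff (g := f) (e := e) (U := O) (m := m) hf.contMDiffOn
      fun y hy ↦ hy.2).1 (he.mono hOU)
    refine ⟨contMDiffOn_iff_contDiffOn.1 (h1.comp hsymm fun ζ hζ ↦ hζ.2), fun ζ hζ ↦ ?_⟩
    rw [(hherm _ (hFV hζ)).self_eq]
    have h3 : metricAt (f (z.symm ζ)) (show C2 from e (z.symm ζ)) (show C2 from e (z.symm ζ)) = 1 :=
      he1 _ (hOU hζ.2)
    exact (congrArg Complex.ofReal ((metricCoord_tangentCoordChange hζ.2.2 _ _).trans h3)).trans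
      Complex.ofReal_one
  have hd : ∀ ζ ∈ V, ∀ w, fderiv ℝ (coordMap f z m) ζ w =
      w • ((s (z.symm ζ) / u (z.symm ζ)) •
        tangentCoordChange 𝓘(ℝ, C2) (f (z.symm ζ)) m (f (z.symm ζ)) (e₁ (z.symm ζ))) +
      starRingEnd ℂ w • ((t (z.symm ζ) / starRingEnd ℂ (u (z.symm ζ))) •
        tangentCoordChange 𝓘(ℝ, C2) (f (z.symm ζ)) m (f (z.symm ζ)) (e₂ (z.symm ζ))) := by
    intro ζ hζ w
    have h1 := h.fderiv_coordMap hS hf hz.1 (m := m) (hOU hζ.2) (hOz hζ.2) hζ.2.2 w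
    rwa [z.right_inv hζ.1] at h1
  have hsO := h.smooth_s.mono hOU
  have htO := h.smooth_t.mono hOU
  have hconj : ContMDiff 𝓘(ℝ, ℂ) 𝓘(ℝ, ℂ) ∞ (starRingEnd ℂ) :=
    (Complex.conjCLE.contDiff (n := ∞)).contMDiff
  have hconjD : ContDiff ℝ ∞ (starRingEnd ℂ) := Complex.conjCLE.contDiff
  have hs' := contMDiffOn_iff_contDiffOn.1 (hsO.comp hsymm fun ζ hζ ↦ hζ.2)
  have ht' := contMDiffOn_iff_contDiffOn.1 (htO.comp hsymm fun ζ hζ ↦ hζ.2)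
  have hu' := contMDiffOn_iff_contDiffOn.1 (hu.comp hsymm fun ζ hζ ↦ hζ.2)
  constructor
  · refine ChernMinimal.eventually_zero_or_factorsAt hz hO hxO hOz hsO hu hu0 ?_
    obtain ⟨h1, h2⟩ := hframe e₁ h.smooth_e₁ h.inner_e₁
    exact exists_dzbar_coeff_eq hV (chartAt C2 m).open_target hFV hG hherm hF hch h1
      (contDiffOn_complex_div hs' hu' fun ζ hζ ↦ hu0 _ hζ.2) h2 fun ζ hζ ↦ dz_eq_of_fderiv (hd ζ hζ)
  -- The `∂/∂z̄` equation holds for the conjugate of `t / ū`, that is `t̄ / u`; a final conjugation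
  -- returns a power of `z̄` for `t`.
  · have key := ChernMinimal.eventually_zero_or_factorsAt (a := fun y ↦ starRingEnd ℂ (t y)) hz hO hxO
      hOz (hconj.comp_contMDiffOn htO) hu hu0 (by
        obtain ⟨h1, h2⟩ := hframe e₂ h.smooth_e₂ h.inner_e₂
        have h3 := exists_dzbar_conj_coeff_eq hV (chartAt C2 m).open_target hFV hG hherm hF hch h1
          (contDiffOn_complex_div ht' (hconjD.comp_contDiffOn hu')
            fun ζ hζ ↦ (map_ne_zero _).2 (hu0 _ hζ.2)) h2
          fun ζ hζ ↦ dzbar_eq_of_fderiv (hd ζ hζ)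
        simpa only [map_div₀, Complex.conj_conj, Function.comp_apply] using h3)
    refine key.imp (fun h1 ↦ ?_) fun ⟨n, hn⟩ ↦ ⟨n, ?_⟩
    · filter_upwards [h1] with y hy
      exact (map_eq_zero _).1 hy
    · simpa only [Complex.conj_conj] using hn.conj

end

end Order

/-! ### Existence of adapted frames. -/

section Existence

set_option linter.unusedSectionVars false

variable {S : Type*} [TopologicalSpace S] [ChartedSpace ℂ S] [IsManifold 𝓘(ℂ) ω S]
  [Bundle.RiemannianBundle (fun x : S ↦ TangentSpace 𝓘(ℝ, ℂ) x)]
  [IsContMDiffRiemannianBundle 𝓘(ℝ, ℂ) ∞ ℂ (fun x : S ↦ TangentSpace 𝓘(ℝ, ℂ) x)]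
  {M : Type*} [TopologicalSpace M] [ChartedSpace C2 M] [IsManifold 𝓘(ℂ, C2) ω M]
  [Bundle.RiemannianBundle (fun x : M ↦ TangentSpace 𝓘(ℝ, C2) x)]
  [IsContMDiffRiemannianBundle 𝓘(ℝ, C2) ∞ C2 (fun x : M ↦ TangentSpace 𝓘(ℝ, C2) x)]
  {f : S → M}

/-- An isometric map is conformal in coordinates. -/
lemma IsIsometricMap.metricCoord_fderiv (hiso : IsIsometricMap f)
    (hf : ContMDiff 𝓘(ℝ, ℂ) 𝓘(ℝ, C2) ∞ f) {z : OpenPartialHomeomorph S ℂ}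
    (hz : z ∈ IsManifold.maximalAtlas 𝓘(ℂ) ω S) {m : M} {y : S} (hy : y ∈ z.source)
    (hfy : f y ∈ (chartAt C2 m).source) (v w : ℂ) :
    metricCoord (E := C2) m (coordMap f z m (z y))
      (fderiv ℝ (coordMap f z m) (z y) (coordDeriv z y * v))
      (fderiv ℝ (coordMap f z m) (z y) (coordDeriv z y * w)) = metricAt y v w := by
  have h1 : coordMap f z m (z y) = chartAt C2 m (f y) := by simp [coordMap, hy]
  rw [ChernMinimal.fderiv_coordMap hf hz hy hfy, ChernMinimal.fderiv_coordMap hf hz hy hfy, h1]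
  exact (metricCoord_tangentCoordChange hfy _ _).trans (hiso y v w)

/-- With `F_x = F_z + F_z̄` and `F_y = i (F_z - F_z̄)`, the relation `|F_x| = |F_y|` kills the real
part of the Hermitian product, and `F_x ⊥ F_y` its imaginary part. The derivatives cannot both
vanish since `F_x` has positive length. -/
lemma IsIsometricMap.hermForm_dz_dzbar (hS : IsHermitianMetric ℂ S) (hM : IsHermitianMetric C2 M)
    (hiso : IsIsometricMap f) (hf : ContMDiff 𝓘(ℝ, ℂ) 𝓘(ℝ, C2) ∞ f)
    {z : OpenPartialHomeomorph S ℂ} (hz : z ∈ IsManifold.maximalAtlas 𝓘(ℂ) ω S) {m : M} {ζ : ℂ}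
    (hζ : ζ ∈ coordDomain f z m) :
    hermForm (metricCoord (E := C2) m (coordMap f z m ζ)) (dz (coordMap f z m) ζ)
      (dzbar (coordMap f z m) ζ) = 0 ∧
      (dz (coordMap f z m) ζ ≠ 0 ∨ dzbar (coordMap f z m) ζ ≠ 0) := by
  obtain ⟨y, hy, rfl⟩ : ∃ y ∈ z.source, z y = ζ :=
    ⟨z.symm ζ, z.map_target hζ.1, z.right_inv hζ.1⟩
  have hfy : f y ∈ (chartAt C2 m).source := by simpa [hy] using hζ.2
  have hβ := coordDeriv_ne_zero hz hy
  have hG := isHermitianForm_metricCoord hM (mapsTo_coordMap f z m hζ)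
  have hg := isHermitianForm_metricAt hS y
  have key : ∀ v w : ℂ, metricCoord (E := C2) m (coordMap f z m (z y))
      (fderiv ℝ (coordMap f z m) (z y) v) (fderiv ℝ (coordMap f z m) (z y) w) =
      metricAt y (v / coordDeriv z y) (w / coordDeriv z y) := by
    intro v w
    rw [← hiso.metricCoord_fderiv hf hz hy hfy, mul_div_cancel₀ _ hβ, mul_div_cancel₀ _ hβ]
  set β := coordDeriv z y
  set G := metricCoord (E := C2) m (coordMap f z m (z y))
  set a := dz (coordMap f z m) (z y)
  set b := dzbar (coordMap f z m) (z y)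
  have h11 := key 1 1
  have h1I := key 1 Complex.I
  have hII := key Complex.I Complex.I
  have hIβ : Complex.I / β = Complex.I • (1 / β) := by rw [smul_eq_mul, mul_one_div]
  have hII' : metricAt y (Complex.I • (1 / β)) (Complex.I • (1 / β)) =
    metricAt y (1 / β) (1 / β) := hg.smul_I _ _
  have h1I' : metricAt y (1 / β) (Complex.I • (1 / β)) = 0 := by
    have h1 := hg.I_left (1 / β) (1 / β)
    rw [hg.symm] at h1
    linarith
  rw [hIβ, hII', ← h11] at hII
  rw [hIβ, h1I'] at h1I
  rw [fderiv_one_eq, fderiv_I_eq] at h1I hII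
  rw [fderiv_one_eq] at h11
  change G (a + b) (Complex.I • (a - b)) = 0 at h1I
  change G (Complex.I • (a - b)) (Complex.I • (a - b)) = G (a + b) (a + b) at hII
  change G (a + b) (a + b) = _ at h11
  rw [hG.smul_I] at hII
  have ia := hG.I_left a a
  have ib := hG.I_left b b
  have iab := hG.I_left a b
  simp only [map_add, map_sub, add_apply, sub_apply, smul_sub] at h1I hII
  rw [hG.symm] at ia ib iab
  have s1 := hG.symm a b
  refine ⟨Complex.ext ?_ ?_, ?_⟩
  · rw [hermForm_re, Complex.zero_re]
    linarith
  · rw [hermForm_im, Complex.zero_im]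
    linarith
  · by_contra! h0
    rw [h0.1, h0.2, add_zero, map_zero] at h11
    exact (hg.pos (1 / β) (one_div_ne_zero hβ)).ne h11

/-- Adapted frames exist locally. -/
lemma exists_isAdaptedFrame (hS : IsHermitianMetric ℂ S) (hM : IsHermitianMetric C2 M)
    (hiso : IsIsometricMap f) (hf : ContMDiff 𝓘(ℝ, ℂ) 𝓘(ℝ, C2) ∞ f) (x : S) :
    ∃ U : Set S, IsOpen U ∧ x ∈ U ∧ ∃ ε e₁ e₂ s t, IsAdaptedFrame f U ε e₁ e₂ s t := by
  set m := f x with hm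
  set φ := chartAt ℂ x with hφ
  have hφm := chartAt_mem_maximalAtlas' (E := ℂ) x
  set F := coordMap f φ m with hFdef
  set V := coordDomain f φ m with hVdef
  have hV : IsOpen V := isOpen_coordDomain hf.continuous φ m
  have hxV : φ x ∈ V := mem_coordDomain (mem_chart_source ℂ x) (mem_chart_source C2 (f x))
  have hF : ContDiffOn ℝ ∞ F V := contDiffOn_coordMap hf hφm m
  have hD : ContDiffOn ℝ ∞ (fun ζ ↦ metricCoord (E := C2) m (F ζ)) V :=
    (contDiffOn_metricCoord (E := C2) m).comp hF (mapsTo_coordMap f φ m)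
  have hherm : ∀ ζ ∈ V, IsHermitianForm (metricCoord (E := C2) m (F ζ)) := fun ζ hζ ↦
    isHermitianForm_metricCoord hM (mapsTo_coordMap f φ m hζ)
  obtain ⟨W, E₁, E₂, σ, τ, hW, hxW, hWV, hE₁, hE₂, hσ, hτ, h11, h22, h12, ha, hb⟩ :=
    exists_unitary_frame (by simp) hV hxV hD hherm (contDiffOn_dz hV hF) (contDiffOn_dzbar hV hF)
      (fun ζ hζ ↦ (hiso.hermForm_dz_dzbar hS hM hf hφm hζ).1)
      (hiso.hermForm_dz_dzbar hS hM hf hφm hxV).2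
  -- `r` rescales the coordinate field `1` to unit length; it will be the coordinate of `ε`.
  obtain ⟨r, hr, hr0, hr1⟩ := exists_smooth_normalization (contDiffOn_metricCoord (E := ℂ) x)
    (fun u hu ↦ isHermitianForm_metricCoord hS hu) (contDiffOn_const (c := (1 : ℂ)))
    (fun _ _ ↦ one_ne_zero)
  have hWt : W ⊆ φ.target := fun ζ hζ ↦ (hWV hζ).1
  set U : Set S := φ.source ∩ φ ⁻¹' W with hUdef
  have hU : IsOpen U := φ.continuousOn.isOpen_inter_preimage φ.open_source hW
  have hφU : ContMDiffOn 𝓘(ℝ, ℂ) 𝓘(ℝ, ℂ) ∞ φ U :=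
    (contMDiffOn_holomorphicChart hφm).mono inter_subset_left
  have hfU : ∀ y ∈ U, f y ∈ (chartAt C2 m).source := fun y hy ↦ by
    simpa [hy.1] using (hWV hy.2).2
  have hFU : ∀ y ∈ U, F (φ y) = chartAt C2 m (f y) := fun y hy ↦ by simp [hFdef, coordMap, hy.1]
  have hself : ∀ y ∈ U, ∀ v : C2, tangentCoordChange 𝓘(ℝ, C2) (f y) m (f y)
      (tangentCoordChange 𝓘(ℝ, C2) m (f y) (f y) v) = v := fun y hy v ↦ by
    rw [tangentCoordChange_comp (by simp [hfU y hy]), tangentCoordChange_self (by simp [hfU y hy])]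
  have hself' : ∀ y ∈ U, ∀ v : C2, tangentCoordChange 𝓘(ℝ, C2) m (f y) (f y)
      (tangentCoordChange 𝓘(ℝ, C2) (f y) m (f y) v) = v := fun y hy v ↦ by
    rw [tangentCoordChange_comp (by simp [hfU y hy]), tangentCoordChange_self (by simp)]
  have hselfS : ∀ y ∈ U, ∀ v : ℂ, tangentCoordChange 𝓘(ℝ, ℂ) y x y
      (tangentCoordChange 𝓘(ℝ, ℂ) x y y v) = v := fun y hy v ↦ by
    rw [tangentCoordChange_comp (by simp [hy.1, ← hφ]),
      tangentCoordChange_self (by simp [hy.1, ← hφ])]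
  have hinner : ∀ y ∈ U, ∀ v w : C2, metricAt (f y) (tangentCoordChange 𝓘(ℝ, C2) m (f y) (f y) v)
      (tangentCoordChange 𝓘(ℝ, C2) m (f y) (f y) w) = metricCoord m (F (φ y)) v w := by
    intro y hy v w
    rw [hFU y hy, ← metricCoord_tangentCoordChange (hfU y hy), hself y hy, hself y hy]
  have hT : ∀ y ∈ U, ∀ (c : ℂ) (v : C2), tangentCoordChange 𝓘(ℝ, C2) m (f y) (f y) (c • v) =
      c • tangentCoordChange 𝓘(ℝ, C2) m (f y) (f y) v := fun y hy c v ↦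
    tangentCoordChange_smul (hfU y hy) (mem_chart_source C2 (f y)) c v
  have hframe : ∀ e : ℂ → C2, ContDiffOn ℝ ∞ e W → ContMDiffOn 𝓘(ℝ, ℂ) 𝓘(ℝ, C2).tangent ∞
      (fun y ↦ (⟨f y, tangentCoordChange 𝓘(ℝ, C2) m (f y) (f y) (e (φ y))⟩ :
        TangentBundle 𝓘(ℝ, C2) M)) U := by
    intro e he
    refine (contMDiffOn_section_iff (g := f) (m := m) hf.contMDiffOn hfU).2 ?_
    refine ((contMDiffOn_iff_contDiffOn.2 he).comp hφU fun y hy ↦ hy.2).congr fun y hy ↦ ?_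
    exact hself y hy _
  obtain ⟨ε, hε⟩ : ∃ ε : Π y : S, TangentSpace 𝓘(ℝ, ℂ) y,
      ∀ y, (show ℂ from ε y) = tangentCoordChange 𝓘(ℝ, ℂ) x y y (r (φ y)) := ⟨_, fun _ ↦ rfl⟩
  have hεr : ∀ y ∈ U, tangentCoordChange 𝓘(ℝ, ℂ) y x y (ε y) = r (φ y) := fun y hy ↦
    (congrArg (tangentCoordChange 𝓘(ℝ, ℂ) y x y) (hε y)).trans (hselfS y hy _)
  have hεs : ∀ y ∈ U, inner ℝ (ε y) (ε y) = (1 : ℝ) := by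
    intro y hy
    have h1 := hr1 (φ y) (φ.map_source hy.1)
    rw [smul_eq_mul, mul_one,
      (isHermitianForm_metricCoord hS (φ.map_source hy.1)).self_eq, ← hεr y hy] at h1
    have h2 := metricCoord_tangentCoordChange (m := x) hy.1 (show ℂ from ε y) (show ℂ from ε y)
    exact h2.symm.trans (by exact_mod_cast h1)
  -- From `dz = r φ` one gets `F_z dz = σ r φ E₁` and `F_z̄ dz̄ = τ r̄ φ̄ E₂`, hence `s = σ r` and
  -- `t = τ r̄`.
  refine ⟨U, hU, ⟨mem_chart_source ℂ x, hxW⟩,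
    ε, fun y ↦ tangentCoordChange 𝓘(ℝ, C2) m (f y) (f y) (E₁ (φ y)),
    fun y ↦ tangentCoordChange 𝓘(ℝ, C2) m (f y) (f y) (E₂ (φ y)),
    fun y ↦ σ (φ y) * r (φ y), fun y ↦ τ (φ y) * starRingEnd ℂ (r (φ y)),
    ?_, hframe E₁ hE₁, hframe E₂ hE₂, ?_, ?_, hεs, ?_, ?_, ?_, ?_, ?_⟩
  · refine (contMDiffOn_section_iff (g := fun y : S ↦ y) (m := x) contMDiffOn_id
      fun y hy ↦ hy.1).2 ?_
    refine ((contMDiffOn_iff_contDiffOn.2 (hr.mono hWt)).comp hφU fun y hy ↦ hy.2).congr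
      fun y hy ↦ ?_
    exact hεr y hy
  · exact (contMDiffOn_iff_contDiffOn.2 (hσ.mul (hr.mono hWt))).comp hφU fun y hy ↦ hy.2
  · exact (contMDiffOn_iff_contDiffOn.2 (hτ.mul
      (Complex.conjCLE.contDiff.comp_contDiffOn (hr.mono hWt)))).comp hφU fun y hy ↦ hy.2
  · intro y hy
    refine (hinner y hy _ _).trans ?_
    rw [← hermForm_re, h11 _ hy.2, Complex.one_re]
  · intro y hy
    refine (hinner y hy _ _).trans ?_
    rw [← hermForm_re, h22 _ hy.2, Complex.one_re]
  · intro y hy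
    refine (hinner y hy _ _).trans ?_
    rw [← hermForm_re, h12 _ hy.2, Complex.zero_re]
  · intro y hy
    have h1 : (Complex.I • tangentCoordChange 𝓘(ℝ, C2) m (f y) (f y) (E₂ (φ y)) : C2) =
      tangentCoordChange 𝓘(ℝ, C2) m (f y) (f y) (Complex.I • E₂ (φ y)) := (hT y hy _ _).symm
    refine (congrArg (metricAt (E := C2) (f y) _) h1).trans ((hinner y hy _ _).trans ?_)
    rw [← hermForm_im, h12 _ hy.2, Complex.zero_im]
  · intro y hy v
    have hε0 : (show ℂ from ε y) ≠ 0 := ne_zero_of_inner_self (hεs y hy)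
    have h1 := ChernMinimal.fderiv_coordMap hf hφm (m := m) hy.1 (hfU y hy) v
    have h2 : diffAt f y v = tangentCoordChange 𝓘(ℝ, C2) m (f y) (f y)
        (fderiv ℝ F (φ y) (coordDeriv φ y * (show ℂ from v))) :=
      ((congrArg (tangentCoordChange 𝓘(ℝ, C2) m (f y) (f y)) h1).trans (hself' y hy _)).symm
    have h3 : coordDeriv φ y * (show ℂ from ε y) = r (φ y) :=
      (coordDeriv_chartAt hy.1 _).trans (hεr y hy)
    have h4 := dualForm_eq hS (hεs y hy) v
    refine h2.trans (Eq.trans ?_ (congrArg₂ (· + ·) (complexSMul_eq (E := C2) (x := f y) _ _)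
      (complexSMul_eq (E := C2) (x := f y) _ _)).symm)
    rw [h4, fderiv_apply_eq, ha _ hy.2, hb _ hy.2, smul_smul, smul_smul, map_add, hT y hy, hT y hy,
      ← h3]
    generalize (show ℂ from ε y) = e at *
    generalize (show ℂ from v) = w at *
    have hε0' : starRingEnd ℂ e ≠ 0 := (map_ne_zero _).2 hε0
    congr 2
    · field_simp
    · rw [map_mul, map_mul, map_div₀]
      field_simp

end Existence

/-! ### Centred coordinates and invariance of the order. -/

section Coordinates

variable {S : Type*} [TopologicalSpace S] [ChartedSpace ℂ S]

/-- A surface has no isolated points. Hence a property cannot both hold near `x` and fail throughout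
a punctured neighbourhood, and exponents can be compared by limits along `𝓝[≠] x`. -/
lemma nhdsNE_neBot_of_chartedSpace (x : S) : (𝓝[≠] x).NeBot := by
  set φ := chartAt ℂ x
  have hx : φ x ∈ φ.target := mem_chart_target ℂ x
  have h : Tendsto φ.symm (𝓝[≠] (φ x)) (𝓝[≠] x) := by
    refine tendsto_nhdsWithin_iff.2 ⟨?_, ?_⟩
    · have h1 := φ.tendsto_symm (mem_chart_source ℂ x)
      exact h1.mono_left nhdsWithin_le_nhds
    · filter_upwards [nhdsWithin_le_nhds (φ.open_target.mem_nhds hx), self_mem_nhdsWithin]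
        with u hu hne h1
      exact hne ((φ.right_inv hu).symm.trans (congrArg φ h1))
  exact h.neBot

lemma FactorsAt.exists_bounds {a z : S → ℂ} {x : S} {n : ℕ} (h : FactorsAt a z x n) :
    ∃ (k : S → ℂ) (c K : ℝ), 0 < c ∧
      ∀ᶠ y in 𝓝 x, a y = z y ^ n * k y ∧ c ≤ ‖k y‖ ∧ ‖k y‖ ≤ K := by
  obtain ⟨V, hV, hx, k, hk, hak⟩ := h
  have hc : Tendsto (fun y ↦ ‖k y‖) (𝓝 x) (𝓝 ‖k x‖) :=
    (hk.continuousOn.continuousAt (hV.mem_nhds hx)).norm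
  have h0 : 0 < ‖k x‖ := norm_pos_iff.2 (hak x hx).1
  refine ⟨k, ‖k x‖ / 2, ‖k x‖ + 1, half_pos h0, ?_⟩
  filter_upwards [hV.mem_nhds hx, hc.eventually (lt_mem_nhds (half_lt_self h0)),
    hc.eventually (gt_mem_nhds (lt_add_one _))] with y h1 h2 h3
  exact ⟨(hak y h1).2, h2.le, h3.le⟩

lemma FactorsAt.pos_iff {a z : S → ℂ} {x : S} {n : ℕ} (h : FactorsAt a z x n) (hz : z x = 0) :
    0 < n ↔ a x = 0 := by
  obtain ⟨V, hV, hx, k, hk, hak⟩ := h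
  obtain ⟨h0, h1⟩ := hak x hx
  rw [h1, hz, Nat.pos_iff_ne_zero]
  simp [h0]

lemma IsHolomorphicCoordinateAt.eventually_ne_zero {z : OpenPartialHomeomorph S ℂ} {x : S}
    (hz : IsHolomorphicCoordinateAt z x) : ∀ᶠ y in 𝓝[≠] x, z y ≠ 0 := by
  filter_upwards [nhdsWithin_le_nhds (z.open_source.mem_nhds hz.2.1), self_mem_nhdsWithin]
    with y hy hne h0
  exact hne (z.injOn hy hz.2.1 (h0.trans hz.2.2.symm))

lemma IsHolomorphicCoordinateAt.tendsto {z : OpenPartialHomeomorph S ℂ} {x : S}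
    (hz : IsHolomorphicCoordinateAt z x) : Tendsto z (𝓝 x) (𝓝 0) := by
  have h := z.continuousAt hz.2.1
  rwa [ContinuousAt, hz.2.2] at h

lemma FactorsAt.eventually_ne_zero {a ζ : S → ℂ} {x : S} {n : ℕ} (h : FactorsAt a ζ x n)
    (hζ : ∀ᶠ y in 𝓝[≠] x, ζ y ≠ 0) : ∀ᶠ y in 𝓝[≠] x, a y ≠ 0 := by
  obtain ⟨V, hV, hx, k, hk, hak⟩ := h
  filter_upwards [nhdsWithin_le_nhds (hV.mem_nhds hx), hζ] with y hy h0
  rw [(hak y hy).2]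
  exact mul_ne_zero (pow_ne_zero _ h0) (hak y hy).1

variable [IsManifold 𝓘(ℂ) ω S]

lemma exists_isHolomorphicCoordinateAt (x : S) :
    ∃ z : OpenPartialHomeomorph S ℂ, IsHolomorphicCoordinateAt z x := by
  set T : ℂ ≃ₜ ℂ := Homeomorph.addRight (-chartAt ℂ x x) with hT
  have hTG : T.toOpenPartialHomeomorph ∈ contDiffGroupoid ω 𝓘(ℂ, ℂ) := by
    rw [contDiffGroupoid, mem_groupoid_of_pregroupoid]
    exact ⟨(contDiff_id.add contDiff_const).contDiffOn, (contDiff_id.add contDiff_const).contDiffOn⟩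
  refine ⟨(chartAt ℂ x).trans T.toOpenPartialHomeomorph, ?_, ?_, ?_⟩
  · refine mem_maximalAtlas_iff.2 fun e he ↦ ⟨?_, ?_⟩
    · rw [OpenPartialHomeomorph.trans_symm_eq_symm_trans_symm, OpenPartialHomeomorph.trans_assoc]
      exact StructureGroupoid.trans _ (StructureGroupoid.symm _ hTG)
        (StructureGroupoid.compatible _ (chart_mem_atlas ℂ x) he)
    · rw [← OpenPartialHomeomorph.trans_assoc]
      exact StructureGroupoid.trans _
        (StructureGroupoid.compatible _ he (chart_mem_atlas ℂ x)) hTG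
  · simp
  · simp [hT]

/-- Two holomorphic coordinates centred at the same point are comparable. -/
lemma IsHolomorphicCoordinateAt.exists_norm_le {z z' : OpenPartialHomeomorph S ℂ} {x : S}
    (hz : IsHolomorphicCoordinateAt z x) (hz' : IsHolomorphicCoordinateAt z' x) :
    ∃ C : ℝ, 0 < C ∧ ∀ᶠ y in 𝓝 x, ‖z y‖ ≤ C * ‖z' y‖ := by
  have h1 := (contDiffAt_transition hz'.1 hz.1 hz'.2.1 hz.2.1).differentiableAt (by simp)
  rw [hz'.2.2] at h1
  -- The transition map fixes `0`, so differentiability there bounds it by a multiple of its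
  -- argument.
  obtain ⟨C, hC, h2⟩ := h1.isBigO_sub.exists_pos
  have h0 : (z ∘ z'.symm) 0 = 0 := by
    have h3 := z'.left_inv hz'.2.1
    rw [hz'.2.2] at h3
    rw [Function.comp_apply, h3, hz.2.2]
  refine ⟨C, hC, ?_⟩
  filter_upwards [hz'.tendsto.eventually h2.bound, z'.open_source.mem_nhds hz'.2.1] with y hy hs
  rwa [h0, sub_zero, sub_zero, Function.comp_apply, z'.left_inv hs] at hy

/-- Functions of the same absolute value have the same order, in comparable coordinates. -/
lemma FactorsAt.order_unique {a a' ζ ζ' : S → ℂ} {z z' : OpenPartialHomeomorph S ℂ} {x : S}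
    {n n' : ℕ} (hz : IsHolomorphicCoordinateAt z x) (hz' : IsHolomorphicCoordinateAt z' x)
    (hζ : ∀ y, ‖ζ y‖ = ‖z y‖) (hζ' : ∀ y, ‖ζ' y‖ = ‖z' y‖)
    (h : FactorsAt a ζ x n) (h' : FactorsAt a' ζ' x n') (ha : ∀ᶠ y in 𝓝 x, ‖a y‖ = ‖a' y‖) :
    n = n' := by
  obtain ⟨k, c, K, hc, hk⟩ := h.exists_bounds
  obtain ⟨k', c', K', hc', hk'⟩ := h'.exists_bounds
  obtain ⟨C, hC, hzz⟩ := hz.exists_norm_le hz'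
  obtain ⟨C', hC', hzz'⟩ := hz'.exists_norm_le hz
  have := nhdsNE_neBot_of_chartedSpace x
  have hle : 𝓝[≠] x ≤ 𝓝 x := nhdsWithin_le_nhds
  -- Only absolute values enter, so `ζ` and `ζ'` may be the coordinates (for `s`) or their
  -- conjugates (for `t`).
  refine exponent_unique (l := 𝓝[≠] x) (ζ := ζ) (ξ := ζ') (h := k) (k := k') ?_ ?_ hC ?_ hC' ?_ hc
    (hle (hk.mono fun y hy ↦ hy.2.1)) (hle (hk.mono fun y hy ↦ hy.2.2)) hc'
    (hle (hk'.mono fun y hy ↦ hy.2.1)) (hle (hk'.mono fun y hy ↦ hy.2.2)) (hle ?_)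
  · rw [tendsto_zero_iff_norm_tendsto_zero]
    simp only [hζ]
    simpa using (hz.tendsto.mono_left hle).norm
  · filter_upwards [hz.eventually_ne_zero] with y hy
    rwa [← norm_ne_zero_iff, hζ, norm_ne_zero_iff]
  · filter_upwards [hle hzz] with y hy
    rwa [hζ, hζ']
  · filter_upwards [hle hzz'] with y hy
    rwa [hζ, hζ']
  · filter_upwards [hk, hk', ha] with y h1 h2 h3
    rw [← h1.1, ← h2.1, h3]

end Coordinates

/-! ### Connectedness, genericity and the conclusion. -/

/-- In a preconnected space, a property that near every point either holds everywhere or fails off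
that point holds locally everywhere or nowhere. -/
lemma forall_or_forall_not_eventually {X : Type*} [TopologicalSpace X] [PreconnectedSpace X]
    [∀ x : X, (𝓝[≠] x).NeBot] {P : X → Prop}
    (hP : ∀ x, (∀ᶠ y in 𝓝 x, P y) ∨ ∀ᶠ y in 𝓝[≠] x, ¬ P y) :
    (∀ x, P x) ∨ ∀ x, ∀ᶠ y in 𝓝[≠] x, ¬ P y := by
  set A : Set X := {x | ∀ᶠ y in 𝓝 x, P y} with hA
  have hopen : IsOpen A := isOpen_setOfPred_eventually_nhds
  have hcl : IsClosed A := by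
    refine ⟨isOpen_iff_mem_nhds.2 fun x hx ↦ ?_⟩
    -- Outside `A` the second alternative holds: nearby points other than `x` violate `P`, so they
    -- lie outside `A` too.
    filter_upwards [eventually_nhdsWithin_iff.1 ((hP x).resolve_left hx)] with y hy hyA
    by_cases hyx : y = x
    · exact hx (hyx ▸ hyA)
    · exact hy hyx (Eventually.self_of_nhds hyA)
  rcases isClopen_iff.1 ⟨hcl, hopen⟩ with h | h
  · exact Or.inr fun x ↦ (hP x).resolve_left fun hx ↦ (h ▸ hx : x ∈ (∅ : Set X))
  · exact Or.inl fun x ↦ Eventually.self_of_nhds (h ▸ mem_univ x : x ∈ A)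

section Main

set_option linter.unusedSectionVars false

variable {S : Type*} [TopologicalSpace S] [ChartedSpace ℂ S] [IsManifold 𝓘(ℂ) ω S]
  [Bundle.RiemannianBundle (fun x : S ↦ TangentSpace 𝓘(ℝ, ℂ) x)]
  [IsContMDiffRiemannianBundle 𝓘(ℝ, ℂ) ∞ ℂ (fun x : S ↦ TangentSpace 𝓘(ℝ, ℂ) x)]
  {M : Type*} [TopologicalSpace M] [ChartedSpace C2 M] [IsManifold 𝓘(ℂ, C2) ω M]
  [Bundle.RiemannianBundle (fun x : M ↦ TangentSpace 𝓘(ℝ, C2) x)]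
  [IsContMDiffRiemannianBundle 𝓘(ℝ, C2) ∞ C2 (fun x : M ↦ TangentSpace 𝓘(ℝ, C2) x)]
  {f : S → M}

/-- Near every point, the anticomplex points of a Chern minimal immersion are everything or isolated,
and so are the complex points. -/
lemma eventually_or_eventually_not (hS : IsHermitianMetric ℂ S) (hM : IsHermitianMetric C2 M)
    (hf : ContMDiff 𝓘(ℝ, ℂ) 𝓘(ℝ, C2) ∞ f) (hiso : IsIsometricMap f) (hmin : IsChernMinimal f)
    (x : S) :
    ((∀ᶠ y in 𝓝 x, IsAnticomplexPoint f y) ∨ ∀ᶠ y in 𝓝[≠] x, ¬ IsAnticomplexPoint f y) ∧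
      ((∀ᶠ y in 𝓝 x, IsComplexPoint f y) ∨ ∀ᶠ y in 𝓝[≠] x, ¬ IsComplexPoint f y) := by
  obtain ⟨U, hU, hx, ε, e₁, e₂, s, t, h⟩ := exists_isAdaptedFrame hS hM hiso hf x
  obtain ⟨z, hz⟩ := exists_isHolomorphicCoordinateAt x
  have hUx := hU.mem_nhds hx
  have hst := h.eventually_zero_or_factorsAt hS hM hf hmin hU hx hz
  refine ⟨hst.1.imp ?_ ?_, hst.2.imp ?_ ?_⟩
  · intro h0
    filter_upwards [hUx, h0] with y hy h1
    exact (h.isAnticomplexPoint_iff hS hy).2 h1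
  · rintro ⟨n, hn⟩
    filter_upwards [nhdsWithin_le_nhds hUx, hn.eventually_ne_zero hz.eventually_ne_zero]
      with y hy h1 h2
    exact h1 ((h.isAnticomplexPoint_iff hS hy).1 h2)
  · intro h0
    filter_upwards [hUx, h0] with y hy h1
    exact (h.isComplexPoint_iff hS hy).2 h1
  · rintro ⟨n, hn⟩
    filter_upwards [nhdsWithin_le_nhds hUx, hn.eventually_ne_zero
      (hz.eventually_ne_zero.mono fun y hy ↦ (map_ne_zero _).2 hy)] with y hy h1 h2
    exact h1 ((h.isComplexPoint_iff hS hy).1 h2)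

variable {U : Set S} {ε : Π x : S, TangentSpace 𝓘(ℝ, ℂ) x}
  {e₁ e₂ : Π x : S, TangentSpace 𝓘(ℝ, C2) (f x)} {s t : S → ℂ}

/-- The orders of the coefficients of an adapted frame are finite at a point near which the complex
and the anticomplex points are isolated. -/
lemma IsAdaptedFrame.exists_factorsAt (hS : IsHermitianMetric ℂ S)
    (hM : IsHermitianMetric C2 M) (hf : ContMDiff 𝓘(ℝ, ℂ) 𝓘(ℝ, C2) ∞ f) (hmin : IsChernMinimal f)
    (hU : IsOpen U) (h : IsAdaptedFrame f U ε e₁ e₂ s t) {x : S} (hx : x ∈ U)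
    (hanti : ∀ᶠ y in 𝓝[≠] x, ¬ IsAnticomplexPoint f y)
    (hcomp : ∀ᶠ y in 𝓝[≠] x, ¬ IsComplexPoint f y)
    {z : OpenPartialHomeomorph S ℂ} (hz : IsHolomorphicCoordinateAt z x) :
    (∃ n, FactorsAt s z x n) ∧ ∃ n, FactorsAt t (fun y ↦ starRingEnd ℂ (z y)) x n := by
  have := nhdsNE_neBot_of_chartedSpace x
  have hst := h.eventually_zero_or_factorsAt hS hM hf hmin hU hx hz
  have hUx : ∀ᶠ y in 𝓝 x, y ∈ U := hU.mem_nhds hx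
  -- A coefficient vanishing near `x` would make every nearby point anticomplex, respectively
  -- complex, against the assumption on a nonempty punctured neighbourhood.
  refine ⟨hst.1.resolve_left fun h0 ↦ ?_, hst.2.resolve_left fun h0 ↦ ?_⟩
  · obtain ⟨y, h1, h2, h3⟩ :=
      (hanti.and ((hUx.and h0).filter_mono nhdsWithin_le_nhds)).exists
    exact h1 ((h.isAnticomplexPoint_iff hS h2).2 h3)
  · obtain ⟨y, h1, h2, h3⟩ :=
      (hcomp.and ((hUx.and h0).filter_mono nhdsWithin_le_nhds)).exists
    exact h1 ((h.isComplexPoint_iff hS h2).2 h3)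

end Main

end ChernMinimal
end

theorem proposition2p3
    -- `S` is a Riemann surface with a metric conformal to its complex structure
    {S : Type*} [TopologicalSpace S] [T2Space S] [ConnectedSpace S]
    [ChartedSpace ℂ S] [IsManifold 𝓘(ℂ) ω S]
    [Bundle.RiemannianBundle (fun x : S ↦ TangentSpace 𝓘(ℝ, ℂ) x)]
    [IsContMDiffRiemannianBundle 𝓘(ℝ, ℂ) ∞ ℂ (fun x : S ↦ TangentSpace 𝓘(ℝ, ℂ) x)]
    (hS : ChernMinimal.IsHermitianMetric ℂ S)
    -- `M` is a Hermitian surface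
    {M : Type*} [TopologicalSpace M] [T2Space M]
    [ChartedSpace ChernMinimal.C2 M] [IsManifold 𝓘(ℂ, ChernMinimal.C2) ω M]
    [Bundle.RiemannianBundle (fun x : M ↦ TangentSpace 𝓘(ℝ, ChernMinimal.C2) x)]
    [IsContMDiffRiemannianBundle 𝓘(ℝ, ChernMinimal.C2) ∞ ChernMinimal.C2
      (fun x : M ↦ TangentSpace 𝓘(ℝ, ChernMinimal.C2) x)]
    (hM : ChernMinimal.IsHermitianMetric ChernMinimal.C2 M)
    -- `f` is a generic Chern minimal isometric immersion
    (f : S → M) (hf : ContMDiff 𝓘(ℝ, ℂ) 𝓘(ℝ, ChernMinimal.C2) ∞ f)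
    (hiso : ChernMinimal.IsIsometricMap f)
    (hmin : ChernMinimal.IsChernMinimal f)
    (hhol : ¬ ∀ x : S, ChernMinimal.IsComplexPoint f x)
    (hantihol : ¬ ∀ x : S, ChernMinimal.IsAnticomplexPoint f x) :
    -- complex and anticomplex points are isolated
    (∀ x : S, ChernMinimal.IsComplexPoint f x ∨ ChernMinimal.IsAnticomplexPoint f x →
      ∀ᶠ y in 𝓝[≠] x,
        ¬ ChernMinimal.IsComplexPoint f y ∧ ¬ ChernMinimal.IsAnticomplexPoint f y) ∧
    -- adapted frames exist near every point
    (∀ x : S, ∃ U : Set S, IsOpen U ∧ x ∈ U ∧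
      ∃ ε e₁ e₂ s t, ChernMinimal.IsAdaptedFrame f U ε e₁ e₂ s t) ∧
    -- orders exist, and do not depend on the adapted frame or the holomorphic coordinate
    (∀ x : S, ∃ p q : ℕ,
      (0 < p ↔ ChernMinimal.IsAnticomplexPoint f x) ∧
      (0 < q ↔ ChernMinimal.IsComplexPoint f x) ∧
      ∀ (U : Set S) (ε : Π x : S, TangentSpace 𝓘(ℝ, ℂ) x)
        (e₁ e₂ : Π x : S, TangentSpace 𝓘(ℝ, ChernMinimal.C2) (f x)) (s t : S → ℂ),
        IsOpen U → x ∈ U → ChernMinimal.IsAdaptedFrame f U ε e₁ e₂ s t →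
        ∀ z : OpenPartialHomeomorph S ℂ, ChernMinimal.IsHolomorphicCoordinateAt z x →
          ∀ n : ℕ,
            (ChernMinimal.FactorsAt s z x n ↔ n = p) ∧
            (ChernMinimal.FactorsAt t (fun y ↦ starRingEnd ℂ (z y)) x n ↔ n = q)) := by
  have hne : ∀ x : S, (𝓝[≠] x).NeBot := ChernMinimal.nhdsNE_neBot_of_chartedSpace
  -- Connectedness leaves two cases, anticomplex everywhere or isolated; genericity rules out the
  -- first.
  have hanti : ∀ x : S, ∀ᶠ y in 𝓝[≠] x, ¬ ChernMinimal.IsAnticomplexPoint f y :=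
    (ChernMinimal.forall_or_forall_not_eventually fun x ↦
      (ChernMinimal.eventually_or_eventually_not hS hM hf hiso hmin x).1).resolve_left hantihol
  have hcomp : ∀ x : S, ∀ᶠ y in 𝓝[≠] x, ¬ ChernMinimal.IsComplexPoint f y :=
    (ChernMinimal.forall_or_forall_not_eventually fun x ↦
      (ChernMinimal.eventually_or_eventually_not hS hM hf hiso hmin x).2).resolve_left hhol
  have hframe := ChernMinimal.exists_isAdaptedFrame hS hM hiso hf
  refine ⟨fun x _ ↦ (hcomp x).and (hanti x), hframe, fun x ↦ ?_⟩
  -- One frame and one coordinate define `p` and `q`; all others are compared with them.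
  obtain ⟨U', hU', hx', ε', e₁', e₂', s', t', h'⟩ := hframe x
  obtain ⟨z', hz'⟩ := ChernMinimal.exists_isHolomorphicCoordinateAt x
  obtain ⟨⟨p, hp⟩, q, hq⟩ :=
    h'.exists_factorsAt hS hM hf hmin hU' hx' (hanti x) (hcomp x) hz'
  refine ⟨p, q, (hp.pos_iff hz'.2.2).trans (h'.isAnticomplexPoint_iff hS hx').symm,
    (hq.pos_iff (by simp [hz'.2.2])).trans (h'.isComplexPoint_iff hS hx').symm, ?_⟩
  intro U ε e₁ e₂ s t hU hx h z hz n
  -- For the given frame and coordinate some exponents exist; uniqueness forces them to be `p` and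
  -- `q`, which yields the converse implications.
  obtain ⟨⟨p₀, hp₀⟩, q₀, hq₀⟩ :=
    h.exists_factorsAt hS hM hf hmin hU hx (hanti x) (hcomp x) hz
  have hmem : ∀ᶠ y in 𝓝 x, y ∈ U ∧ y ∈ U' := Filter.inter_mem (hU.mem_nhds hx) (hU'.mem_nhds hx')
  have hs : ∀ m, ChernMinimal.FactorsAt s z x m → m = p := fun m hm ↦
    hm.order_unique hz hz' (fun _ ↦ rfl) (fun _ ↦ rfl) hp
      (hmem.mono fun y hy ↦ h.norm_s_eq hS hM h' hy.1 hy.2)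
  have ht : ∀ m, ChernMinimal.FactorsAt t (fun y ↦ starRingEnd ℂ (z y)) x m → m = q := fun m hm ↦
    hm.order_unique hz hz' (fun y ↦ Complex.norm_conj _) (fun y ↦ Complex.norm_conj _) hq
      (hmem.mono fun y hy ↦ h.norm_t_eq hS hM h' hy.1 hy.2)
  exact ⟨⟨hs n, fun hn ↦ hn ▸ hs p₀ hp₀ ▸ hp₀⟩, ⟨ht n, fun hn ↦ hn ▸ ht q₀ hq₀ ▸ hq₀⟩⟩
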